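/- \textbf{Setting.} Let $N\ge 1$, $\ell\ge 2$ an integer, $\beta\in[0,1]$. Let $\mathfrak C$ be the class of closures $E$ of open sets of $\mathbb R^N$ with compact boundary of class $C^{\ell,\beta}$. We say $E_n\to E$ in $\mathfrak C$ if $\partial E$ and (for large $n$) $\partial E_n$ are covered by finitely many open cylinders, in each of which $E$ and (for large $n$) $E_n$ are the regions on the same side of graphs of $C^{\ell,\beta}$ functions over the base of the cylinder, these functions converge in $C^{\ell,\beta}$, and the limit graph stays away from the top and bottom of the cylinder. Let $\kappa(x,E)\in\mathbb R$ be given for $E\in\mathfrak C$, $x\in\partial E$, such that: A) if $E\subseteq F$ are in $\mathfrak C$ and $x\in\partial E\cap\partial F$, then $\kappa(x,F)\le\kappa(x,E)$; B) $\kappa(x,E)=\kappa(x+y,E+y)$ for all $E\in\mathfrak C$, $x\in\partial E$, $y\in\mathbb R^N$; C) if $E_n\to E$ in $\mathfrak C$ and $\partial E_n\ni x_n\to x\in\partial E$, then $\kappa(x_n,E_n)\to\kappa(x,E)$; D) there is $K>0$ with $\underline c(\rho):=\min_{x\in\partial B_\rho}\min\{\kappa(x,\overline{B_\rho}),-\kappa(x,\mathbb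 R^N\setminus B_\rho)\}>-K$ for all $\rho>0$. Put $\overline c(\rho):=\max_{x\in\partial B_\rho}\max\{\kappa(x,\overline{B_\rho}),-\kappa(x,\mathbb R^N\setminus B_\rho)\}$, where $B_\rho$ is the open ball centred at $0$. Let $\mathcal F$ be the set of $f\in C^\infty([0,\infty))$ with $f(0)=f'(0)=f''(0)=0$, $f''(r)>0$ for all small $r>0$, $f$ constant on some $[M,\infty)$, and $\lim_{\rho\to0^+}f'(\rho)\,\overline c(\rho)=0$. Fix $T>0$. A function on $\mathbb R^N\times J$, $J\subseteq[0,T]$, is \emph{constant outside a compact set} if there is a compact $\mathcal K\subseteq\mathbb R^N$ such that at each time $t\in J$ it is constant on $\mathbb R^N\setminus\mathcal K$ (the constant may depend on $t$). Let $\hat z=(\hat x,\hat t)\in\mathbb R^N\times(0,T)$ and let $A\subseteq(0,T)$ be an open interval containing $\hat t$. A function $\varphi\in C^0(\mathbb R^N\times\overline A)$ is \emph{admissible} at $\hat z$ if it is $C^2$ near $\hat z$, constant outside a compact set, and, in case $D\varphi(\hat z)=0$, there are $f\in\mathcal F$ and $\omega\in C^\infty([0,\infty))$ with $\omega(0)=\omega'(0)=0$,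 $\omega(r)>0$ for $r>0$, such that $|\varphi(x,t)-\varphi(\hat z)-\varphi_t(\hat z)(t-\hat t)|\le f(|x-\hat x|)+\omega(|t-\hat t|)$ on $\mathbb R^N\times A$. Here $D$ denotes the spatial gradient. Consider the Cauchy problem $$u_t(x,t)+|Du(x,t)|\,\kappa\big(x,\{y:u(y,t)\ge u(x,t)\}\big)=0,\qquad u(\cdot,0)=u_0. \tag{1}$$ An upper semicontinuous $u:\mathbb R^N\times[0,T]\to\mathbb R$, constant outside a compact set, is a \emph{viscosity subsolution} of (1) if $u(\cdot,0)\le u_0$ and, for every $z=(x,t)\in\mathbb R^N\times(0,T)$, every open interval $A\subseteq(0,T)$ containing $t$ and every $\varphi\in C^0(\mathbb R^N\times\overline A)$ that is $C^\infty$ on $\mathbb R^N\times A$, is admissible at $z$ and is such that $u-\varphi$ has a maximum over $\mathbb R^N\times\overline A$ at $z$: (i) if $D\varphi(z)=0$, then $\varphi_t(z)\le0$; (ii) if the level set $\{\varphi(\cdot,t)=\varphi(z)\}$ is noncritical (that is, $D\varphi(\cdot,t)\ne0$ on it), then $\varphi_t(z)+|D\varphi(z)|\,\kappa(x,\{y:\varphi(y,t)\ge\varphi(z)\})\le0$.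 A lower semicontinuous $u:\mathbb R^N\times[0,T]\to\mathbb R$, constant outside a compact set, is a \emph{viscosity supersolution} if $u(\cdot,0)\ge u_0$ and, for all such $\varphi$ with minimum in place of maximum: (i) if $D\varphi(z)=0$, then $\varphi_t(z)\ge0$; (ii) if the level set is noncritical, then $\varphi_t(z)+|D\varphi(z)|\,\kappa(x,\overline{\{y:\varphi(y,t)>\varphi(z)\}})\ge0$. A function $u:\mathbb R^N\times[0,T]\to\mathbb R$ is a \emph{viscosity solution} of (1) if its upper semicontinuous envelope is a (real-valued) subsolution and its lower semicontinuous envelope is a (real-valued) supersolution. \textbf{Theorem.} Let $\kappa$ satisfy A)--D) and let $R,T>0$. There is a constant $R'>R$, depending only on $\kappa,R,T$, such that for every $C_0\in\mathbb R$ and every uniformly continuous $u_0:\mathbb R^N\to\mathbb R$ with $u_0=C_0$ for $|x|\ge R$ there exists a viscosity solution $u:\mathbb R^N\times[0,T]\to\mathbb R$ of (1) with $u(x,t)=C_0$ for all $|x|\ge R'$ and $t\in[0,T]$. -/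

import Mathlib

open Set Filter Topology Metric
open scoped ContDiff InnerProductSpace

/-- Euclidean space `ℝ^N`. -/
abbrev Space (N : ℕ) : Type := EuclideanSpace ℝ (Fin N)

/-! ### Sets of class `C^{ℓ,β}` and their convergence -/

/-- `g` is of class `C^{ℓ,β}` on the open set `s`: it is `C^ℓ` with bounded derivatives up to
order `ℓ`, and the derivative of order `ℓ` is `β`-Hölder (no condition for `β = 0` beyond
boundedness, Lipschitz for `β = 1`). -/
def IsCHolderOn {V : Type*} [NormedAddCommGroup V] [NormedSpace ℝ V]
    (ℓ : ℕ) (β : ℝ) (g : V → ℝ) (s : Set V) : Prop :=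
  ContDiffOn ℝ ℓ g s ∧
  ∃ C : ℝ,
    (∀ k ≤ ℓ, ∀ x ∈ s, ‖iteratedFDeriv ℝ k g x‖ ≤ C) ∧
    (∀ x ∈ s, ∀ y ∈ s,
      ‖iteratedFDeriv ℝ ℓ g x - iteratedFDeriv ℝ ℓ g y‖ ≤ C * dist x y ^ β)

/-- `g n → g` in the norm of `C^{ℓ,β}` on the open set `s`. -/
def TendstoCHolderOn {V : Type*} [NormedAddCommGroup V] [NormedSpace ℝ V]
    (ℓ : ℕ) (β : ℝ) (g : ℕ → V → ℝ) (g₀ : V → ℝ) (s : Set V) : Prop :=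
  ∀ ε > 0, ∀ᶠ n in atTop,
    (∀ k ≤ ℓ, ∀ x ∈ s, ‖iteratedFDeriv ℝ k (g n) x - iteratedFDeriv ℝ k g₀ x‖ ≤ ε) ∧
    (∀ x ∈ s, ∀ y ∈ s,
      ‖(iteratedFDeriv ℝ ℓ (g n) x - iteratedFDeriv ℝ ℓ g₀ x) -
        (iteratedFDeriv ℝ ℓ (g n) y - iteratedFDeriv ℝ ℓ g₀ y)‖ ≤ ε * dist x y ^ β)

/-- The data of an open cylinder: centre, unit axis, radius and (half) height. -/
structure Cylinder (N : ℕ) where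
  center : Space N
  axis : Space N
  norm_axis : ‖axis‖ = 1
  radius : ℝ
  radius_pos : 0 < radius
  height : ℝ
  height_pos : 0 < height

namespace Cylinder

variable {N : ℕ}

/-- The hyperplane orthogonal to the axis, over which graphs are taken. -/
abbrev Base (Z : Cylinder N) : Type := ↥((ℝ ∙ Z.axis)ᗮ)

/-- The component of `y - center` in the hyperplane orthogonal to the axis. -/
noncomputable def horiz (Z : Cylinder N) (y : Space N) : Z.Base :=
  ((ℝ ∙ Z.axis)ᗮ).orthogonalProjectionOnto (y - Z.center)

/-- The component of `y - center` along the axis. -/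
noncomputable def vert (Z : Cylinder N) (y : Space N) : ℝ := ⟪Z.axis, y - Z.center⟫_ℝ

/-- The open cylinder as a set. -/
def carrier (Z : Cylinder N) : Set (Space N) :=
  {y | Z.horiz y ∈ ball (0 : Z.Base) Z.radius ∧ |Z.vert y| < Z.height}

end Cylinder

/-- The open set `U` has a boundary of class `C^{ℓ,β}`: near every boundary point, in a suitable
cylinder, `U` is the region strictly below the graph of a function of class `C^{ℓ,β}`. -/
def HasCHolderBoundary {N : ℕ} (ℓ : ℕ) (β : ℝ) (U : Set (Space N)) : Prop :=
  ∀ x ∈ frontier U, ∃ Z : Cylinder N, x ∈ Z.carrier ∧ ∃ g : Z.Base → ℝ,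
    IsCHolderOn ℓ β g (ball 0 Z.radius) ∧
    U ∩ Z.carrier = {y ∈ Z.carrier | Z.vert y < g (Z.horiz y)}

/-- The class `ℭ`: closures of open sets with compact boundary of class `C^{ℓ,β}`. -/
def IsRegularSet {N : ℕ} (ℓ : ℕ) (β : ℝ) (E : Set (Space N)) : Prop :=
  ∃ U : Set (Space N), IsOpen U ∧ IsCompact (frontier U) ∧ HasCHolderBoundary ℓ β U ∧
    E = closure U

/-- Convergence `E n → E` in `ℭ`: the boundaries are covered by finitely many cylinders, in each of
which `E` and (for large `n`) `E n` are the regions below graphs of functions of class `C^{ℓ,β}`,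
and these functions converge in `C^{ℓ,β}`. The limit graphs stay away from the tops and bottoms of the
cylinders. -/
def TendstoRegular {N : ℕ} (ℓ : ℕ) (β : ℝ) (E : ℕ → Set (Space N)) (E₀ : Set (Space N)) : Prop :=
  ∃ (m : ℕ) (Z : Fin m → Cylinder N)
    (g : (i : Fin m) → ℕ → (Z i).Base → ℝ) (g₀ : (i : Fin m) → (Z i).Base → ℝ),
    frontier E₀ ⊆ ⋃ i, (Z i).carrier ∧
    (∀ᶠ n in atTop, frontier (E n) ⊆ ⋃ i, (Z i).carrier) ∧
    ∀ i,
      IsCHolderOn ℓ β (g₀ i) (ball 0 (Z i).radius) ∧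
      (∀ v ∈ ball (0 : (Z i).Base) (Z i).radius, |g₀ i v| ≤ (Z i).height / 2) ∧
      E₀ ∩ (Z i).carrier = {y ∈ (Z i).carrier | (Z i).vert y ≤ g₀ i ((Z i).horiz y)} ∧
      (∀ᶠ n in atTop,
        IsCHolderOn ℓ β (g i n) (ball 0 (Z i).radius) ∧
        E n ∩ (Z i).carrier = {y ∈ (Z i).carrier | (Z i).vert y ≤ g i n ((Z i).horiz y)}) ∧
      TendstoCHolderOn ℓ β (g i) (g₀ i) (ball 0 (Z i).radius)

/-! ### Nonlocal curvatures -/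

/-- `c̄(ρ)`: the maximum over `x ∈ ∂B_ρ` of `κ(x, B_ρ)` and `-κ(x, ℝ^N ∖ B_ρ)`; the ball is taken
closed and its complement is taken as the complement of the open ball, so that both belong
to `ℭ`. -/
noncomputable def cUpper {N : ℕ} (κ : Space N → Set (Space N) → ℝ) (ρ : ℝ) : ℝ :=
  sSup ((fun x => max (κ x (closedBall 0 ρ)) (-κ x (ball 0 ρ)ᶜ)) '' sphere 0 ρ)

/-- `c̲(ρ)`: the minimum over `x ∈ ∂B_ρ` of `κ(x, B_ρ)` and `-κ(x, ℝ^N ∖ B_ρ)`. -/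
noncomputable def cLower {N : ℕ} (κ : Space N → Set (Space N) → ℝ) (ρ : ℝ) : ℝ :=
  sInf ((fun x => min (κ x (closedBall 0 ρ)) (-κ x (ball 0 ρ)ᶜ)) '' sphere 0 ρ)

/-- The axioms A)–D) of a nonlocal curvature. Only the values `κ x E` with `E ∈ ℭ` and `x ∈ ∂E`
are constrained. -/
structure IsNonlocalCurvature {N : ℕ} (ℓ : ℕ) (β : ℝ) (κ : Space N → Set (Space N) → ℝ) :
    Prop where
  /-- A) monotonicity -/
  mono : ∀ E F : Set (Space N), IsRegularSet ℓ β E → IsRegularSet ℓ β F → E ⊆ F →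
    ∀ x ∈ frontier F ∩ frontier E, κ x F ≤ κ x E
  /-- B) translational invariance -/
  translate : ∀ E : Set (Space N), IsRegularSet ℓ β E → ∀ x ∈ frontier E, ∀ y : Space N,
    κ x E = κ (x + y) ((fun z => z + y) '' E)
  /-- C) continuity -/
  continuous : ∀ (E : ℕ → Set (Space N)) (E₀ : Set (Space N)),
    (∀ n, IsRegularSet ℓ β (E n)) → IsRegularSet ℓ β E₀ → TendstoRegular ℓ β E E₀ →
    ∀ (x : ℕ → Space N) (x₀ : Space N), (∀ n, x n ∈ frontier (E n)) → x₀ ∈ frontier E₀ →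
      Tendsto x atTop (𝓝 x₀) → Tendsto (fun n => κ (x n) (E n)) atTop (𝓝 (κ x₀ E₀))
  /-- D) curvature of the balls -/
  balls : ∃ K > 0, ∀ ρ > 0, -K < cLower κ ρ

/-! ### Test functions -/

/-- The family `𝓕` of functions `f ∈ C^∞([0,∞))` with `f(0) = f'(0) = f''(0) = 0`, `f'' > 0` at
small positive arguments, `f` constant near infinity and `f'(ρ) c̄(ρ) → 0` as `ρ → 0⁺`. -/
structure InFamilyF {N : ℕ} (κ : Space N → Set (Space N) → ℝ) (f : ℝ → ℝ) : Prop where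
  smooth : ContDiffOn ℝ ∞ f (Ici 0)
  zero : f 0 = 0
  deriv_zero : derivWithin f (Ici 0) 0 = 0
  deriv2_zero : iteratedDerivWithin 2 f (Ici 0) 0 = 0
  deriv2_pos : ∀ᶠ r in 𝓝[>] (0 : ℝ), 0 < iteratedDerivWithin 2 f (Ici 0) r
  eventually_const : ∃ M > 0, ∃ c : ℝ, ∀ r ≥ M, f r = c
  tendsto : Tendsto (fun ρ => derivWithin f (Ici 0) ρ * cUpper κ ρ) (𝓝[>] 0) (𝓝 0)

/-- The class of moduli `σ ∈ C^∞([0,∞))` with `σ(0) = σ'(0) = 0` and `σ(r) > 0` for `r ≠ 0`. -/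
structure IsTimeModulus (σ : ℝ → ℝ) : Prop where
  smooth : ContDiffOn ℝ ∞ σ (Ici 0)
  zero : σ 0 = 0
  deriv_zero : derivWithin σ (Ici 0) 0 = 0
  pos : ∀ r > 0, 0 < σ r

/-- Spatial gradient `Dφ(x,t)`. -/
noncomputable def spaceGrad {N : ℕ} (φ : Space N × ℝ → ℝ) (x : Space N) (t : ℝ) : Space N :=
  gradient (fun y => φ (y, t)) x

/-- Time derivative `φ_t(x,t)`. -/
noncomputable def timeDeriv {N : ℕ} (φ : Space N × ℝ → ℝ) (x : Space N) (t : ℝ) : ℝ :=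
  deriv (fun s => φ (x, s)) t

/-- `φ`, a function on `ℝ^N × [a,b]` (the closure of `ℝ^N × A`, `A = (a,b) ∋ t`), is admissible at
the point `(x,t)`. -/
structure IsAdmissible {N : ℕ} (κ : Space N → Set (Space N) → ℝ) (a b : ℝ)
    (φ : Space N × ℝ → ℝ) (x : Space N) (t : ℝ) : Prop where
  continuousOn : ContinuousOn φ (univ ×ˢ Icc a b)
  contDiffAt : ContDiffAt ℝ 2 φ (x, t)
  const_outside : ∃ K : Set (Space N), IsCompact K ∧ ∃ c : ℝ → ℝ,
    ∀ s ∈ Icc a b, ∀ y ∉ K, φ (y, s) = c s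
  flat : spaceGrad φ x t = 0 → ∃ f σ : ℝ → ℝ, InFamilyF κ f ∧ IsTimeModulus σ ∧
    ∀ y : Space N, ∀ s ∈ Ioo a b,
      |φ (y, s) - φ (x, t) - timeDeriv φ x t * (s - t)| ≤ f ‖y - x‖ + σ |s - t|

/-- `φ` is a `C^∞` test function on `ℝ^N × [a,b]`, with `t ∈ (a,b) ⊆ (0,T)`, which is admissible
at `(x,t)`. -/
def IsSmoothTest {N : ℕ} (κ : Space N → Set (Space N) → ℝ) (T a b : ℝ)
    (φ : Space N × ℝ → ℝ) (x : Space N) (t : ℝ) : Prop :=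
  0 ≤ a ∧ b ≤ T ∧ t ∈ Ioo a b ∧ ContDiffOn ℝ ∞ φ (univ ×ˢ Ioo a b) ∧ IsAdmissible κ a b φ x t

/-- The level set `{φ(·,t) = φ(x,t)}` is noncritical. -/
def NoncriticalLevel {N : ℕ} (φ : Space N × ℝ → ℝ) (x : Space N) (t : ℝ) : Prop :=
  ∀ y, φ (y, t) = φ (x, t) → spaceGrad φ y t ≠ 0

/-! ### Viscosity solutions -/

/-- The space-time domain `ℝ^N × [0,T]`. -/
abbrev SpaceTime (N : ℕ) (T : ℝ) : Type := Space N × ↥(Icc (0 : ℝ) T)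

/-- `u` is constant outside a compact set of `ℝ^N`, the constant possibly depending on time. -/
def ConstOutsideCompact {N : ℕ} {T : ℝ} (u : SpaceTime N T → ℝ) : Prop :=
  ∃ K : Set (Space N), IsCompact K ∧ ∃ c : ↥(Icc (0 : ℝ) T) → ℝ, ∀ t, ∀ x ∉ K, u (x, t) = c t

/-- Viscosity subsolutions of the level set Cauchy problem. -/
structure IsViscositySubsolution {N : ℕ} {T : ℝ} (κ : Space N → Set (Space N) → ℝ)
    (u₀ : Space N → ℝ) (u : SpaceTime N T → ℝ) : Prop where
  usc : UpperSemicontinuous u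
  const_outside : ConstOutsideCompact u
  initial : ∀ (x : Space N) (t : ↥(Icc (0 : ℝ) T)), (t : ℝ) = 0 → u (x, t) ≤ u₀ x
  test : ∀ (x : Space N) (t : ↥(Icc (0 : ℝ) T)) (a b : ℝ) (φ : Space N × ℝ → ℝ),
    IsSmoothTest κ T a b φ x t →
    IsMaxOn (fun w : SpaceTime N T => u w - φ (w.1, (w.2 : ℝ))) {w | (w.2 : ℝ) ∈ Icc a b} (x, t) →
    (spaceGrad φ x t = 0 → timeDeriv φ x t ≤ 0) ∧
    (NoncriticalLevel φ x t →
      timeDeriv φ x t + ‖spaceGrad φ x t‖ * κ x {y | φ (y, (t : ℝ)) ≥ φ (x, (t : ℝ))} ≤ 0)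

/-- Viscosity supersolutions of the level set Cauchy problem. The curvature of the open set
`{φ(·,t) > φ(x,t)}` is that of its closure, which is the corresponding element of `ℭ`. -/
structure IsViscositySupersolution {N : ℕ} {T : ℝ} (κ : Space N → Set (Space N) → ℝ)
    (u₀ : Space N → ℝ) (u : SpaceTime N T → ℝ) : Prop where
  lsc : LowerSemicontinuous u
  const_outside : ConstOutsideCompact u
  initial : ∀ (x : Space N) (t : ↥(Icc (0 : ℝ) T)), (t : ℝ) = 0 → u₀ x ≤ u (x, t)
  test : ∀ (x : Space N) (t : ↥(Icc (0 : ℝ) T)) (a b : ℝ) (φ : Space N × ℝ → ℝ),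
    IsSmoothTest κ T a b φ x t →
    IsMinOn (fun w : SpaceTime N T => u w - φ (w.1, (w.2 : ℝ))) {w | (w.2 : ℝ) ∈ Icc a b} (x, t) →
    (spaceGrad φ x t = 0 → 0 ≤ timeDeriv φ x t) ∧
    (NoncriticalLevel φ x t →
      0 ≤ timeDeriv φ x t +
        ‖spaceGrad φ x t‖ * κ x (closure {y | φ (y, (t : ℝ)) > φ (x, (t : ℝ))}))

/-- `v` is the upper semicontinuous envelope of `u`: the least upper semicontinuous (real-valued)
function above `u`. -/
def IsUSCEnvelope {X : Type*} [TopologicalSpace X] (u v : X → ℝ) : Prop :=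
  IsLeast {g : X → ℝ | UpperSemicontinuous g ∧ u ≤ g} v

/-- `v` is the lower semicontinuous envelope of `u`: the greatest lower semicontinuous
(real-valued) function below `u`. -/
def IsLSCEnvelope {X : Type*} [TopologicalSpace X] (u v : X → ℝ) : Prop :=
  IsGreatest {g : X → ℝ | LowerSemicontinuous g ∧ g ≤ u} v

/-- Viscosity solutions of the level set Cauchy problem: the upper semicontinuous envelope is a
subsolution and the lower semicontinuous envelope is a supersolution. -/
def IsViscositySolution {N : ℕ} {T : ℝ} (κ : Space N → Set (Space N) → ℝ)
    (u₀ : Space N → ℝ) (u : SpaceTime N T → ℝ) : Prop :=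
  (∃ v, IsUSCEnvelope u v ∧ IsViscositySubsolution κ u₀ v) ∧
  (∃ w, IsLSCEnvelope u w ∧ IsViscositySupersolution κ u₀ w)

/-! The solution is built by Perron's method. `perronClass` consists of the upper semicontinuous
functions that pass the subsolution tests and lie between one explicit lower barrier and every upper
barrier; its largest element `u` is the solution. The supremum of the class keeps the subsolution
tests after taking its upper semicontinuous envelope (`IsRelaxedSup.isSubTested`), so the envelope
is again in the class and `u` exists. If the lower envelope of `u` failed a supersolution test,
there would be a classical strict subsolution `q`, a small bump on the test function, exceeding `u`
somewhere; then `max u q` would be a larger element (`IsPerronBarriers.le_of_isStrictSubsolutionAt`,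
`IsPerronBarriers.not_bump`).

No comparison principle is used. Lower barriers stay below `u₀` and upper barriers stay above it at
all later times, so they are ordered from the start; and a bump cannot cross an upper barrier,
because a strict subsolution cannot touch a supersolution from below
(`IsStrictSubsolutionAt.not_touch_dual`). Cones with truncated tips give the initial values. A
radial profile that moves outward with speed `K`, where `-K` is the lower curvature bound of axiom
D, gives the radius `R + 1 + K * T`, which depends neither on `u₀` nor on `C₀`.

Two points need work. At noncritical levels the tests are stable only if the curvature is continuous
along perturbed level sets, so smooth families of superlevel sets must be shown to converge in `ℭ`;
this is the implicit function theorem with parameters (`IsDefiningFamily.tendstoRegular`). At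
critical points the test function is controlled only by `f(|x - x̂|)`, and this radial function need
not be smooth at `x̂`. It is replaced by a smooth radial function with derivative at most `6 f'`
(`InFamilyF.exists_radial`); its level sets are spheres, and `f' c̄ → 0` makes the curvature term
negligible.

Supersolutions are treated as subsolutions for `dualCurvature`, the curvature of complements with
reversed sign. -/

/-! ### Implicit functions with parameters -/

section ImplicitGraph

variable {B P : Type*} [NormedAddCommGroup B] [NormedSpace ℝ B]
  [NormedAddCommGroup P] [NormedSpace ℝ P]

/-- Implicit function theorem with parameters, for a scalar equation which is decreasing in the
last variable, including the description of both sides of the graph. -/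
theorem exists_implicit_graph [CompleteSpace B] [CompleteSpace P] {n : ℕ} (hn : n ≠ 0)
    {Ψ : (B × P) × ℝ → ℝ} {p₀ : B × P}
    (hΨ : ContDiffAt ℝ n Ψ (p₀, 0)) (h0 : Ψ (p₀, 0) = 0)
    (hneg : fderiv ℝ Ψ (p₀, 0) (0, 1) < 0) :
    ∃ G : B × P → ℝ, ContDiffAt ℝ n G p₀ ∧ ∃ h > 0, ∀ᶠ p in 𝓝 p₀, |G p| ≤ h / 2 ∧
      ∀ τ, |τ| < h → (0 ≤ Ψ (p, τ) ↔ τ ≤ G p) ∧ (0 < Ψ (p, τ) ↔ τ < G p) := by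
  have hn' : (n : ℕ∞ω) ≠ 0 := by exact_mod_cast hn
  have hinv : (fderiv ℝ Ψ (p₀, 0) ∘L .inr ℝ (B × P) ℝ).IsInvertible := by
    refine ⟨ContinuousLinearEquiv.unitsEquivAut ℝ
      (Units.mk0 (fderiv ℝ Ψ (p₀, 0) (0, 1)) hneg.ne), ?_⟩
    ext
    simp
  refine ⟨hΨ.implicitFunction hn' hinv, hΨ.contDiffAt_implicitFunction hn' hinv, ?_⟩
  set G := hΨ.implicitFunction hn' hinv with hG
  have hG0 : G p₀ = 0 := hΨ.implicitFunction_apply_self hn' hinv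
  have hGc : ContinuousAt G p₀ := (hΨ.contDiffAt_implicitFunction hn' hinv).continuousAt
  have hGeq : ∀ᶠ p in 𝓝 p₀, Ψ (p, G p) = 0 := by
    filter_upwards [hΨ.eventually_apply_implicitFunction hn' hinv] with p hp
    rw [hp, h0]
  have hn1 : (1 : ℕ∞ω) ≤ n := by exact_mod_cast Nat.one_le_iff_ne_zero.2 hn
  have hdiff : ∀ᶠ q in 𝓝 (p₀, (0 : ℝ)), DifferentiableAt ℝ Ψ q ∧ fderiv ℝ Ψ q (0, 1) < 0 := by
    have h1 := (hΨ.of_le hn1).eventually (by simp)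
    have h2 : ContinuousAt (fun q => fderiv ℝ Ψ q (0, 1)) (p₀, (0 : ℝ)) :=
      (((hΨ.of_le hn1).fderiv_right (m := 0) (by simp)).continuousAt).clm_apply continuousAt_const
    filter_upwards [h1, h2.eventually (gt_mem_nhds hneg)] with q hq hq'
    exact ⟨hq.differentiableAt (by simp), hq'⟩
  obtain ⟨U, hU, V, hV, hUV⟩ := mem_nhds_prod_iff.1 hdiff
  obtain ⟨h, hh, hhV⟩ := Metric.mem_nhds_iff.1 hV
  refine ⟨h, hh, ?_⟩
  have hGs : ∀ᶠ p in 𝓝 p₀, |G p| < h / 2 := by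
    exact hGc.abs.eventually_lt continuousAt_const (by rw [hG0]; simpa using hh)
  filter_upwards [hU, hGeq, hGs] with p hpU hpG hps
  -- Strict monotonicity on the whole interval turns the single zero `G p` into a sign description
  -- on both sides of the graph.
  have hanti : StrictAntiOn (fun τ => Ψ (p, τ)) (Ioo (-h) h) := by
    have hd : ∀ τ ∈ Ioo (-h) h, HasDerivAt (fun τ => Ψ (p, τ)) (fderiv ℝ Ψ (p, τ) (0, 1)) τ := by
      intro τ hτ
      have hm : (p, τ) ∈ U ×ˢ V := ⟨hpU, hhV (by simpa [Real.dist_eq, abs_lt] using hτ)⟩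
      have := (hUV hm).1.hasFDerivAt.comp_hasDerivAt τ
        ((hasDerivAt_const τ p).prodMk (hasDerivAt_id τ))
      exact this
    refine strictAntiOn_of_deriv_neg (convex_Ioo _ _)
      (fun τ hτ => (hd τ hτ).continuousAt.continuousWithinAt) ?_
    intro τ hτ
    rw [interior_Ioo] at hτ
    rw [(hd τ hτ).deriv]
    exact (hUV (show (p, τ) ∈ U ×ˢ V from
      ⟨hpU, hhV (by simpa [Real.dist_eq, abs_lt] using hτ)⟩)).2
  refine ⟨hps.le, fun τ hτ => ?_⟩
  have hτ' : τ ∈ Ioo (-h) h := abs_lt.1 hτ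
  have hGm : G p ∈ Ioo (-h) h := abs_lt.1 (hps.trans (by linarith))
  have h1 := hanti.le_iff_ge hGm hτ'
  have h2 := hanti.lt_iff_gt hGm hτ'
  simp only [hpG] at h1 h2
  exact ⟨h1, h2⟩

/-- Each derivative in the first variable costs one order of joint smoothness, since
`ContDiffAt.fderiv` lets the differentiated function depend on a parameter. -/
theorem ContDiffAt.iteratedFDeriv_partial {F : Type*} [NormedAddCommGroup F] [NormedSpace ℝ F]
    {G : B × P → F} {p : B × P} (k : ℕ) :
    ∀ {m : ℕ}, ContDiffAt ℝ (m + k : ℕ) G p →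
      ContDiffAt ℝ m (fun q : B × P => iteratedFDeriv ℝ k (fun v => G (v, q.2)) q.1) p := by
  induction k with
  | zero =>
    intro m hG
    simp only [iteratedFDeriv_zero_eq_comp, Function.comp_def]
    exact (continuousMultilinearCurryFin0 ℝ B F).symm.contDiff.contDiffAt.comp p hG
  | succ k ih =>
    intro m hG
    have h1 : ContDiffAt ℝ ((m + 1 : ℕ)) _ p := ih (by rwa [show m + 1 + k = m + (k + 1) by ring])
    simp only [iteratedFDeriv_succ_eq_comp_left, Function.comp_def]
    refine (LinearIsometryEquiv.contDiff (𝕜 := ℝ) (E := B →L[ℝ] B [×k]→L[ℝ] F)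
      (F := B [×(k + 1)]→L[ℝ] F)
      (continuousMultilinearCurryLeftEquiv ℝ (fun _ : Fin (k + 1) => B)
      F).symm).contDiffAt.comp p ?_
    refine ContDiffAt.fderiv (n := (m + 1 : ℕ))
      (f := fun q : B × P => iteratedFDeriv ℝ k (fun v => G (v, q.2))) (g := Prod.fst) ?_
      contDiffAt_fst (by norm_cast)
    have : ContDiffAt ℝ ((m + 1 : ℕ)) (fun w : (B × P) × B => (w.2, w.1.2)) (p, p.1) := by fun_prop
    exact ContDiffAt.comp (p, p.1)
      (g := fun q : B × P => iteratedFDeriv ℝ k (fun v => G (v, q.2)) q.1) h1 this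

end ImplicitGraph

/-! ### Hölder bounds and convergence of parametrised graphs -/

section CHolderPartial

variable {B P : Type*} [NormedAddCommGroup B] [NormedSpace ℝ B]
  [NormedAddCommGroup P] [NormedSpace ℝ P]

/-- Mean value inequality for the `k`-th derivative of `f - g`. With `k = ℓ` it yields the Hölder
seminorm of a difference; with `g = 0` that of a single function. -/
theorem norm_iteratedFDeriv_sub_sub_le {f g : B → ℝ} {k : ℕ} {s : Set B} (hs : Convex ℝ s)
    {C : ℝ} (hf : ∀ x ∈ s, DifferentiableAt ℝ (iteratedFDeriv ℝ k f) x)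
    (hg : ∀ x ∈ s, DifferentiableAt ℝ (iteratedFDeriv ℝ k g) x)
    (hC : ∀ x ∈ s, ‖iteratedFDeriv ℝ (k + 1) f x - iteratedFDeriv ℝ (k + 1) g x‖ ≤ C)
    {x y : B} (hx : x ∈ s) (hy : y ∈ s) :
    ‖(iteratedFDeriv ℝ k f x - iteratedFDeriv ℝ k g x) -
      (iteratedFDeriv ℝ k f y - iteratedFDeriv ℝ k g y)‖ ≤ C * dist x y := by
  rw [dist_eq_norm]
  refine hs.norm_image_sub_le_of_norm_fderiv_le (𝕜 := ℝ)
    (f := fun z => iteratedFDeriv ℝ k f z - iteratedFDeriv ℝ k g z)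
    (fun z hz => (hf z hz).fun_sub (hg z hz)) (fun z hz => ?_) hy hx
  have h := hC z hz
  have e : fderiv ℝ (fun z => iteratedFDeriv ℝ k f z - iteratedFDeriv ℝ k g z) z =
      (continuousMultilinearCurryLeftEquiv ℝ (fun _ : Fin (k + 1) => B) ℝ)
        (iteratedFDeriv ℝ (k + 1) f z - iteratedFDeriv ℝ (k + 1) g z) := by
    rw [fderiv_fun_sub (hf z hz) (hg z hz), fderiv_iteratedFDeriv, fderiv_iteratedFDeriv]
    rfl
  rw [e]
  calc _ = ‖iteratedFDeriv ℝ (k + 1) f z - iteratedFDeriv ℝ (k + 1) g z‖ :=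
        LinearIsometryEquiv.norm_map _ _
    _ ≤ C := h

/-- Radius at most `1 / 2` keeps distances at most `1`, where a Lipschitz bound is a `β`-Hölder
bound with the same constant. -/
theorem dist_le_dist_rpow {B : Type*} [NormedAddCommGroup B] {β : ℝ} (hβ : β ∈ Icc (0 : ℝ) 1) {r : ℝ} (hr : r ≤ 1 / 2) {x y : B}
    (hx : x ∈ ball (0 : B) r) (hy : y ∈ ball (0 : B) r) : dist x y ≤ dist x y ^ β := by
  rcases (dist_nonneg (x := x) (y := y)).eq_or_lt with h | h
  · rw [← h]; positivity
  · have h1 : dist x y ≤ 1 := by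
      rw [mem_ball] at hx hy
      linarith [dist_triangle_right x y 0]
    calc dist x y = dist x y ^ (1 : ℝ) := (Real.rpow_one _).symm
      _ ≤ dist x y ^ β := Real.rpow_le_rpow_of_exponent_ge h h1 hβ.2

/-- One order of smoothness is spent: on a compact ball the derivatives up to order `ℓ + 1` are
bounded and converge uniformly, and the last one controls the Hölder seminorm of order `ℓ` for every
`β ≤ 1`. -/
theorem eventually_isCHolderOn_partial [ProperSpace B] {ℓ : ℕ} {β : ℝ} (hβ : β ∈ Icc (0 : ℝ) 1)
    {G : B × P → ℝ} {s₀ : P} (hG : ContDiffAt ℝ (ℓ + 1 : ℕ) G (0, s₀)) :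
    ∃ r₀ > 0, ∀ r, r ≤ r₀ →
      (∀ᶠ s in 𝓝 s₀, IsCHolderOn ℓ β (fun v => G (v, s)) (ball 0 r)) ∧
      ∀ s : ℕ → P, Tendsto s atTop (𝓝 s₀) →
        TendstoCHolderOn ℓ β (fun n v => G (v, s n)) (fun v => G (v, s₀)) (ball 0 r) := by
  have hev := hG.eventually (by simp)
  obtain ⟨U, hU, V, hV, hUV⟩ := mem_nhds_prod_iff.1 hev
  obtain ⟨ρ, hρ, hρU⟩ := Metric.mem_nhds_iff.1 hU
  refine ⟨min (ρ / 2) (1 / 2), by positivity, fun r hr => ?_⟩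
  have hr1 : r < ρ := (hr.trans (min_le_left _ _)).trans_lt (half_lt_self hρ)
  have hr2 : r ≤ 1 / 2 := hr.trans (min_le_right _ _)
  have hKU : closedBall (0 : B) r ⊆ U := (closedBall_subset_ball hr1).trans hρU
  have hK : IsCompact (closedBall (0 : B) r) := isCompact_closedBall _ _
  have hsm : ∀ v ∈ closedBall (0 : B) r, ∀ s ∈ V, ContDiffAt ℝ (ℓ + 1 : ℕ) G (v, s) :=
    fun v hv s hs => hUV (show (v, s) ∈ U ×ˢ V from ⟨hKU hv, hs⟩)
  set D : (k : ℕ) → B × P → B [×k]→L[ℝ] ℝ :=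
    fun k q => iteratedFDeriv ℝ k (fun v => G (v, q.2)) q.1 with hD
  have hDs : ∀ k ≤ ℓ + 1, ∀ v ∈ closedBall (0 : B) r, ∀ s ∈ V,
      ContDiffAt ℝ (ℓ + 1 - k : ℕ) (D k) (v, s) := fun k hk v hv s hs =>
    ContDiffAt.iteratedFDeriv_partial k (by
      rw [Nat.sub_add_cancel hk]; exact hsm v hv s hs)
  have hin : ∀ s : P, ∀ v : B, ContDiffAt ℝ (ℓ + 1 : ℕ) (fun v : B => (v, s)) v := by
    intros; fun_prop
  have hDd : ∀ s ∈ V, ∀ v ∈ ball (0 : B) r,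
      DifferentiableAt ℝ (iteratedFDeriv ℝ ℓ (fun v => G (v, s))) v := by
    intro s hs v hv
    have h1 : ContDiffAt ℝ (1 : ℕ) (D ℓ) (v, s) := by
      have := hDs ℓ (Nat.le_succ _) v (ball_subset_closedBall hv) s hs
      rwa [Nat.add_sub_cancel_left] at this
    have h2 := (h1.differentiableAt (by simp)).comp v
      (((hin s v).of_le (m := (1 : ℕ)) (by norm_cast; omega)).differentiableAt (by simp))
    exact h2
  constructor
  · filter_upwards [hV] with s hs
    have hcd : ∀ v ∈ closedBall (0 : B) r, ContDiffAt ℝ (ℓ + 1 : ℕ) (fun v => G (v, s)) v :=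
      fun v hv => (hsm v hv s hs).comp v (hin s v)
    have hb : ∀ k ≤ ℓ + 1, ∃ C, ∀ v ∈ closedBall (0 : B) r, ‖D k (v, s)‖ ≤ C := by
      intro k hk
      refine hK.exists_bound_of_continuousOn (f := fun v => D k (v, s)) fun v hv => ?_
      exact (ContinuousAt.comp (f := fun v => (v, s)) (x := v) (hDs k hk v hv s hs).continuousAt
        (hin s v).continuousAt).continuousWithinAt
    choose! C hC using hb
    set M := ∑ k ∈ Finset.range (ℓ + 2), |C k| with hM
    have hle : ∀ k ≤ ℓ + 1, ∀ v ∈ ball (0 : B) r, ‖iteratedFDeriv ℝ k (fun v => G (v, s)) v‖ ≤ M :=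
      fun k hk v hv => ((hC k hk v (ball_subset_closedBall hv)).trans (le_abs_self _)).trans
        (Finset.single_le_sum (f := fun k => |C k|) (fun _ _ => abs_nonneg _)
          (Finset.mem_range.2 (by omega)))
    refine ⟨fun v hv => ((hcd v (ball_subset_closedBall hv)).of_le
      (by norm_cast; omega)).contDiffWithinAt, M, fun k hk => hle k (by omega), ?_⟩
    intro x hx y hy
    have hM0 : 0 ≤ M := Finset.sum_nonneg fun _ _ => abs_nonneg _
    have h0 : iteratedFDeriv ℝ ℓ (fun _ : B => (0 : ℝ)) = 0 := iteratedFDeriv_fun_zero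
    have h0' : iteratedFDeriv ℝ (ℓ + 1) (fun _ : B => (0 : ℝ)) = 0 := iteratedFDeriv_fun_zero
    have := norm_iteratedFDeriv_sub_sub_le (f := fun v => G (v, s)) (g := fun _ => (0 : ℝ)) (k := ℓ)
      (convex_ball (0 : B) r) (C := M) (hDd s hs)
      (fun v _ => by rw [h0]; exact differentiableAt_const _)
      (fun v hv => by rw [h0']; simpa using hle (ℓ + 1) le_rfl v hv) hx hy
    rw [h0] at this
    simp only [Pi.zero_apply, sub_zero] at this
    exact this.trans (mul_le_mul_of_nonneg_left (dist_le_dist_rpow hβ hr2 hx hy) hM0)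
  · intro s hs ε hε
    have hs0 : s₀ ∈ V := mem_of_mem_nhds hV
    have hclose : ∀ k ∈ Finset.range (ℓ + 2), ∀ᶠ t in 𝓝 s₀, ∀ v ∈ closedBall (0 : B) r,
        ‖D k (v, t) - D k (v, s₀)‖ < ε := by
      intro k hk
      have hk' : k ≤ ℓ + 1 := by have := Finset.mem_range.1 hk; omega
      refine hK.eventually_forall_of_forall_eventually fun v hv => ?_
      have h1 := (hDs k hk' v hv s₀ hs0).continuousAt
      have h2 : ContinuousAt (fun q : B × P => D k (q.1, s₀)) (v, s₀) :=
        ContinuousAt.comp (f := fun q : B × P => (q.1, s₀)) (x := (v, s₀)) h1 (by fun_prop)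
      have h3 := (h1.sub h2).norm.eventually_lt continuousAt_const
        (show ‖D k (v, s₀) - D k (v, s₀)‖ < ε by simpa using hε)
      have h4 : ContinuousAt (fun z : P × B => (z.2, z.1)) (s₀, v) := by fun_prop
      exact h4.eventually h3
    have hall := (Finset.eventually_all (Finset.range (ℓ + 2))).2 hclose
    filter_upwards [hs.eventually hall, hs.eventually hV] with n hn hnV
    refine ⟨fun k hk x hx => (hn k (Finset.mem_range.2 (by omega)) x
      (ball_subset_closedBall hx)).le, fun x hx y hy => ?_⟩
    refine (norm_iteratedFDeriv_sub_sub_le (convex_ball (0 : B) r) (hDd _ hnV) (hDd _ hs0)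
      (fun v hv => (hn (ℓ + 1) (Finset.mem_range.2 (by omega)) v
        (ball_subset_closedBall hv)).le) hx hy).trans ?_
    exact mul_le_mul_of_nonneg_left (dist_le_dist_rpow hβ hr2 hx hy) hε.le

end CHolderPartial

/-! ### Superlevel sets of smooth functions as elements of `ℭ` -/

section DefiningFunctions

variable {N : ℕ} {P : Type*} [NormedAddCommGroup P] [NormedSpace ℝ P]

/-- `Ξ` is a smooth function whose zero set is compact and noncritical. -/
structure IsDefining (Ξ : Space N → ℝ) : Prop where
  smooth : ContDiff ℝ ∞ Ξ
  compact : ∃ K : Set (Space N), IsCompact K ∧ ∀ x ∉ K, Ξ x ≠ 0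
  regular : ∀ x, Ξ x = 0 → fderiv ℝ Ξ x ≠ 0

/-- `Φ` is a family of functions, smooth jointly in the parameter near `s₀`, whose zero sets stay
in a fixed compact set, and are noncritical for the parameter `s₀`. -/
structure IsDefiningFamily (Φ : Space N × P → ℝ) (s₀ : P) : Prop where
  smooth : ∃ U ∈ 𝓝 s₀, ContDiffOn ℝ ∞ Φ (univ ×ˢ U)
  compact : ∃ K : Set (Space N), IsCompact K ∧ ∀ᶠ s in 𝓝 s₀, ∀ x ∉ K, Φ (x, s) ≠ 0
  regular : ∀ x, Φ (x, s₀) = 0 → fderiv ℝ (fun y => Φ (y, s₀)) x ≠ 0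

theorem IsDefining.neg {Ξ : Space N → ℝ} (h : IsDefining Ξ) : IsDefining (fun x => -Ξ x) where
  smooth := h.smooth.neg
  compact := by simpa using h.compact
  regular x hx := by
    rw [fderiv_fun_neg]
    simpa using h.regular x (by simpa using hx)

theorem IsDefiningFamily.neg {Φ : Space N × P → ℝ} {s₀ : P} (h : IsDefiningFamily Φ s₀) :
    IsDefiningFamily (fun q => -Φ q) s₀ where
  smooth := by
    obtain ⟨U, hU, h⟩ := h.smooth
    exact ⟨U, hU, h.neg⟩
  compact := by simpa using h.compact
  regular x hx := by
    rw [fderiv_fun_neg]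
    simpa using h.regular x (by simpa using hx)

theorem IsDefining.family {Ξ : Space N → ℝ} (h : IsDefining Ξ) (s₀ : P) :
    IsDefiningFamily (fun q : Space N × P => Ξ q.1) s₀ where
  smooth := ⟨univ, univ_mem, (h.smooth.comp contDiff_fst).contDiffOn⟩
  compact := by
    obtain ⟨K, hK, h⟩ := h.compact
    exact ⟨K, hK, Eventually.of_forall fun _ => h⟩
  regular x hx := h.regular x hx

theorem IsDefiningFamily.eventually_contDiffAt {Φ : Space N × P → ℝ} {s₀ : P}
    (h : IsDefiningFamily Φ s₀) : ∀ᶠ s in 𝓝 s₀, ∀ x, ContDiffAt ℝ ∞ Φ (x, s) := by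
  obtain ⟨U, hU, h⟩ := h.smooth
  filter_upwards [eventually_mem_nhds_iff.2 hU] with s hs x
  exact h.contDiffAt (prod_mem_nhds univ_mem hs)

/-- On the compact set `K` the alternative "nonzero value or nonzero derivative" is open in the
point and the parameter, so it persists uniformly; off `K` there are no zeros. -/
theorem IsDefiningFamily.eventually_isDefining {Φ : Space N × P → ℝ} {s₀ : P}
    (h : IsDefiningFamily Φ s₀) : ∀ᶠ s in 𝓝 s₀, IsDefining (fun x => Φ (x, s)) := by
  obtain ⟨K, hK, hKs⟩ := h.compact
  have hsm := h.eventually_contDiffAt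
  have hs0 := hsm.self_of_nhds
  have hreg : ∀ᶠ s in 𝓝 s₀, ∀ x ∈ K, Φ (x, s) ≠ 0 ∨ fderiv ℝ (fun y => Φ (y, s)) x ≠ 0 := by
    refine hK.eventually_forall_of_forall_eventually fun x _ => ?_
    have hsw : ContinuousAt (fun z : P × Space N => (z.2, z.1)) (s₀, x) := by fun_prop
    by_cases h0 : Φ (x, s₀) = 0
    · have h1 : ContDiffAt ℝ 0 (fun q : Space N × P => fderiv ℝ (fun y => Φ (y, q.2)) q.1)
          (x, s₀) := by
        refine ContDiffAt.fderiv (n := 1) (f := fun q : Space N × P => fun y => Φ (y, q.2))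
          (g := Prod.fst) ?_ contDiffAt_fst (by norm_num)
        have : ContDiffAt ℝ 1 (fun w : (Space N × P) × Space N => (w.2, w.1.2)) ((x, s₀), x) := by
          fun_prop
        exact ContDiffAt.comp ((x, s₀), x) (g := Φ) ((hs0 x).of_le (by exact_mod_cast le_top)) this
      have h2 := h1.continuousAt.eventually_ne (h.regular x h0)
      exact (hsw.eventually h2).mono fun z hz => Or.inr hz
    · have h2 := (hs0 x).continuousAt.eventually_ne h0
      exact (hsw.eventually h2).mono fun z hz => Or.inl hz
  filter_upwards [hKs, hsm, hreg] with s h1 h2 h3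
  refine ⟨contDiff_iff_contDiffAt.2 fun x => ?_, ⟨K, hK, h1⟩, fun x hx => ?_⟩
  · have : ContDiffAt ℝ ∞ (fun y : Space N => (y, s)) x := by fun_prop
    exact (h2 x).comp x this
  · have hxK : x ∈ K := by
      by_contra hn
      exact h1 x hn hx
    exact (h3 x hxK).resolve_left (fun h => h hx)

/-- Otherwise the zero would be a local maximum, hence critical. -/
theorem IsDefining.mem_closure_pos {Ξ : Space N → ℝ} (h : IsDefining Ξ) {x : Space N}
    (hx : Ξ x = 0) : x ∈ closure {y | 0 < Ξ y} := by
  by_contra hn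
  have hev : ∀ᶠ y in 𝓝 x, y ∉ {y | 0 < Ξ y} := by
    rw [mem_closure_iff_frequently, not_frequently] at hn
    exact hn
  have hmax : IsLocalMax Ξ x := by
    filter_upwards [hev] with y hy
    rw [hx]
    exact not_lt.1 hy
  exact h.regular x hx hmax.fderiv_eq_zero

theorem IsDefining.closure_pos {Ξ : Space N → ℝ} (h : IsDefining Ξ) :
    closure {y | 0 < Ξ y} = {y | 0 ≤ Ξ y} := by
  refine subset_antisymm (closure_minimal (fun y (hy : 0 < Ξ y) => hy.le)
    (isClosed_le continuous_const h.smooth.continuous)) fun y hy => ?_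
  rcases (show 0 ≤ Ξ y from hy).eq_or_lt with h0 | h0
  · exact h.mem_closure_pos h0.symm
  · exact subset_closure h0

theorem IsDefining.closure_compl {Ξ : Space N → ℝ} (h : IsDefining Ξ) :
    closure {y | 0 ≤ Ξ y}ᶜ = {y | 0 ≤ -Ξ y} := by
  rw [← h.neg.closure_pos]
  congr 1
  ext y
  simp

theorem IsDefining.frontier_nonneg {Ξ : Space N → ℝ} (h : IsDefining Ξ) :
    frontier {y | 0 ≤ Ξ y} = {y | Ξ y = 0} := by
  rw [frontier_eq_closure_inter_closure, h.closure_compl,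
    (isClosed_le continuous_const h.smooth.continuous).closure_eq]
  ext y
  simp only [mem_inter_iff, mem_ofPred_eq, Left.nonneg_neg_iff]
  exact ⟨fun h => le_antisymm h.2 h.1, fun h => ⟨h.ge, h.le⟩⟩

theorem IsDefining.isCompact_zero {Ξ : Space N → ℝ} (h : IsDefining Ξ) :
    IsCompact {y | Ξ y = 0} := by
  obtain ⟨K, hK, hKs⟩ := h.compact
  refine hK.of_isClosed_subset (isClosed_eq h.smooth.continuous continuous_const) fun y hy => ?_
  by_contra hn
  exact hKs y hn hy

theorem IsDefining.frontier_pos {Ξ : Space N → ℝ} (h : IsDefining Ξ) :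
    frontier {y | 0 < Ξ y} = {y | Ξ y = 0} := by
  rw [(isOpen_lt continuous_const h.smooth.continuous).frontier_eq, h.closure_pos]
  ext y
  simp only [Set.mem_sdiff, mem_ofPred_eq, not_lt]
  exact ⟨fun h => le_antisymm h.2 h.1, fun h => ⟨h.ge, h.le⟩⟩

theorem Cylinder.eq_add (Z : Cylinder N) (y : Space N) :
    Z.center + (Z.horiz y : Space N) + Z.vert y • Z.axis = y := by
  have h := (ℝ ∙ Z.axis).starProjection_add_starProjection_orthogonal (y - Z.center)
  rw [Submodule.starProjection_unit_singleton ℝ Z.norm_axis] at h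
  have h2 : (Z.horiz y : Space N) = ((ℝ ∙ Z.axis)ᗮ).starProjection (y - Z.center) := rfl
  rw [h2, Cylinder.vert, add_assoc, add_comm (Submodule.starProjection _ _), h]
  abel

theorem Cylinder.isOpen_carrier (Z : Cylinder N) : IsOpen Z.carrier := by
  have h1 : Continuous Z.horiz := by unfold Cylinder.horiz; fun_prop
  have h2 : Continuous Z.vert := by unfold Cylinder.vert; fun_prop
  exact (isOpen_ball.preimage h1).inter (isOpen_lt h2.abs continuous_const)

theorem Cylinder.center_mem (Z : Cylinder N) : Z.center ∈ Z.carrier := by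
  simp [Cylinder.carrier, Cylinder.horiz, Cylinder.vert, Z.radius_pos, Z.height_pos]

/-- A single implicit function, with the parameter among its variables, describes all nearby sets in
the same cylinder, so convergence of the graphs is continuity in the parameter. -/
theorem IsDefiningFamily.exists_chart [CompleteSpace P] {ℓ : ℕ} {β : ℝ} (hβ : β ∈ Icc (0 : ℝ) 1)
    {Φ : Space N × P → ℝ} {s₀ : P} (h : IsDefiningFamily Φ s₀) {x₁ : Space N}
    (hx : Φ (x₁, s₀) = 0) :
    ∃ Z : Cylinder N, x₁ ∈ Z.carrier ∧ ∃ g : P → Z.Base → ℝ,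
      (∀ᶠ s in 𝓝 s₀, IsCHolderOn ℓ β (g s) (ball 0 Z.radius) ∧
        (∀ v ∈ ball (0 : Z.Base) Z.radius, |g s v| ≤ Z.height / 2) ∧
        ∀ y ∈ Z.carrier, (0 ≤ Φ (y, s) ↔ Z.vert y ≤ g s (Z.horiz y)) ∧
          (0 < Φ (y, s) ↔ Z.vert y < g s (Z.horiz y))) ∧
      ∀ s : ℕ → P, Tendsto s atTop (𝓝 s₀) →
        TendstoCHolderOn ℓ β (fun n => g (s n)) (g s₀) (ball 0 Z.radius) := by
  have hsm : ContDiffAt ℝ ∞ Φ (x₁, s₀) := h.eventually_contDiffAt.self_of_nhds x₁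
  set p : Space N := gradient (fun y => Φ (y, s₀)) x₁ with hp
  have hd1 : DifferentiableAt ℝ (fun y => Φ (y, s₀)) x₁ := by
    have h1 : DifferentiableAt ℝ (fun y : Space N => (y, s₀)) x₁ := by fun_prop
    exact (hsm.differentiableAt (by simp)).comp x₁ h1
  have hfd : fderiv ℝ (fun y => Φ (y, s₀)) x₁ = innerSL ℝ p := by
    have := hd1.hasGradientAt.hasFDerivAt.fderiv
    rw [this]; rfl
  have hp0 : p ≠ 0 := by
    intro h0
    apply h.regular x₁ hx
    rw [hfd, h0, map_zero]
  have hpn : 0 < ‖p‖ := norm_pos_iff.2 hp0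
  -- The axis points against the gradient, so that the superlevel set lies below the graph.
  set ν : Space N := -(‖p‖⁻¹ • p) with hν
  have hν1 : ‖ν‖ = 1 := by
    rw [hν, norm_neg, norm_smul, norm_inv, norm_norm, inv_mul_cancel₀ hpn.ne']
  let Ψ : (↥((ℝ ∙ ν)ᗮ) × P) × ℝ → ℝ := fun w => Φ (x₁ + (w.1.1 : Space N) + w.2 • ν, w.1.2)
  let A : (↥((ℝ ∙ ν)ᗮ) × P) × ℝ → Space N × P := fun w => (x₁ + (w.1.1 : Space N) + w.2 • ν, w.1.2)
  have hA : ContDiff ℝ ∞ A := by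
    have : ContDiff ℝ ∞ fun w : (↥((ℝ ∙ ν)ᗮ) × P) × ℝ => ((w.1.1 : Space N)) :=
      ((ℝ ∙ ν)ᗮ).subtypeL.contDiff.comp (contDiff_fst.comp contDiff_fst)
    fun_prop
  have hA0 : A ((0, s₀), 0) = (x₁, s₀) := by simp [A]
  have hΨ : ContDiffAt ℝ ∞ Ψ ((0, s₀), 0) := by
    refine ContDiffAt.comp (g := Φ) (f := A) _ ?_ hA.contDiffAt
    rwa [hA0]
  have hneg : fderiv ℝ Ψ ((0, s₀), 0) (0, 1) < 0 := by
    have e1 : HasDerivAt (fun τ : ℝ => Ψ ((0, s₀), τ)) (fderiv ℝ Ψ ((0, s₀), 0) (0, 1)) 0 :=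
      (hΨ.differentiableAt (by simp)).hasFDerivAt.comp_hasDerivAt (0 : ℝ)
        ((hasDerivAt_const (0 : ℝ) ((0 : ↥((ℝ ∙ ν)ᗮ)), s₀)).prodMk (hasDerivAt_id (0 : ℝ)))
    have e2 : HasDerivAt (fun τ : ℝ => x₁ + τ • ν) ν 0 := by
      simpa using ((hasDerivAt_id (0 : ℝ)).smul_const ν).const_add x₁
    have e3 : HasDerivAt (fun τ : ℝ => Φ (x₁ + τ • ν, s₀)) (innerSL ℝ p ν) 0 := by
      have hF : HasFDerivAt (fun y => Φ (y, s₀)) (innerSL ℝ p) (x₁ + (0 : ℝ) • ν) := by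
        rw [← hfd, zero_smul, add_zero]; exact hd1.hasFDerivAt
      exact hF.comp_hasDerivAt (0 : ℝ) e2
    have e4 : (fun τ : ℝ => Ψ ((0, s₀), τ)) = fun τ : ℝ => Φ (x₁ + τ • ν, s₀) := by
      funext τ; simp [Ψ]
    rw [e4] at e1
    rw [e1.unique e3, hν]
    simp only [innerSL_apply_apply, inner_neg_right, real_inner_smul_right,
      real_inner_self_eq_norm_sq, Left.neg_neg_iff]
    positivity
  obtain ⟨G, hG, η, hη, hev⟩ := exists_implicit_graph (n := ℓ + 1) (by omega)
    (hΨ.of_le (by exact_mod_cast le_top)) (by simpa [Ψ] using hx) hneg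
  obtain ⟨r₀, hr₀, hr⟩ := eventually_isCHolderOn_partial (ℓ := ℓ) hβ hG
  obtain ⟨U, hU, V, hV, hUV⟩ := mem_nhds_prod_iff.1 hev
  obtain ⟨ρ, hρ, hρU⟩ := Metric.mem_nhds_iff.1 hU
  obtain ⟨hr1, hr2⟩ := hr (min r₀ ρ) (min_le_left _ _)
  -- `r₀` is the radius for the Hölder estimates and `ρ` the one for the description of both sides
  -- of the graph.
  let Z : Cylinder N := ⟨x₁, ν, hν1, min r₀ ρ, by positivity, η, hη⟩
  refine ⟨Z, Z.center_mem, fun s v => G (v, s), ?_, hr2⟩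
  filter_upwards [hr1, hV] with s hs hsV
  have hin : ∀ v ∈ ball (0 : Z.Base) Z.radius, v ∈ U := fun v hv =>
    hρU (ball_subset_ball (min_le_right _ _) hv)
  refine ⟨hs, fun v hv => (hUV (show (v, s) ∈ U ×ˢ V from ⟨hin v hv, hsV⟩)).1, fun y hy => ?_⟩
  have := (hUV (show (Z.horiz y, s) ∈ U ×ˢ V from ⟨hin _ hy.1, hsV⟩)).2 (Z.vert y) hy.2
  have e : x₁ + (Z.horiz y : Space N) + Z.vert y • ν = y := Z.eq_add y
  simpa only [Ψ, e] using this

theorem IsDefining.isRegularSet {ℓ : ℕ} {β : ℝ} (hβ : β ∈ Icc (0 : ℝ) 1)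
    {Ξ : Space N → ℝ} (h : IsDefining Ξ) : IsRegularSet ℓ β {y | 0 ≤ Ξ y} := by
  refine ⟨{y | 0 < Ξ y}, isOpen_lt continuous_const h.smooth.continuous, ?_, ?_,
    h.closure_pos.symm⟩
  · rw [h.frontier_pos]; exact h.isCompact_zero
  · intro x hx
    rw [h.frontier_pos] at hx
    obtain ⟨Z, hxZ, g, hg, -⟩ := (h.family (0 : ℝ)).exists_chart (ℓ := ℓ) hβ hx
    obtain ⟨h1, -, h2⟩ := hg.self_of_nhds
    refine ⟨Z, hxZ, g 0, h1, ?_⟩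
    ext y
    constructor
    · exact fun hy => ⟨hy.2, (h2 y hy.2).2.1 hy.1⟩
    · exact fun hy => ⟨(h2 y hy.1).2.2 hy.2, hy.1⟩

/-- Finitely many charts cover the compact zero set for `s₀`. On the rest of the fixed compact set
the function is nonzero for `s₀`, hence for nearby parameters, so the nearby boundaries cannot leave
the charts. -/
theorem IsDefiningFamily.tendstoRegular [CompleteSpace P] {ℓ : ℕ} {β : ℝ}
    (hβ : β ∈ Icc (0 : ℝ) 1) {Φ : Space N × P → ℝ} {s₀ : P} (h : IsDefiningFamily Φ s₀)
    {s : ℕ → P} (hs : Tendsto s atTop (𝓝 s₀)) :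
    TendstoRegular ℓ β (fun n => {y | 0 ≤ Φ (y, s n)}) {y | 0 ≤ Φ (y, s₀)} := by
  have hdef := h.eventually_isDefining
  have h0 := hdef.self_of_nhds
  choose Z hZ g hg hgt using fun x : {x : Space N // Φ (x, s₀) = 0} =>
    h.exists_chart (ℓ := ℓ) hβ x.2
  obtain ⟨t, ht⟩ := h0.isCompact_zero.elim_finite_subcover (fun x => (Z x).carrier)
    (fun x => (Z x).isOpen_carrier) (fun x hx => mem_iUnion.2 ⟨⟨x, hx⟩, hZ ⟨x, hx⟩⟩)
  let e := t.equivFin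
  have hcov : ∀ y : Space N, (y ∈ ⋃ x ∈ t, (Z x).carrier) →
      y ∈ ⋃ i : Fin t.card, (Z (e.symm i)).carrier := by
    intro y hy
    obtain ⟨x, hx, hy⟩ := mem_iUnion₂.1 hy
    exact mem_iUnion.2 ⟨e ⟨x, hx⟩, by simpa using hy⟩
  refine ⟨t.card, fun i => Z (e.symm i), fun i n => g (e.symm i) (s n),
    fun i => g (e.symm i) s₀, ?_, ?_, fun i => ?_⟩
  · rw [h0.frontier_nonneg]
    exact fun y hy => hcov y (ht hy)
  · obtain ⟨K, hK, hKs⟩ := h.compact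
    have hO : IsOpen (⋃ x ∈ t, (Z x).carrier) :=
      isOpen_biUnion fun x _ => (Z x).isOpen_carrier
    have hne : ∀ᶠ s in 𝓝 s₀, ∀ x ∈ K \ ⋃ x ∈ t, (Z x).carrier, Φ (x, s) ≠ 0 := by
      refine (hK.diff hO).eventually_forall_of_forall_eventually fun x hx => ?_
      have hsw : ContinuousAt (fun z : P × Space N => (z.2, z.1)) (s₀, x) := by fun_prop
      exact hsw.eventually ((h.eventually_contDiffAt.self_of_nhds x).continuousAt.eventually_ne
        fun hx0 => hx.2 (ht hx0))
    filter_upwards [hs.eventually hne, hs.eventually hKs, hs.eventually hdef] with n h1 h2 h3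
    rw [h3.frontier_nonneg]
    intro y hy
    refine hcov y ?_
    by_contra hn
    by_cases hyK : y ∈ K
    · exact h1 y ⟨hyK, hn⟩ hy
    · exact h2 y hyK hy
  · have hgi := hg (e.symm i)
    have hset : ∀ {s : P}, (∀ y ∈ (Z (e.symm i)).carrier,
        (0 ≤ Φ (y, s) ↔ (Z (e.symm i)).vert y ≤ g (e.symm i) s ((Z (e.symm i)).horiz y)) ∧
          (0 < Φ (y, s) ↔ (Z (e.symm i)).vert y < g (e.symm i) s ((Z (e.symm i)).horiz y))) →
        {y | 0 ≤ Φ (y, s)} ∩ (Z (e.symm i)).carrier = {y ∈ (Z (e.symm i)).carrier |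
          (Z (e.symm i)).vert y ≤ g (e.symm i) s ((Z (e.symm i)).horiz y)} := by
      intro s hs
      ext y
      constructor
      · exact fun hy => ⟨hy.2, (hs y hy.2).1.1 hy.1⟩
      · exact fun hy => ⟨(hs y hy.1).1.2 hy.2, hy.1⟩
    have h00 := hgi.self_of_nhds
    refine ⟨h00.1, h00.2.1, hset h00.2.2, ?_, hgt _ s hs⟩
    filter_upwards [hs.eventually hgi] with n hn
    exact ⟨hn.1, hset hn.2.2⟩

end DefiningFunctions

/-! ### The curvature axioms in terms of defining functions, and duality -/

section SmoothCurvature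

variable {N : ℕ}

/-- The consequences of the axioms of a nonlocal curvature for sets with smooth defining functions;
`c` bounds the curvature of balls from above and `-K` from below. -/
structure IsSmoothCurvature (κ : Space N → Set (Space N) → ℝ) (c : ℝ → ℝ) (K : ℝ) : Prop where
  K_pos : 0 < K
  mono : ∀ Ξ₁ Ξ₂ : Space N → ℝ, IsDefining Ξ₁ → IsDefining Ξ₂ → (∀ y, 0 ≤ Ξ₁ y → 0 ≤ Ξ₂ y) →
    ∀ x, Ξ₁ x = 0 → Ξ₂ x = 0 → κ x {y | 0 ≤ Ξ₂ y} ≤ κ x {y | 0 ≤ Ξ₁ y}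
  cont : ∀ (Φ : Space N × (ℝ × ℝ × ℝ) → ℝ) (s₀ : ℝ × ℝ × ℝ) (x₀ : Space N),
    IsDefiningFamily Φ s₀ → Φ (x₀, s₀) = 0 →
    Tendsto (fun q : Space N × (ℝ × ℝ × ℝ) => κ q.1 {y | 0 ≤ Φ (y, q.2)})
      (𝓝[{q | Φ q = 0}] (x₀, s₀)) (𝓝 (κ x₀ {y | 0 ≤ Φ (y, s₀)}))
  ball_lower : ∀ x₀ : Space N, ∀ r > 0, ∀ x ∈ sphere x₀ r, -K < κ x (closedBall x₀ r)
  ball_upper : ∀ x₀ : Space N, ∀ r > 0, ∀ x ∈ sphere x₀ r, κ x (closedBall x₀ r) ≤ c r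
  compl_lower : ∀ x₀ : Space N, ∀ r > 0, ∀ x ∈ sphere x₀ r, -K < -κ x (ball x₀ r)ᶜ
  compl_upper : ∀ x₀ : Space N, ∀ r > 0, ∀ x ∈ sphere x₀ r, -κ x (ball x₀ r)ᶜ ≤ c r
  antitone : AntitoneOn c (Ioi 0)

/-- The defining function of a ball. -/
noncomputable def ballFn (x₀ : Space N) (r : ℝ) (y : Space N) : ℝ := r ^ 2 - ‖y - x₀‖ ^ 2

theorem isDefining_ballFn (x₀ : Space N) {r : ℝ} (hr : 0 < r) : IsDefining (ballFn x₀ r) where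
  smooth := contDiff_const.sub ((contDiff_id.sub contDiff_const).norm_sq ℝ)
  compact := by
    refine ⟨closedBall x₀ r, isCompact_closedBall _ _, fun x hx h0 => hx ?_⟩
    rw [mem_closedBall, dist_eq_norm]
    rw [ballFn, sub_eq_zero] at h0
    exact ((pow_left_inj₀ hr.le (norm_nonneg _) two_ne_zero).1 h0).ge
  regular x h0 h := by
    -- In the radial direction the function is `r² - (1 + τ)² r²`, with slope `-2r²` at the sphere.
    have hd : HasDerivAt (fun τ : ℝ => ballFn x₀ r (x + τ • (x - x₀)))
        (-(2 * r ^ 2)) 0 := by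
      have e : (fun τ : ℝ => ballFn x₀ r (x + τ • (x - x₀))) =
          fun τ : ℝ => r ^ 2 - (1 + τ) ^ 2 * r ^ 2 := by
        funext τ
        have h1 : x + τ • (x - x₀) - x₀ = (1 + τ) • (x - x₀) := by module
        rw [ballFn, sub_eq_zero] at h0
        rw [ballFn, h1, norm_smul, mul_pow, ← h0, Real.norm_eq_abs, sq_abs]
      rw [e]
      have := (((((hasDerivAt_id (0 : ℝ)).const_add 1).pow 2).mul_const (r ^ 2)).const_sub (r ^ 2))
      simpa using this
    have hs : ContDiff ℝ ∞ (ballFn x₀ r) :=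
      contDiff_const.sub ((contDiff_id.sub contDiff_const).norm_sq ℝ)
    have e2 : HasDerivAt (fun τ : ℝ => x + τ • (x - x₀)) (x - x₀) 0 := by
      simpa using ((hasDerivAt_id (0 : ℝ)).smul_const (x - x₀)).const_add x
    have hF : HasFDerivAt (ballFn x₀ r) (0 : Space N →L[ℝ] ℝ) (x + (0 : ℝ) • (x - x₀)) := by
      rw [← h, zero_smul, add_zero]
      exact (hs.differentiable (by simp) x).hasFDerivAt
    have := hd.unique (HasFDerivAt.comp_hasDerivAt (l := ballFn x₀ r)
      (f := fun τ : ℝ => x + τ • (x - x₀)) (0 : ℝ) hF e2)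
    have h2 : 0 < r ^ 2 := by positivity
    simp at this
    exact hr.ne' this

theorem setOf_ballFn_nonneg (x₀ : Space N) {r : ℝ} (hr : 0 < r) :
    {y | 0 ≤ ballFn x₀ r y} = closedBall x₀ r := by
  ext y
  rw [mem_ofPred_eq, ballFn, sub_nonneg, mem_closedBall, dist_eq_norm,
    pow_le_pow_iff_left₀ (norm_nonneg _) hr.le two_ne_zero]

theorem setOf_neg_ballFn_nonneg (x₀ : Space N) {r : ℝ} (hr : 0 < r) :
    {y | 0 ≤ -ballFn x₀ r y} = (ball x₀ r)ᶜ := by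
  ext y
  rw [mem_ofPred_eq, ballFn, neg_sub, sub_nonneg, mem_compl_iff, mem_ball, dist_eq_norm,
    pow_le_pow_iff_left₀ hr.le (norm_nonneg _) two_ne_zero, not_lt]

theorem ballFn_eq_zero {x₀ x : Space N} {r : ℝ} (hx : x ∈ sphere x₀ r) : ballFn x₀ r x = 0 := by
  rw [ballFn, ← dist_eq_norm, mem_sphere.1 hx, sub_self]

/-- The curvature that governs the complements of the evolving sets. -/
noncomputable def dualCurvature (κ : Space N → Set (Space N) → ℝ) (x : Space N)
    (E : Set (Space N)) : ℝ := -κ x (closure Eᶜ)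

theorem dualCurvature_setOf {κ : Space N → Set (Space N) → ℝ} {Ξ : Space N → ℝ}
    (h : IsDefining Ξ) (x : Space N) :
    dualCurvature κ x {y | 0 ≤ Ξ y} = -κ x {y | 0 ≤ -Ξ y} := by
  rw [dualCurvature, h.closure_compl]

theorem dualCurvature_closedBall {κ : Space N → Set (Space N) → ℝ} (x x₀ : Space N) {r : ℝ}
    (hr : 0 < r) : dualCurvature κ x (closedBall x₀ r) = -κ x (ball x₀ r)ᶜ := by
  rw [← setOf_ballFn_nonneg x₀ hr, dualCurvature_setOf (isDefining_ballFn x₀ hr),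
    setOf_neg_ballFn_nonneg x₀ hr]

theorem dualCurvature_compl_ball {κ : Space N → Set (Space N) → ℝ} (x x₀ : Space N) {r : ℝ}
    (hr : 0 < r) : dualCurvature κ x (ball x₀ r)ᶜ = -κ x (closedBall x₀ r) := by
  rw [← setOf_neg_ballFn_nonneg x₀ hr, dualCurvature_setOf (isDefining_ballFn x₀ hr).neg]
  simp only [neg_neg]
  rw [setOf_ballFn_nonneg x₀ hr]

/-- Passing to complements reverses inclusions and the sign undoes the reversal; the bounds for
balls and for their complements change places. Hence results on subsolutions apply to negatives of
supersolutions. -/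
theorem IsSmoothCurvature.dual {κ : Space N → Set (Space N) → ℝ} {c : ℝ → ℝ} {K : ℝ}
    (h : IsSmoothCurvature κ c K) : IsSmoothCurvature (dualCurvature κ) c K where
  K_pos := h.K_pos
  mono Ξ₁ Ξ₂ h₁ h₂ hle x hx₁ hx₂ := by
    rw [dualCurvature_setOf h₁, dualCurvature_setOf h₂, neg_le_neg_iff]
    refine h.mono _ _ h₂.neg h₁.neg (fun y hy => ?_) x (by simpa using hx₂) (by simpa using hx₁)
    -- Complements give only the inclusion of the open sets `{Ξ₂ < 0} ⊆ {Ξ₁ < 0}`; taking closures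
    -- restores the weak inequalities.
    have hclo : {y | 0 ≤ -Ξ₂ y} ⊆ {y | 0 ≤ -Ξ₁ y} := by
      rw [← h₂.closure_compl, ← h₁.closure_compl]
      exact closure_mono (compl_subset_compl.2 hle)
    exact hclo hy
  cont Φ s₀ x₀ hΦ h0 := by
    have h1 := (h.cont _ s₀ x₀ hΦ.neg (by simpa using h0)).neg
    rw [← dualCurvature_setOf (Ξ := fun y => Φ (y, s₀)) hΦ.eventually_isDefining.self_of_nhds] at h1
    simp only [neg_eq_zero] at h1
    refine h1.congr' ?_
    have h2 : ∀ᶠ q : Space N × (ℝ × ℝ × ℝ) in 𝓝[{q | Φ q = 0}] (x₀, s₀),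
        IsDefining (fun y => Φ (y, q.2)) :=
      Eventually.filter_mono nhdsWithin_le_nhds
        ((continuous_snd.tendsto (x₀, s₀)).eventually hΦ.eventually_isDefining)
    filter_upwards [h2] with q hq
    rw [dualCurvature_setOf hq]
  ball_lower x₀ r hr x hx := by
    rw [dualCurvature_closedBall x x₀ hr]; exact h.compl_lower x₀ r hr x hx
  ball_upper x₀ r hr x hx := by
    rw [dualCurvature_closedBall x x₀ hr]; exact h.compl_upper x₀ r hr x hx
  compl_lower x₀ r hr x hx := by
    rw [dualCurvature_compl_ball x x₀ hr, neg_neg]; exact h.ball_lower x₀ r hr x hx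
  compl_upper x₀ r hr x hx := by
    rw [dualCurvature_compl_ball x x₀ hr, neg_neg]; exact h.ball_upper x₀ r hr x hx
  antitone := h.antitone

variable {ℓ : ℕ} {β : ℝ} {κ : Space N → Set (Space N) → ℝ}

theorem IsNonlocalCurvature.tendsto_family (hκ : IsNonlocalCurvature ℓ β κ)
    (hβ : β ∈ Icc (0 : ℝ) 1) {P : Type*} [NormedAddCommGroup P] [NormedSpace ℝ P] [CompleteSpace P]
    {Φ : Space N × P → ℝ} {s₀ : P} {x₀ : Space N} (hΦ : IsDefiningFamily Φ s₀)
    (h0 : Φ (x₀, s₀) = 0) :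
    Tendsto (fun q : Space N × P => κ q.1 {y | 0 ≤ Φ (y, q.2)})
      (𝓝[{q | Φ q = 0}] (x₀, s₀)) (𝓝 (κ x₀ {y | 0 ≤ Φ (y, s₀)})) := by
  refine tendsto_of_seq_tendsto fun q hq => ?_
  have hq1 : Tendsto q atTop (𝓝 (x₀, s₀)) := hq.mono_right nhdsWithin_le_nhds
  have hqs : Tendsto (fun n => (q n).2) atTop (𝓝 s₀) := (continuous_snd.tendsto _).comp hq1
  have hev : ∀ᶠ n in atTop, Φ (q n) = 0 ∧ IsDefining (fun y => Φ (y, (q n).2)) :=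
    (hq.eventually self_mem_nhdsWithin).and (hqs.eventually hΦ.eventually_isDefining)
  obtain ⟨n₀, hn₀⟩ := eventually_atTop.1 hev
  have hd0 := hΦ.eventually_isDefining.self_of_nhds
  -- The continuity axiom wants every set of the sequence regular, so the indices below `n₀` are
  -- dropped.
  rw [← tendsto_add_atTop_iff_nat n₀]
  refine hκ.continuous (fun n => {y | 0 ≤ Φ (y, (q (n + n₀)).2)}) _
    (fun n => (hn₀ _ (Nat.le_add_left _ _)).2.isRegularSet hβ)
    (hd0.isRegularSet hβ)
    (hΦ.tendstoRegular hβ ((tendsto_add_atTop_iff_nat n₀).2 hqs))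
    (fun n => (q (n + n₀)).1) x₀ (fun n => ?_) ?_ ?_
  · rw [(hn₀ _ (Nat.le_add_left _ _)).2.frontier_nonneg]
    exact (hn₀ _ (Nat.le_add_left _ _)).1
  · rw [hd0.frontier_nonneg]; exact h0
  · exact (tendsto_add_atTop_iff_nat n₀).2 ((continuous_fst.tendsto _).comp hq1)

theorem IsNonlocalCurvature.continuousOn (hκ : IsNonlocalCurvature ℓ β κ)
    (hβ : β ∈ Icc (0 : ℝ) 1) {Ξ : Space N → ℝ} (hΞ : IsDefining Ξ) :
    ContinuousOn (fun x => κ x {y | 0 ≤ Ξ y}) {x | Ξ x = 0} := by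
  intro x hx
  have h1 := hκ.tendsto_family hβ (x₀ := x) (hΞ.family (0 : ℝ)) hx
  have h2 : Tendsto (fun z : Space N => (z, (0 : ℝ))) (𝓝[{x | Ξ x = 0}] x)
      (𝓝[{q : Space N × ℝ | Ξ q.1 = 0}] (x, 0)) := by
    refine tendsto_nhdsWithin_of_tendsto_nhds_of_eventually_within _ ?_ ?_
    · exact (Continuous.tendsto (by fun_prop) x).mono_left nhdsWithin_le_nhds
    · exact eventually_mem_nhdsWithin
  exact h1.comp h2

/-- `cUpper` and `cLower` concern balls centred at the origin, and translation moves them.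
Antitonicity of `cUpper` is monotonicity of the curvature for internally tangent balls. -/
theorem IsNonlocalCurvature.isSmoothCurvature (hN : 1 ≤ N) (hβ : β ∈ Icc (0 : ℝ) 1)
    (hκ : IsNonlocalCurvature ℓ β κ) : ∃ K, IsSmoothCurvature κ (cUpper κ) K := by
  obtain ⟨K, hK, hballs⟩ := hκ.balls
  have : Nonempty (Fin N) := ⟨⟨0, hN⟩⟩
  have mono : ∀ Ξ₁ Ξ₂ : Space N → ℝ, IsDefining Ξ₁ → IsDefining Ξ₂ → (∀ y, 0 ≤ Ξ₁ y → 0 ≤ Ξ₂ y) →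
      ∀ x, Ξ₁ x = 0 → Ξ₂ x = 0 → κ x {y | 0 ≤ Ξ₂ y} ≤ κ x {y | 0 ≤ Ξ₁ y} :=
    fun Ξ₁ Ξ₂ h₁ h₂ hle x hx₁ hx₂ => hκ.mono _ _ (h₁.isRegularSet hβ) (h₂.isRegularSet hβ) hle x
      (by rw [h₁.frontier_nonneg, h₂.frontier_nonneg]; exact ⟨hx₂, hx₁⟩)
  have hc1 : ∀ r > 0, ContinuousOn (fun x => κ x (closedBall 0 r)) (sphere 0 r) := fun r hr => by
    have := hκ.continuousOn hβ (isDefining_ballFn 0 hr)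
    rw [setOf_ballFn_nonneg 0 hr] at this
    exact this.mono fun x hx => ballFn_eq_zero hx
  have hc2 : ∀ r > 0, ContinuousOn (fun x => κ x (ball 0 r)ᶜ) (sphere 0 r) := fun r hr => by
    have := hκ.continuousOn hβ (isDefining_ballFn 0 hr).neg
    rw [setOf_neg_ballFn_nonneg 0 hr] at this
    exact this.mono fun x hx => by simp [ballFn_eq_zero hx]
  -- Continuity on the compact sphere bounds the image, so that `sSup` and `sInf` are genuine bounds
  -- rather than default values.
  have hup : ∀ r > 0, ∀ x ∈ sphere (0 : Space N) r,
      max (κ x (closedBall 0 r)) (-κ x (ball 0 r)ᶜ) ≤ cUpper κ r := fun r hr x hx =>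
    le_csSup ((isCompact_sphere 0 r).bddAbove_image ((hc1 r hr).sup (hc2 r hr).neg))
      (mem_image_of_mem _ hx)
  have hlo : ∀ r > 0, ∀ x ∈ sphere (0 : Space N) r,
      -K < min (κ x (closedBall 0 r)) (-κ x (ball 0 r)ᶜ) := fun r hr x hx =>
    (hballs r hr).trans_le (csInf_le
      ((isCompact_sphere 0 r).bddBelow_image ((hc1 r hr).inf (hc2 r hr).neg))
      (mem_image_of_mem _ hx))
  have htr1 : ∀ x₀ x : Space N, ∀ r > 0, x ∈ sphere x₀ r →
      κ x (closedBall x₀ r) = κ (x - x₀) (closedBall 0 r) := by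
    intro x₀ x r hr hx
    have h := isDefining_ballFn x₀ hr
    have := hκ.translate (closedBall x₀ r)
      (by rw [← setOf_ballFn_nonneg x₀ hr]; exact h.isRegularSet hβ) x
      (by rw [← setOf_ballFn_nonneg x₀ hr, h.frontier_nonneg]; exact ballFn_eq_zero hx) (-x₀)
    rw [this, ← sub_eq_add_neg]
    congr 1
    ext y
    simp [dist_eq_norm]
  have htr2 : ∀ x₀ x : Space N, ∀ r > 0, x ∈ sphere x₀ r →
      κ x (ball x₀ r)ᶜ = κ (x - x₀) (ball 0 r)ᶜ := by
    intro x₀ x r hr hx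
    have h := (isDefining_ballFn x₀ hr).neg
    have := hκ.translate (ball x₀ r)ᶜ
      (by rw [← setOf_neg_ballFn_nonneg x₀ hr]; exact h.isRegularSet hβ) x
      (by rw [← setOf_neg_ballFn_nonneg x₀ hr, h.frontier_nonneg]
          simp [ballFn_eq_zero hx]) (-x₀)
    rw [this, ← sub_eq_add_neg]
    congr 1
    ext y
    simp [dist_eq_norm]
  have hsub : ∀ {x₀ x : Space N} {r : ℝ}, x ∈ sphere x₀ r → x - x₀ ∈ sphere (0 : Space N) r := by
    intro x₀ x r hx
    simpa [dist_eq_norm] using hx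
  have hbu : ∀ x₀ : Space N, ∀ r > 0, ∀ x ∈ sphere x₀ r, κ x (closedBall x₀ r) ≤ cUpper κ r :=
    fun x₀ r hr x hx => by
      rw [htr1 x₀ x r hr hx]; exact (le_max_left _ _).trans (hup r hr _ (hsub hx))
  have hcu : ∀ x₀ : Space N, ∀ r > 0, ∀ x ∈ sphere x₀ r, -κ x (ball x₀ r)ᶜ ≤ cUpper κ r :=
    fun x₀ r hr x hx => by
      rw [htr2 x₀ x r hr hx]; exact (le_max_right _ _).trans (hup r hr _ (hsub hx))
  refine ⟨K, hK, mono, fun Φ s₀ x₀ hΦ h0 => hκ.tendsto_family hβ hΦ h0, ?_, hbu, ?_, hcu, ?_⟩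
  · intro x₀ r hr x hx
    rw [htr1 x₀ x r hr hx]; exact (hlo r hr _ (hsub hx)).trans_le (min_le_left _ _)
  · intro x₀ r hr x hx
    rw [htr2 x₀ x r hr hx]; exact (hlo r hr _ (hsub hx)).trans_le (min_le_right _ _)
  · intro r hr r' hr' hrr'
    rw [mem_Ioi] at hr hr'
    refine csSup_le (((NormedSpace.sphere_nonempty).2 hr'.le).image _) ?_
    rintro _ ⟨x, hx, rfl⟩
    have hxn : ‖x‖ = r' := by simpa using hx
    -- Centre of the ball of radius `r` that touches the sphere of radius `r'` from inside at `x`.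
    set x₀ : Space N := (1 - r / r') • x with hx₀
    have hx1 : x ∈ sphere x₀ r := by
      rw [mem_sphere, dist_eq_norm, show x - x₀ = (r / r') • x by rw [hx₀]; module, norm_smul, hxn,
        Real.norm_of_nonneg (by positivity), div_mul_cancel₀ _ hr'.ne']
    have hd : dist x₀ 0 = r' - r := by
      rw [dist_zero_right, hx₀, norm_smul, hxn, Real.norm_of_nonneg
        (sub_nonneg.2 ((div_le_one hr').2 hrr')), sub_mul, div_mul_cancel₀ _ hr'.ne', one_mul]
    refine max_le ?_ ?_
    · refine le_trans ?_ (hbu x₀ r hr x hx1)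
      have := mono _ _ (isDefining_ballFn x₀ hr) (isDefining_ballFn 0 hr') (fun y hy => ?_) x
        (ballFn_eq_zero hx1) (ballFn_eq_zero hx)
      · rwa [setOf_ballFn_nonneg _ hr, setOf_ballFn_nonneg _ hr'] at this
      · have h1 : y ∈ closedBall x₀ r := by rw [← setOf_ballFn_nonneg _ hr]; exact hy
        have h2 : y ∈ closedBall (0 : Space N) r' := closedBall_subset_closedBall' (by linarith) h1
        rw [← setOf_ballFn_nonneg _ hr'] at h2
        exact h2
    · refine le_trans ?_ (hcu x₀ r hr x hx1)
      have := mono _ _ (isDefining_ballFn 0 hr').neg (isDefining_ballFn x₀ hr).neg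
        (fun y hy => ?_) x (by simp [ballFn_eq_zero hx]) (by simp [ballFn_eq_zero hx1])
      · rw [setOf_neg_ballFn_nonneg _ hr, setOf_neg_ballFn_nonneg _ hr'] at this
        linarith
      · have h1 : y ∈ (ball (0 : Space N) r')ᶜ := by rw [← setOf_neg_ballFn_nonneg _ hr']; exact hy
        have h2 : y ∈ (ball x₀ r)ᶜ :=
          compl_subset_compl.2 (ball_subset_ball' (by linarith)) h1
        rw [← setOf_neg_ballFn_nonneg _ hr] at h2
        exact h2

end SmoothCurvature

/-! ### Barriers: truncated cones and expanding radial profiles -/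

section Barriers

variable {N : ℕ}

/-- The linear form on space-time with spatial gradient `p` and time derivative `α`. -/
noncomputable def jetMap (p : Space N) (α : ℝ) : Space N × ℝ →L[ℝ] ℝ :=
  (innerSL ℝ p).comp (ContinuousLinearMap.fst ℝ (Space N) ℝ) +
    α • ContinuousLinearMap.snd ℝ (Space N) ℝ

@[simp] theorem jetMap_apply (p : Space N) (α : ℝ) (v : Space N × ℝ) :
    jetMap p α v = ⟪p, v.1⟫_ℝ + α * v.2 := by
  simp [jetMap]

theorem HasDerivAt.nonneg_of_eventually_le {f : ℝ → ℝ} {f' : ℝ} (hf : HasDerivAt f f' 0)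
    (h : ∀ᶠ τ in 𝓝[>] (0 : ℝ), f 0 ≤ f τ) : 0 ≤ f' := by
  have h1 : Tendsto (slope f 0) (𝓝[>] 0) (𝓝 f') :=
    hf.tendsto_slope.mono_left (nhdsWithin_mono (0 : ℝ) fun x (hx : 0 < x) => (hx.ne' : x ≠ 0))
  refine ge_of_tendsto h1 ?_
  filter_upwards [h, self_mem_nhdsWithin] with τ hτ hτ0
  rw [slope_def_field, sub_zero]
  exact div_nonneg (sub_nonneg.2 hτ) (le_of_lt hτ0)

/-- One half-line suffices for one linear inequality on the jet, so kinks of the barrier do no harm.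
-/
theorem jetMap_ge_of_eventually {φ : Space N × ℝ → ℝ} {p : Space N} {α : ℝ} {x : Space N} {t : ℝ}
    (hφ : HasFDerivAt φ (jetMap p α) (x, t)) (e : Space N) (σ M : ℝ)
    (h : ∀ᶠ τ in 𝓝[>] (0 : ℝ), φ (x, t) - M * τ ≤ φ (x + τ • e, t + τ * σ)) :
    -M ≤ ⟪p, e⟫_ℝ + α * σ := by
  have e1 : HasDerivAt (fun τ : ℝ => (x + τ • e, t + τ * σ)) (e, σ) 0 := by
    have a1 := ((hasDerivAt_id (0 : ℝ)).smul_const e).const_add x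
    have a2 := ((hasDerivAt_id (0 : ℝ)).mul_const σ).const_add t
    simpa using a1.prodMk a2
  have hφ' : HasFDerivAt φ (jetMap p α) (x + (0 : ℝ) • e, t + 0 * σ) := by simpa using hφ
  have e2 := HasFDerivAt.comp_hasDerivAt (l := φ) (f := fun τ : ℝ => (x + τ • e, t + τ * σ))
    (0 : ℝ) hφ' e1
  have e3 := e2.add ((hasDerivAt_id (0 : ℝ)).const_mul M)
  have := e3.nonneg_of_eventually_le (by
    filter_upwards [h] with τ hτ
    simp
    linarith)
  simp at this
  linarith

theorem jetMap_eq_of_isLocalMin {q ψ : Space N × ℝ → ℝ} {p p' : Space N} {α α' : ℝ}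
    {z : Space N × ℝ} (hq : HasFDerivAt q (jetMap p α) z) (hψ : HasFDerivAt ψ (jetMap p' α') z)
    (h : IsLocalMin (fun w => ψ w - q w) z) : p' = p ∧ α' = α := by
  have h0 := h.hasFDerivAt_eq_zero (hψ.fun_sub hq)
  have h1 : ∀ v, jetMap p' α' v = jetMap p α v := fun v => by
    have := DFunLike.congr_fun h0 v
    simpa [sub_eq_zero] using this
  constructor
  · refine ext_inner_right ℝ fun v => ?_
    simpa using h1 (v, 0)
  · simpa using h1 (0, 1)

/-- Subsolutions in a sense which only involves the jets of the functions that touch from above,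
so that it makes sense for barriers with simple kinks. -/
def IsJetSubsolution (κ : Space N → Set (Space N) → ℝ) (b : Space N × ℝ → ℝ) : Prop :=
  ∀ (x : Space N) (t : ℝ) (φ : Space N × ℝ → ℝ) (p : Space N) (α : ℝ),
    HasFDerivAt φ (jetMap p α) (x, t) →
    (∀ᶠ s in 𝓝 t, ∀ y, b (y, s) - φ (y, s) ≤ b (x, t) - φ (x, t)) →
    (p = 0 → α ≤ 0) ∧
    (p ≠ 0 → ∀ Ξ : Space N → ℝ, IsDefining Ξ → Ξ x = 0 →
      (∀ y, b (x, t) ≤ b (y, t) → 0 ≤ Ξ y) → α + ‖p‖ * κ x {y | 0 ≤ Ξ y} ≤ 0)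

/-- Contact with the maximum is contact with whichever function attains it, and the superlevel set
of that function is contained in that of the maximum. -/
theorem IsJetSubsolution.sup {κ : Space N → Set (Space N) → ℝ} {b₁ b₂ : Space N × ℝ → ℝ}
    (h₁ : IsJetSubsolution κ b₁) (h₂ : IsJetSubsolution κ b₂) :
    IsJetSubsolution κ (fun z => max (b₁ z) (b₂ z)) := by
  intro x t φ p α hφ hle
  rcases le_total (b₂ (x, t)) (b₁ (x, t)) with h | h
  · have hm : max (b₁ (x, t)) (b₂ (x, t)) = b₁ (x, t) := max_eq_left h
    obtain ⟨g1, g2⟩ := h₁ x t φ p α hφ (by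
      filter_upwards [hle] with s hs y
      have := hs y
      rw [hm] at this
      linarith [le_max_left (b₁ (y, s)) (b₂ (y, s))])
    refine ⟨g1, fun hp Ξ hΞ h0 hsub => g2 hp Ξ hΞ h0 fun y hy => hsub y ?_⟩
    exact hm.le.trans (hy.trans (le_max_left _ _))
  · have hm : max (b₁ (x, t)) (b₂ (x, t)) = b₂ (x, t) := max_eq_right h
    obtain ⟨g1, g2⟩ := h₂ x t φ p α hφ (by
      filter_upwards [hle] with s hs y
      have := hs y
      rw [hm] at this
      linarith [le_max_right (b₁ (y, s)) (b₂ (y, s))])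
    refine ⟨g1, fun hp Ξ hΞ h0 hsub => g2 hp Ξ hΞ h0 fun y hy => hsub y ?_⟩
    exact hm.le.trans (hy.trans (le_max_right _ _))

variable {κ : Space N → Set (Space N) → ℝ} {c : ℝ → ℝ} {K : ℝ}

theorem IsSmoothCurvature.le_of_closedBall_subset (h : IsSmoothCurvature κ c K) {Ξ : Space N → ℝ}
    (hΞ : IsDefining Ξ) {x₀ x : Space N} {r : ℝ} (hr : 0 < r) (hx : x ∈ sphere x₀ r)
    (h0 : Ξ x = 0) (hsub : ∀ y ∈ closedBall x₀ r, 0 ≤ Ξ y) : κ x {y | 0 ≤ Ξ y} ≤ c r := by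
  refine le_trans ?_ (h.ball_upper x₀ r hr x hx)
  rw [← setOf_ballFn_nonneg x₀ hr] at hsub ⊢
  exact h.mono _ _ (isDefining_ballFn x₀ hr) hΞ hsub x (ballFn_eq_zero hx) h0

theorem IsSmoothCurvature.lt_of_compl_ball_subset (h : IsSmoothCurvature κ c K) {Ξ : Space N → ℝ}
    (hΞ : IsDefining Ξ) {x₀ x : Space N} {r : ℝ} (hr : 0 < r) (hx : x ∈ sphere x₀ r)
    (h0 : Ξ x = 0) (hsub : ∀ y ∈ (ball x₀ r)ᶜ, 0 ≤ Ξ y) : κ x {y | 0 ≤ Ξ y} < K := by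
  refine lt_of_le_of_lt ?_ (neg_lt_neg_iff.1 (by simpa using h.compl_lower x₀ r hr x hx) :
    κ x (ball x₀ r)ᶜ < K)
  rw [← setOf_neg_ballFn_nonneg x₀ hr] at hsub ⊢
  exact h.mono _ _ (isDefining_ballFn x₀ hr).neg hΞ hsub x (by simp [ballFn_eq_zero hx]) h0

/-- Where the gradient can be nonzero, the superlevel sets are balls of radius at least `ρ`, of
curvature at most `c ρ`, and the slope is at most `L`; hence sinking at rate `C ≥ L * c ρ` is
enough. The truncation avoids small radii, where `c` may blow up. -/
theorem IsSmoothCurvature.isJetSubsolution_cone (h : IsSmoothCurvature κ c K) (x₀ : Space N)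
    {A L ρ C : ℝ} (hL : 0 ≤ L) (hρ : 0 < ρ) (hC0 : 0 ≤ C) (hC : L * c ρ ≤ C) :
    IsJetSubsolution κ (fun z => A - L * max ‖z.1 - x₀‖ ρ - C * z.2) := by
  intro x t φ p α hφ hle
  have hle0 : ∀ y, φ (x, t) - L * (max ‖y - x₀‖ ρ - max ‖x - x₀‖ ρ) ≤ φ (y, t) := fun y => by
    have := hle.self_of_nhds y
    simp only at this
    linarith
  have hα : α ≤ -C := by
    have := jetMap_ge_of_eventually hφ 0 (-1) (-C) (by
      have hc : Tendsto (fun τ : ℝ => t + τ * (-1)) (𝓝[>] 0) (𝓝 t) := by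
        have : Tendsto (fun τ : ℝ => t + τ * (-1)) (𝓝 0) (𝓝 (t + 0 * (-1))) :=
          Continuous.tendsto (by fun_prop) 0
        simpa using this.mono_left nhdsWithin_le_nhds
      filter_upwards [hc.eventually hle] with τ hτ
      have := hτ (x + τ • 0)
      simp only [smul_zero, add_zero] at this ⊢
      linarith)
    simp at this
    linarith
  refine ⟨fun _ => by linarith, fun hp Ξ hΞ h0 hsub => ?_⟩
  have hpn : 0 < ‖p‖ := norm_pos_iff.2 hp
  -- Motion against `p`: on the plateau `M = 0` would force `p = 0`, and outside it `M = L * ‖p‖`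
  -- yields `‖p‖ ≤ L`.
  have hdir : ∀ M : ℝ, (∀ᶠ τ in 𝓝[>] (0 : ℝ),
      L * (max ‖x - τ • p - x₀‖ ρ - max ‖x - x₀‖ ρ) ≤ M * τ) → ‖p‖ ^ 2 ≤ M := by
    intro M hM
    have := jetMap_ge_of_eventually hφ (-p) 0 M (by
      filter_upwards [hM] with τ hτ
      have := hle0 (x - τ • p)
      simp only [mul_zero, add_zero, smul_neg, ← sub_eq_add_neg]
      linarith)
    rw [inner_neg_right, real_inner_self_eq_norm_sq] at this
    linarith
  rcases lt_or_ge ‖x - x₀‖ ρ with hr | hr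
  · exfalso
    have := hdir 0 (by
      have hc : ContinuousAt (fun τ : ℝ => ‖x - τ • p - x₀‖) 0 := by fun_prop
      have hev : ∀ᶠ τ : ℝ in 𝓝 0, ‖x - τ • p - x₀‖ < ρ :=
        hc.eventually_lt continuousAt_const (by simpa using hr)
      filter_upwards [hev.filter_mono nhdsWithin_le_nhds] with τ hτ
      rw [max_eq_right hτ.le, max_eq_right hr.le]
      simp)
    have h2 : 0 < ‖p‖ ^ 2 := by positivity
    linarith
  · have hpL : ‖p‖ ≤ L := by
      have := hdir (L * ‖p‖) (by
        filter_upwards [self_mem_nhdsWithin] with τ (hτ : 0 < τ)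
        rw [mul_assoc]
        refine mul_le_mul_of_nonneg_left ?_ hL
        have h1 : ‖x - τ • p - x₀‖ ≤ ‖x - x₀‖ + ‖p‖ * τ := by
          have : x - τ • p - x₀ = (x - x₀) - τ • p := by abel
          rw [this]
          refine (norm_sub_le _ _).trans ?_
          rw [norm_smul, Real.norm_of_nonneg hτ.le, mul_comm]
        rw [max_eq_left hr, sub_le_iff_le_add, add_comm]
        exact max_le h1 (hr.trans (le_add_of_nonneg_right (by positivity))))
      rw [sq] at this
      exact le_of_mul_le_mul_right this hpn
    have hr0 : 0 < ‖x - x₀‖ := hρ.trans_le hr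
    have hκ : κ x {y | 0 ≤ Ξ y} ≤ c ρ := by
      refine (h.le_of_closedBall_subset hΞ hr0 (x₀ := x₀) (by rw [mem_sphere, dist_eq_norm]) h0
        fun y hy => hsub y ?_).trans (h.antitone (mem_Ioi.2 hρ) (mem_Ioi.2 hr0) hr)
      rw [mem_closedBall, dist_eq_norm] at hy
      have := mul_le_mul_of_nonneg_left (max_le_max_right ρ hy) hL
      simp only
      linarith
    have h1 : ‖p‖ * κ x {y | 0 ≤ Ξ y} ≤ C := by
      refine (mul_le_mul_of_nonneg_left hκ hpn.le).trans ?_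
      rcases le_total 0 (c ρ) with hc | hc
      · exact (mul_le_mul_of_nonneg_right hpL hc).trans hC
      · exact (mul_nonpos_of_nonneg_of_nonpos hpn.le hc).trans hC0
    linarith

/-- Superlevel sets are complements of balls, of curvature less than `K`, and they recede with speed
`K`. Backwards in time, the barrier does not decrease along any motion of speed at most `K`; the
velocity `-(K / ‖p‖) • p` gives `α ≤ -K ‖p‖`. Only monotonicity of the profile matters. -/
theorem IsSmoothCurvature.isJetSubsolution_expanding (h : IsSmoothCurvature κ c K) {g : ℝ → ℝ}
    (hg : Monotone g) : IsJetSubsolution κ (fun z => g (‖z.1‖ - K * z.2)) := by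
  intro x t φ p α hφ hle
  have hdir : ∀ e : Space N, ‖e‖ ≤ K → 0 ≤ ⟪p, e⟫_ℝ - α := by
    intro e he
    have := jetMap_ge_of_eventually hφ e (-1) 0 (by
      have hc : Tendsto (fun τ : ℝ => t + τ * (-1)) (𝓝[>] 0) (𝓝 t) := by
        have : Tendsto (fun τ : ℝ => t + τ * (-1)) (𝓝 0) (𝓝 (t + 0 * (-1))) :=
          Continuous.tendsto (by fun_prop) 0
        simpa using this.mono_left nhdsWithin_le_nhds
      filter_upwards [hc.eventually hle, self_mem_nhdsWithin] with τ hτ (hτ0 : 0 < τ)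
      have h1 := hτ (x + τ • e)
      have h2 : g (‖x‖ - K * t) ≤ g (‖x + τ • e‖ - K * (t + τ * (-1))) := by
        refine hg ?_
        have h3 : ‖x‖ ≤ ‖x + τ • e‖ + ‖τ • e‖ := by
          simpa using norm_sub_le (x + τ • e) (τ • e)
        rw [norm_smul, Real.norm_of_nonneg hτ0.le] at h3
        have h4 := mul_le_mul_of_nonneg_left he hτ0.le
        nlinarith
      linarith)
    linarith
  constructor
  · intro hp
    have := hdir 0 (by simpa using h.K_pos.le)
    simp at this
    exact this
  · intro hp Ξ hΞ h0 hsub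
    have hpn : 0 < ‖p‖ := norm_pos_iff.2 hp
    have hα : α ≤ -(K * ‖p‖) := by
      have := hdir (-(K / ‖p‖) • p) (by
        rw [norm_smul, norm_neg, Real.norm_of_nonneg (div_nonneg h.K_pos.le hpn.le),
          div_mul_cancel₀ _ hpn.ne'])
      rw [real_inner_smul_right, real_inner_self_eq_norm_sq] at this
      have e : -(K / ‖p‖) * ‖p‖ ^ 2 = -(K * ‖p‖) := by field_simp
      linarith
    -- At the origin the superlevel set would be the whole space and `Ξ` would have a critical zero.
    have hx : 0 < ‖x‖ := by
      rw [norm_pos_iff]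
      rintro rfl
      have hmin : IsLocalMin Ξ 0 := Eventually.of_forall fun y => by
        rw [h0]
        refine hsub y (hg ?_)
        simp
      exact hΞ.regular 0 h0 hmin.fderiv_eq_zero
    have hκ : κ x {y | 0 ≤ Ξ y} < K := by
      refine h.lt_of_compl_ball_subset hΞ hx (x₀ := 0) (by simp) h0 fun y hy => hsub y (hg ?_)
      have : ‖x‖ ≤ ‖y‖ := by simpa using hy
      simpa using this
    have := mul_le_mul_of_nonneg_left hκ.le hpn.le
    linarith [mul_comm K ‖p‖]

end Barriers

/-! ### Smoothing radial functions by a flat factor -/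

section FlatFunctions

/-- A function which is smooth on `[0,∞)`, composed with the square root and multiplied by a
function that is flat at the origin. -/
theorem tendsto_sqrt_mul_expNegInvGlue {g : ℝ → ℝ} (hg : ContinuousOn g (Ici 0)) (m : ℕ) :
    Tendsto (fun s => (√s)⁻¹ ^ m * g √s * expNegInvGlue s) (𝓝 0) (𝓝 0) := by
  have h1 := expNegInvGlue.tendsto_polynomial_inv_mul_zero (Polynomial.X ^ m)
  have h2 : Tendsto (fun s => √s ^ m * g √s) (𝓝 0) (𝓝 (√0 ^ m * g √0)) := by
    have h3 : Tendsto (fun s => √s) (𝓝 0) (𝓝[Ici 0] √0) :=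
      tendsto_nhdsWithin_of_tendsto_nhds_of_eventually_within _
        (Real.continuous_sqrt.tendsto 0) (Eventually.of_forall Real.sqrt_nonneg)
    exact ((Real.continuous_sqrt.tendsto 0).pow m).mul
      (((hg _ (Real.sqrt_nonneg 0)).tendsto).comp h3)
  have h4 := h1.mul h2
  rw [zero_mul] at h4
  refine h4.congr fun s => ?_
  rcases le_or_gt s 0 with hs | hs
  · simp [expNegInvGlue.zero_of_nonpos hs]
  · have hr : 0 < √s := Real.sqrt_pos.2 hs
    have e : s = √s ^ 2 := (Real.sq_sqrt hs.le).symm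
    have e2 : s⁻¹ ^ m * √s ^ m = (√s)⁻¹ ^ m := by
      rw [← mul_pow]
      congr 1
      nth_rewrite 1 [e]
      field_simp
    simp only [Polynomial.eval_pow, Polynomial.eval_X]
    rw [← e2]
    ring

/-- The derivative has the same form, with `m + 4` for `m` and another smooth profile, so smoothness
follows by induction. For `s ≤ 0` the default values of the root and the inverse are harmless
because the flat factor vanishes. -/
theorem hasDerivAt_sqrt_mul_expNegInvGlue {g : ℝ → ℝ} (hg : ContDiffOn ℝ ∞ g (Ici 0)) (m : ℕ)
    (s : ℝ) :
    HasDerivAt (fun s => (√s)⁻¹ ^ m * g √s * expNegInvGlue s)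
      ((√s)⁻¹ ^ (m + 4) * (-(m / 2) * √s ^ 2 * g √s + √s ^ 3 * derivWithin g (Ici 0) √s / 2 + g √s)
        * expNegInvGlue s) s := by
  rcases lt_trichotomy s 0 with hs | rfl | hs
  · rw [expNegInvGlue.zero_of_nonpos hs.le, mul_zero]
    refine (hasDerivAt_const s 0).congr_of_eventuallyEq ?_
    filter_upwards [gt_mem_nhds hs] with y hy
    rw [expNegInvGlue.zero_of_nonpos hy.le, mul_zero]
  · rw [expNegInvGlue.zero, mul_zero, hasDerivAt_iff_tendsto_slope]
    -- The difference quotient at the origin is the same expression with exponent `m + 2`.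
    have h1 := (tendsto_sqrt_mul_expNegInvGlue hg.continuousOn (m + 2)).mono_left
      (nhdsWithin_le_nhds (s := {(0 : ℝ)}ᶜ))
    refine h1.congr fun s => ?_
    rw [slope_def_field, expNegInvGlue.zero, mul_zero, sub_zero, sub_zero]
    rcases le_or_gt s 0 with hs | hs
    · simp [expNegInvGlue.zero_of_nonpos hs]
    · have e : (√s)⁻¹ ^ 2 = s⁻¹ := by rw [inv_pow, Real.sq_sqrt hs.le]
      rw [pow_add, e]
      ring
  · have hr : 0 < √s := Real.sqrt_pos.2 hs
    have hsq : HasDerivAt (fun s => √s) (1 / (2 * √s)) s := Real.hasDerivAt_sqrt hs.ne'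
    have hgd : HasDerivAt g (derivWithin g (Ici 0) √s) √s := by
      have := (hg.differentiableOn (by simp) √s hr.le).hasDerivWithinAt
      exact this.hasDerivAt (Ici_mem_nhds hr)
    have hE : HasDerivAt expNegInvGlue ((s⁻¹) ^ 2 * expNegInvGlue s) s := by
      have := expNegInvGlue.hasDerivAt_polynomial_eval_inv_mul 1 s
      simpa using this
    have h1 := (((hsq.inv hr.ne').pow m).mul (hgd.comp s hsq)).mul hE
    refine h1.congr_deriv ?_
    have e : s⁻¹ = (√s)⁻¹ ^ 2 := by rw [inv_pow, Real.sq_sqrt hs.le]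
    have e1 : m * (√s)⁻¹ ^ (m - 1) * (√s)⁻¹ = m * (√s)⁻¹ ^ m := by
      rcases Nat.eq_zero_or_pos m with rfl | hm
      · simp
      · rw [mul_assoc, ← pow_succ, Nat.sub_add_cancel hm]
    simp only [Pi.mul_apply, Pi.pow_apply, Pi.inv_apply, Function.comp_apply]
    have e3 : ↑m * (√s)⁻¹ ^ (m - 1) * (-(1 / (2 * √s)) / √s ^ 2) =
        -(m / 2) * (√s)⁻¹ ^ m * (√s)⁻¹ ^ 2 := by
      calc _ = -(1 / 2) * (√s)⁻¹ ^ 2 * (m * (√s)⁻¹ ^ (m - 1) * (√s)⁻¹) := by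
            field_simp
        _ = _ := by rw [e1]; ring
    rw [e3, e]
    have e4 : (√s)⁻¹ * √s = 1 := inv_mul_cancel₀ hr.ne'
    generalize √s = r at *
    have h2 : r⁻¹ ^ 4 * r ^ 2 = r⁻¹ ^ 2 := by field_simp
    have h3 : r⁻¹ ^ 4 * r ^ 3 = r⁻¹ := by field_simp
    have h4 : 1 / (2 * r) = r⁻¹ / 2 := by field_simp
    rw [h4, pow_add]
    linear_combination (-(r⁻¹ ^ m * (-(m / 2) * g r) * expNegInvGlue s)) * h2 -
      (r⁻¹ ^ m * (derivWithin g (Ici 0) r / 2) * expNegInvGlue s) * h3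

theorem contDiff_sqrt_mul_expNegInvGlue {g : ℝ → ℝ} (hg : ContDiffOn ℝ ∞ g (Ici 0)) (m : ℕ) :
    ContDiff ℝ ∞ (fun s => (√s)⁻¹ ^ m * g √s * expNegInvGlue s) := by
  refine contDiff_all_iff_nat.2 (fun n => ?_) ⊤
  induction n generalizing g m with
  | zero =>
    exact contDiff_zero.2 (continuous_iff_continuousAt.2 fun s =>
      (hasDerivAt_sqrt_mul_expNegInvGlue hg m s).continuousAt)
  | succ n ih =>
    rw [show ((n + 1 : ℕ) : WithTop ℕ∞) = n + 1 from rfl]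
    refine contDiff_succ_iff_deriv.2 ⟨fun s =>
      (hasDerivAt_sqrt_mul_expNegInvGlue hg m s).differentiableAt, by simp, ?_⟩
    have hg' : ContDiffOn ℝ ∞ (fun r => -(m / 2 : ℝ) * r ^ 2 * g r +
        r ^ 3 * derivWithin g (Ici 0) r / 2 + g r) (Ici 0) := by
      have h1 : ContDiffOn ℝ ∞ (derivWithin g (Ici 0)) (Ici 0) :=
        hg.derivWithin (uniqueDiffOn_Ici 0) (by simp)
      have h2 : ContDiffOn ℝ ∞ (fun r : ℝ => r) (Ici 0) := contDiffOn_id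
      exact (((contDiffOn_const.mul (h2.pow 2)).mul hg).add
        (((h2.pow 3).mul h1).div_const 2)).add hg
    convert! ih hg' (m + 4) using 1
    funext s
    exact (hasDerivAt_sqrt_mul_expNegInvGlue hg m s).deriv

/-- A radial function with a smooth profile becomes smooth at the origin after multiplication by a
flat function. -/
theorem contDiff_radial_mul_expNegInvGlue {V : Type*} [NormedAddCommGroup V]
    [InnerProductSpace ℝ V] {f : ℝ → ℝ} (hf : ContDiffOn ℝ ∞ f (Ici 0)) {ε : ℝ} (hε : 0 < ε) :
    ContDiff ℝ ∞ (fun x : V => f ‖x‖ * expNegInvGlue (‖x‖ ^ 2 / ε)) := by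
  have hg : ContDiffOn ℝ ∞ (fun r => f (√ε * r)) (Ici 0) :=
    hf.comp (contDiffOn_const.mul contDiffOn_id) fun r hr =>
      mul_nonneg (Real.sqrt_nonneg _) hr
  have h1 := (contDiff_sqrt_mul_expNegInvGlue hg 0).comp
    ((contDiff_id.norm_sq ℝ (E := V)).div_const ε)
  convert! h1 using 1
  funext x
  have e : √ε * √(‖x‖ ^ 2 / ε) = ‖x‖ := by
    rw [← Real.sqrt_mul hε.le, mul_div_cancel₀ _ hε.ne', Real.sqrt_sq (norm_nonneg _)]
  simp only [Function.comp, pow_zero, one_mul, id, e]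

end FlatFunctions

/-! ### Smooth radial majorants of profiles in `𝓕` -/

section RadialTests

variable {N : ℕ} {κ : Space N → Set (Space N) → ℝ} {f : ℝ → ℝ}

theorem InFamilyF.hasDerivWithinAt (hf : InFamilyF κ f) {r : ℝ} (hr : 0 ≤ r) :
    HasDerivWithinAt f (derivWithin f (Ici 0) r) (Ici 0) r :=
  (hf.smooth.differentiableOn (by simp) r hr).hasDerivWithinAt

theorem InFamilyF.hasDerivAt (hf : InFamilyF κ f) {r : ℝ} (hr : 0 < r) :
    HasDerivAt f (derivWithin f (Ici 0) r) r :=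
  (hf.hasDerivWithinAt hr.le).hasDerivAt (Ici_mem_nhds hr)

/-- Near the origin `f'` increases from `0`. The last bound is convexity, through the mean value
theorem; it absorbs the derivative of the flat factor later. -/
theorem InFamilyF.exists_strictMonoOn (hf : InFamilyF κ f) :
    ∃ ρ₀ > 0, (∀ r ∈ Ioc 0 ρ₀, 0 < derivWithin f (Ici 0) r) ∧ StrictMonoOn f (Icc 0 ρ₀) ∧
      ∀ r ∈ Icc 0 ρ₀, f r ≤ r * derivWithin f (Ici 0) r := by
  obtain ⟨ρ, hρ, hpos⟩ := (mem_nhdsGT_iff_exists_Ioo_subset).1 hf.deriv2_pos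
  have hρ' : (0 : ℝ) < ρ := hρ
  have hsm' : ContDiffOn ℝ ∞ (derivWithin f (Ici 0)) (Ici 0) :=
    hf.smooth.derivWithin (uniqueDiffOn_Ici 0) (by simp)
  have hmono' : StrictMonoOn (derivWithin f (Ici 0)) (Icc 0 (ρ / 2)) := by
    refine strictMonoOn_of_deriv_pos (convex_Icc _ _)
      (hsm'.continuousOn.mono fun x hx => hx.1) fun r hr => ?_
    rw [interior_Icc] at hr
    have h1 : 0 < iteratedDerivWithin 2 f (Ici 0) r := hpos ⟨hr.1, by linarith [hr.2]⟩
    rw [iteratedDerivWithin_succ, derivWithin_of_mem_nhds (Ici_mem_nhds hr.1)] at h1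
    rwa [iteratedDerivWithin_one] at h1
  have hpos' : ∀ r ∈ Ioc 0 (ρ / 2), 0 < derivWithin f (Ici 0) r := fun r hr => by
    have := hmono' (left_mem_Icc.2 (by linarith)) ⟨hr.1.le, hr.2⟩ hr.1
    rwa [hf.deriv_zero] at this
  refine ⟨ρ / 2, by linarith, hpos', ?_, ?_⟩
  · refine strictMonoOn_of_deriv_pos (convex_Icc _ _)
      (hf.smooth.continuousOn.mono fun x hx => hx.1) fun r hr => ?_
    rw [interior_Icc] at hr
    rw [(hf.hasDerivAt hr.1).deriv]
    exact hpos' r ⟨hr.1, hr.2.le⟩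
  · intro r hr
    rcases hr.1.eq_or_lt with h0 | h0
    · rw [← h0, hf.zero]; simp
    · obtain ⟨ξ, hξ, he⟩ := exists_hasDerivAt_eq_slope f (derivWithin f (Ici 0)) h0
        (hf.smooth.continuousOn.mono fun x hx => hx.1) (fun x hx => hf.hasDerivAt hx.1)
      rw [hf.zero, sub_zero, sub_zero] at he
      have h1 := hmono' ⟨hξ.1.le, hξ.2.le.trans hr.2⟩ hr hξ.2
      rw [he, div_lt_iff₀ h0] at h1
      linarith

theorem InFamilyF.exists_bound (hf : InFamilyF κ f) : ∃ L, 1 ≤ L ∧ ∀ r, 0 ≤ r → f r + 1 ≤ L := by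
  obtain ⟨M, hM, c, hc⟩ := hf.eventually_const
  obtain ⟨B, hB⟩ := (isCompact_Icc (a := (0 : ℝ)) (b := M)).exists_bound_of_continuousOn
    (hf.smooth.continuousOn.mono fun x hx => hx.1)
  simp only [Real.norm_eq_abs] at hB
  refine ⟨|B| + 1, by linarith [abs_nonneg B], fun r hr => ?_⟩
  rcases le_total r M with h | h
  · linarith [le_abs_self (f r), hB r ⟨hr, h⟩, le_abs_self B]
  · rw [hc r h, ← hc M le_rfl]
    linarith [le_abs_self (f M), hB M ⟨hM.le, le_rfl⟩, le_abs_self B]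

/-- A smooth radial cutoff, equal to `0` for `r ≤ ρ` and to `1` for `r ≥ 2ρ`. -/
noncomputable def radialCutoff (ρ r : ℝ) : ℝ := Real.smoothTransition (r ^ 2 / ρ ^ 2 - 1)

theorem radialCutoff_of_le {ρ r : ℝ} (hρ : 0 < ρ) (hr : 0 ≤ r) (h : r ≤ ρ) :
    radialCutoff ρ r = 0 := by
  refine Real.smoothTransition.zero_of_nonpos (sub_nonpos.2 ((div_le_one (by positivity)).2 ?_))
  exact pow_le_pow_left₀ hr h 2

theorem radialCutoff_of_ge {ρ r : ℝ} (hρ : 0 < ρ) (h : 2 * ρ ≤ r) : radialCutoff ρ r = 1 := by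
  refine Real.smoothTransition.one_of_one_le ?_
  rw [le_sub_iff_add_le, le_div_iff₀ (by positivity)]
  nlinarith

theorem radialCutoff_nonneg (ρ r : ℝ) : 0 ≤ radialCutoff ρ r := Real.smoothTransition.nonneg _

theorem radialCutoff_le_one (ρ r : ℝ) : radialCutoff ρ r ≤ 1 := Real.smoothTransition.le_one _

theorem contDiff_radialCutoff (ρ : ℝ) : ContDiff ℝ ∞ (radialCutoff ρ) :=
  Real.smoothTransition.contDiff.comp
    (((contDiff_id.pow 2).div_const _).sub contDiff_const)

theorem contDiff_radialCutoff_norm {V : Type*} [NormedAddCommGroup V] [InnerProductSpace ℝ V]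
    (ρ : ℝ) : ContDiff ℝ ∞ (fun x : V => radialCutoff ρ ‖x‖) :=
  Real.smoothTransition.contDiff.comp
    ((((contDiff_id (E := V)).norm_sq ℝ).div_const _).sub contDiff_const)

/-- Apart from smoothness and constancy near infinity, the conditions only see the germ at the
origin, where the function is `2 f`. -/
theorem InFamilyF.cutoff (hf : InFamilyF κ f) {ρ : ℝ} (hρ : 0 < ρ) (L : ℝ) :
    InFamilyF κ (fun r => 2 * f r * (1 - radialCutoff ρ r) + L * radialCutoff ρ r) := by
  set F : ℝ → ℝ := fun r => 2 * f r * (1 - radialCutoff ρ r) + L * radialCutoff ρ r with hF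
  have heq : ∀ r, 0 ≤ r → r ≤ ρ → F r = 2 * f r := fun r h0 h => by
    simp [hF, radialCutoff_of_le hρ h0 h]
  have hev : ∀ r, 0 ≤ r → r < ρ → F =ᶠ[𝓝[Ici 0] r] fun r => 2 * f r := fun r h0 h => by
    filter_upwards [self_mem_nhdsWithin, nhdsWithin_le_nhds (Iio_mem_nhds h)] with y hy hy'
    exact heq y hy (le_of_lt hy')
  have hd : ∀ r, 0 ≤ r → r < ρ → derivWithin F (Ici 0) r = 2 * derivWithin f (Ici 0) r :=
    fun r h0 h => by
      rw [(hev r h0 h).derivWithin_eq (heq r h0 h.le)]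
      exact ((hf.hasDerivWithinAt h0).const_mul 2).derivWithin (uniqueDiffOn_Ici 0 r h0)
  have hd2 : ∀ r, 0 ≤ r → r < ρ →
      iteratedDerivWithin 2 F (Ici 0) r = 2 * iteratedDerivWithin 2 f (Ici 0) r :=
    fun r h0 h => by
      have e1 : ∀ g : ℝ → ℝ, iteratedDerivWithin 2 g (Ici 0) r =
          derivWithin (derivWithin g (Ici 0)) (Ici 0) r := fun g => by
        rw [iteratedDerivWithin_succ, iteratedDerivWithin_one]
      rw [e1, e1]
      have e2 : derivWithin F (Ici 0) =ᶠ[𝓝[Ici 0] r] fun r => 2 * derivWithin f (Ici 0) r := by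
        filter_upwards [self_mem_nhdsWithin, nhdsWithin_le_nhds (Iio_mem_nhds h)] with y hy hy'
        exact hd y hy hy'
      rw [e2.derivWithin_eq (hd r h0 h)]
      have hsm' : ContDiffOn ℝ ∞ (derivWithin f (Ici 0)) (Ici 0) :=
        hf.smooth.derivWithin (uniqueDiffOn_Ici 0) (by simp)
      exact ((hsm'.differentiableOn (by simp) r h0).hasDerivWithinAt.const_mul
        (2 : ℝ)).derivWithin (uniqueDiffOn_Ici 0 r h0)
  have hsmall : ∀ᶠ r in 𝓝[>] (0 : ℝ), 0 ≤ r ∧ r < ρ := by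
    filter_upwards [Ioo_mem_nhdsGT hρ] with r hr
    exact ⟨hr.1.le, hr.2⟩
  have hc := (contDiff_radialCutoff ρ).contDiffOn (s := Ici (0 : ℝ))
  exact
  { smooth := ((contDiffOn_const.mul hf.smooth).mul (contDiffOn_const.sub hc)).add
      (contDiffOn_const.mul hc)
    zero := by rw [heq 0 le_rfl hρ.le, hf.zero, mul_zero]
    deriv_zero := by rw [hd 0 le_rfl hρ, hf.deriv_zero, mul_zero]
    deriv2_zero := by rw [hd2 0 le_rfl hρ, hf.deriv2_zero, mul_zero]
    deriv2_pos := by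
      filter_upwards [hf.deriv2_pos, hsmall] with r h1 h2
      rw [hd2 r h2.1 h2.2]
      linarith
    eventually_const := by
      refine ⟨2 * ρ, by positivity, L, fun r hr => ?_⟩
      simp [hF, radialCutoff_of_ge hρ hr]
    tendsto := by
      have := hf.tendsto.const_mul 2
      rw [mul_zero] at this
      refine this.congr' ?_
      filter_upwards [hsmall] with r h
      rw [hd r h.1 h.2]
      ring }

theorem expNegInvGlue_of_pos {x : ℝ} (hx : 0 < x) : expNegInvGlue x = Real.exp (-x⁻¹) := by
  simp [expNegInvGlue, hx.not_ge]

theorem expNegInvGlue_le_one (x : ℝ) : expNegInvGlue x ≤ 1 := by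
  rcases le_or_gt x 0 with h | h
  · rw [expNegInvGlue.zero_of_nonpos h]; exact zero_le_one
  · rw [expNegInvGlue_of_pos h]
    exact Real.exp_le_one_iff.2 (by simpa using h.le)

theorem exists_expNegInvGlue_ge {ρ : ℝ} (hρ : 0 < ρ) :
    ∃ ε > 0, 3 / 4 ≤ expNegInvGlue (ρ ^ 2 / ε) := by
  have hc : ContinuousAt (fun ε : ℝ => Real.exp (-(ε / ρ ^ 2))) 0 := by fun_prop
  have h1 : ∀ᶠ ε : ℝ in 𝓝[>] 0, 3 / 4 < Real.exp (-(ε / ρ ^ 2)) :=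
    (continuousAt_const.eventually_lt hc (by norm_num)).filter_mono nhdsWithin_le_nhds
  obtain ⟨ε, h2, hε⟩ := (h1.and self_mem_nhdsWithin).exists
  have hε' : 0 < ε := hε
  refine ⟨ε, hε', ?_⟩
  rw [expNegInvGlue_of_pos (by positivity), inv_div]
  exact h2.le

theorem hasDerivAt_mul_expNegInvGlue (hf : InFamilyF κ f) {ε r : ℝ} (_hε : 0 < ε) (hr : 0 < r) :
    HasDerivAt (fun r => f r * expNegInvGlue (r ^ 2 / ε))
      (derivWithin f (Ici 0) r * expNegInvGlue (r ^ 2 / ε) +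
        f r / r * (2 * (ε / r ^ 2 * expNegInvGlue (r ^ 2 / ε)))) r := by
  have hE : HasDerivAt expNegInvGlue (((r ^ 2 / ε)⁻¹) ^ 2 * expNegInvGlue (r ^ 2 / ε))
      (r ^ 2 / ε) := by
    have := expNegInvGlue.hasDerivAt_polynomial_eval_inv_mul 1 (r ^ 2 / ε)
    simpa only [Polynomial.eval_one, one_mul, Polynomial.derivative_one, sub_zero, mul_one,
      Polynomial.eval_pow, Polynomial.eval_X] using this
  have h1 := (hf.hasDerivAt hr).mul (hE.comp r ((hasDerivAt_pow 2 r).div_const ε))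
  refine h1.congr_deriv ?_
  simp only [Function.comp_apply]
  field_simp
  ring

/-- Smooth radial functions which approximate a profile in the family `𝓕` from above up to a
neighbourhood of the origin, keeping the size of the derivative. -/
theorem InFamilyF.exists_radial (hf : InFamilyF κ f) :
    ∃ ρ₁ > 0, StrictMonoOn f (Icc 0 ρ₁) ∧ (∀ r ∈ Ioc 0 ρ₁, 0 < derivWithin f (Ici 0) r) ∧
    ∃ F : ℝ → ℝ, InFamilyF κ F ∧ ∀ ρ ∈ Ioo 0 ρ₁, ∃ G : ℝ → ℝ, ∃ γ > 0,
      ContDiff ℝ ∞ (fun y : Space N => G ‖y‖) ∧ (∃ M c : ℝ, ∀ r ≥ M, G r = c) ∧ G 0 = 0 ∧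
      (∀ r, 0 ≤ r → 0 ≤ f r → 0 ≤ G r ∧ G r ≤ F r) ∧
      (∀ r ≥ ρ, 0 ≤ f r → f r + γ ≤ G r) ∧
      (∀ r ∈ Ioo 0 ρ₁, ∃ d, HasDerivAt G d r ∧ 0 < d ∧ d ≤ 6 * derivWithin f (Ici 0) r) ∧
      ∀ r ∈ Ioo 0 ρ₁, ∀ s ≥ 0, (G r ≤ G s ↔ r ≤ s) := by
  obtain ⟨ρ₀, hρ₀, hpos, hmono, hle⟩ := hf.exists_strictMonoOn
  obtain ⟨L, hL1, hL⟩ := hf.exists_bound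
  -- Half of `ρ₀`, so that the transition zone `[ρ₁, 2ρ₁]` of the cutoff stays where `f` increases.
  set ρ₁ := ρ₀ / 2 with hρ₁
  have hρ₁0 : 0 < ρ₁ := by positivity
  have hsub : ρ₁ ≤ ρ₀ := by linarith
  refine ⟨ρ₁, hρ₁0, hmono.mono (Icc_subset_Icc_right hsub),
    fun r hr => hpos r ⟨hr.1, hr.2.trans hsub⟩, _, hf.cutoff hρ₁0 (2 * L), fun ρ hρ => ?_⟩
  -- Beyond `ρ` the function `2 f E` is then at least `3/2 f`, which before the end of the
  -- transition zone exceeds `f` by `f ρ / 2` or more.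
  obtain ⟨ε, hε, hε34⟩ := exists_expNegInvGlue_ge hρ.1
  set E : ℝ → ℝ := fun r => expNegInvGlue (r ^ 2 / ε) with hE
  set θ := radialCutoff ρ₁ with hθ
  have hE0 : ∀ r, 0 ≤ E r := fun r => expNegInvGlue.nonneg _
  have hE1 : ∀ r, E r ≤ 1 := fun r => expNegInvGlue_le_one _
  have hEpos : ∀ r, 0 < r → 0 < E r := fun r hr => expNegInvGlue.pos_of_pos (by positivity)
  have hEmono : ∀ r s, 0 ≤ r → r ≤ s → E r ≤ E s := fun r s hr hs =>
    expNegInvGlue.monotone (div_le_div_of_nonneg_right (pow_le_pow_left₀ hr hs 2) hε.le)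
  have hθ0 : ∀ r, 0 ≤ θ r := radialCutoff_nonneg ρ₁
  have hθ1 : ∀ r, 0 ≤ 1 - θ r := fun r => sub_nonneg.2 (radialCutoff_le_one ρ₁ r)
  have hf0 : ∀ r ∈ Ioc 0 ρ₀, 0 < f r := fun r hr => by
    have := hmono (left_mem_Icc.2 hρ₀.le) ⟨hr.1.le, hr.2⟩ hr.1
    rwa [hf.zero] at this
  have hfle : ∀ r s, 0 ≤ r → r ≤ s → s ≤ ρ₀ → f r ≤ f s := fun r s h0 h1 h2 =>
    hmono.monotoneOn ⟨h0, h1.trans h2⟩ ⟨h0.trans h1, h2⟩ h1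
  set G : ℝ → ℝ := fun r => 2 * (f r * E r) * (1 - θ r) + 2 * L * θ r with hG
  have hGin : ∀ r, 0 ≤ r → r ≤ ρ₁ → G r = 2 * (f r * E r) := fun r h0 h1 => by
    simp [hG, hθ, radialCutoff_of_le hρ₁0 h0 h1]
  have hGderiv : ∀ r ∈ Ioo 0 ρ₁,
      ∃ d, HasDerivAt G d r ∧ 0 < d ∧ d ≤ 6 * derivWithin f (Ici 0) r := by
    intro r hr
    have hr0 : r ∈ Ioc 0 ρ₀ := ⟨hr.1, hr.2.le.trans hsub⟩
    have hd := (hasDerivAt_mul_expNegInvGlue hf hε hr.1).const_mul 2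
    have hev : G =ᶠ[𝓝 r] fun r => 2 * (f r * expNegInvGlue (r ^ 2 / ε)) := by
      filter_upwards [Ioo_mem_nhds hr.1 hr.2] with y hy
      exact hGin y hy.1.le hy.2.le
    refine ⟨_, hd.congr_of_eventuallyEq hev, ?_, ?_⟩
    · have h1 := mul_pos (hpos r hr0) (hEpos r hr.1)
      have h2 : 0 ≤ f r / r * (2 * (ε / r ^ 2 * E r)) := by
        have := (hf0 r hr0).le
        have := hE0 r
        have := hr.1.le
        positivity
      simp only [hE] at h1 h2
      linarith
    · have h1 : derivWithin f (Ici 0) r * E r ≤ derivWithin f (Ici 0) r :=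
        mul_le_of_le_one_right (hpos r hr0).le (hE1 r)
      have h2 : f r / r ≤ derivWithin f (Ici 0) r := by
        rw [div_le_iff₀ hr.1, mul_comm]
        exact hle r ⟨hr.1.le, hr0.2⟩
      -- This is `x e⁻ˣ ≤ 1` for `x = ε / r²`. The flat factor therefore contributes at most `2 f'`,
      -- and the total is `2 (1 + 2) = 6` times `f'`.
      have h3 : ε / r ^ 2 * E r ≤ 1 := by
        have hx : 0 < r ^ 2 / ε := div_pos (pow_pos hr.1 2) hε
        simp only [hE]
        rw [expNegInvGlue_of_pos hx, inv_div, Real.exp_neg]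
        have : ε / r ^ 2 ≤ Real.exp (ε / r ^ 2) := by linarith [Real.add_one_le_exp (ε / r ^ 2)]
        exact mul_inv_le_one_of_le₀ this (Real.exp_nonneg _)
      have h4 : f r / r * (2 * (ε / r ^ 2 * E r)) ≤ derivWithin f (Ici 0) r * 2 :=
        mul_le_mul h2 (by linarith) (mul_nonneg zero_le_two (mul_nonneg
          (div_nonneg hε.le (sq_nonneg r)) (hE0 r))) (hpos r hr0).le
      simp only [hE] at h1 h4
      linarith
  have hGmono : StrictMonoOn G (Icc 0 ρ₁) := by
    intro r hr s hs hrs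
    rw [hGin r hr.1 hr.2, hGin s hs.1 hs.2]
    have h1 : f r < f s := hmono ⟨hr.1, hr.2.trans hsub⟩ ⟨hs.1, hs.2.trans hsub⟩ hrs
    have h2 := hEmono r s hr.1 hrs.le
    have h3 : 0 ≤ f r := by
      have := hfle 0 r le_rfl hr.1 (hr.2.trans hsub)
      rwa [hf.zero] at this
    have h4 := hEpos s (hr.1.trans_lt hrs)
    have h5 := mul_le_mul_of_nonneg_left h2 h3
    have h6 := mul_lt_mul_of_pos_right h1 h4
    linarith
  -- With this, radii below `ρ₁` are ordered by `G` against all radii, so the superlevel sets at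
  -- these radii are exact complements of balls.
  have hGfar : ∀ s, ρ₁ ≤ s → G ρ₁ ≤ G s := by
    intro s hs
    rw [hGin ρ₁ hρ₁0.le le_rfl]
    have hb : f ρ₁ * E ρ₁ ≤ L := by
      have h1 := hL ρ₁ hρ₁0.le
      have h2 := mul_le_of_le_one_right (hf0 ρ₁ ⟨hρ₁0, hsub⟩).le (hE1 ρ₁)
      linarith
    rcases le_total s (2 * ρ₁) with h | h
    · have h1 := hfle ρ₁ s hρ₁0.le hs (by linarith)
      have h2 := hEmono ρ₁ s hρ₁0.le hs
      have h3 : f ρ₁ * E ρ₁ ≤ f s * E s :=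
        mul_le_mul h1 h2 (hE0 _) ((hf0 ρ₁ ⟨hρ₁0, hsub⟩).le.trans h1)
      have h4 := mul_le_mul_of_nonneg_right h3 (hθ1 s)
      have h5 := mul_le_mul_of_nonneg_right hb (hθ0 s)
      simp only [hG]
      linarith
    · simp only [hG, hθ, radialCutoff_of_ge hρ₁0 h]
      linarith
  refine ⟨G, min (f ρ / 2) 1, ?_, ?_, ⟨2 * ρ₁, 2 * L, fun r hr => ?_⟩, ?_, ?_, ?_, hGderiv, ?_⟩
  · have := hf0 ρ ⟨hρ.1, hρ.2.le.trans hsub⟩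
    positivity
  · have h1 := contDiff_radial_mul_expNegInvGlue (V := Space N) hf.smooth hε
    have h2 := contDiff_radialCutoff_norm (V := Space N) ρ₁
    exact ((contDiff_const.mul h1).mul (contDiff_const.sub h2)).add (contDiff_const.mul h2)
  · simp [hG, hθ, radialCutoff_of_ge hρ₁0 hr]
  · rw [hGin 0 le_rfl hρ₁0.le, hf.zero]; simp
  · intro r hr hfr
    have h1 : 0 ≤ f r * E r := mul_nonneg hfr (hE0 r)
    have h2 := mul_nonneg h1 (hθ1 r)
    have h3 := mul_nonneg (zero_le_one.trans hL1) (hθ0 r)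
    have h4 := mul_le_mul_of_nonneg_right (mul_le_of_le_one_right hfr (hE1 r)) (hθ1 r)
    simp only [hG]
    constructor <;> linarith
  · intro r hr hfr
    have hr0 : 0 ≤ r := hρ.1.le.trans hr
    have hE34 : 3 / 4 ≤ E r := hε34.trans (hEmono ρ r hρ.1.le hr)
    have h1 : 3 / 2 * f r ≤ 2 * (f r * E r) := by nlinarith
    have h2 := hL r hr0
    rcases le_total r (2 * ρ₁) with h | h
    · have h3 := hfle ρ r hρ.1.le hr (by linarith)
      have h4 : f r + f ρ / 2 ≤ 2 * (f r * E r) := by linarith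
      have hm1 := min_le_left (f ρ / 2) 1
      have hm2 := min_le_right (f ρ / 2) 1
      have h5 := mul_le_mul_of_nonneg_right
        (show f r + min (f ρ / 2) 1 ≤ 2 * (f r * E r) by linarith) (hθ1 r)
      have h6 := mul_le_mul_of_nonneg_right
        (show f r + min (f ρ / 2) 1 ≤ 2 * L by linarith) (hθ0 r)
      simp only [hG]
      linarith
    · have := min_le_right (f ρ / 2) 1
      simp only [hG, hθ, radialCutoff_of_ge hρ₁0 h]
      linarith
  · intro r hr s hs
    have hr' : r ∈ Icc 0 ρ₁ := ⟨hr.1.le, hr.2.le⟩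
    rcases le_total s ρ₁ with h | h
    · exact hGmono.le_iff_le hr' ⟨hs, h⟩
    · refine ⟨fun _ => hr.2.le.trans h, fun _ => ?_⟩
      exact ((hGmono.monotoneOn hr' (right_mem_Icc.2 hρ₁0.le) hr.2.le)).trans (hGfar s h)

end RadialTests

/-! ### Test functions, penalties and continuity of the operator -/

section TestFunctions

variable {N : ℕ}

theorem HasFDerivAt.spaceGrad_eq {φ : Space N × ℝ → ℝ} {x : Space N} {t : ℝ}
    {L : Space N × ℝ →L[ℝ] ℝ} (h : HasFDerivAt φ L (x, t)) :
    spaceGrad φ x t = (InnerProductSpace.toDual ℝ (Space N)).symm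
      (L.comp (ContinuousLinearMap.inl ℝ (Space N) ℝ)) := by
  have h1 : HasFDerivAt (fun y : Space N => (y, t)) (ContinuousLinearMap.inl ℝ (Space N) ℝ) x :=
    hasFDerivAt_prodMk_left x t
  have h2 := HasFDerivAt.comp (g := φ) (f := fun y : Space N => (y, t)) x h h1
  rw [spaceGrad, gradient]
  congr 1
  exact h2.fderiv

theorem HasFDerivAt.timeDeriv_eq {φ : Space N × ℝ → ℝ} {x : Space N} {t : ℝ}
    {L : Space N × ℝ →L[ℝ] ℝ} (h : HasFDerivAt φ L (x, t)) : timeDeriv φ x t = L (0, 1) :=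
  (HasFDerivAt.comp_hasDerivAt (l := φ) (f := fun s : ℝ => (x, s)) t h
    ((hasDerivAt_const t x).prodMk (hasDerivAt_id t))).deriv

theorem DifferentiableAt.hasFDerivAt_jetMap {φ : Space N × ℝ → ℝ} {x : Space N} {t : ℝ}
    (h : DifferentiableAt ℝ φ (x, t)) :
    HasFDerivAt φ (jetMap (spaceGrad φ x t) (timeDeriv φ x t)) (x, t) := by
  refine h.hasFDerivAt.congr_fderiv ?_
  rw [h.hasFDerivAt.spaceGrad_eq, h.hasFDerivAt.timeDeriv_eq]
  refine ContinuousLinearMap.ext fun v => ?_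
  rw [jetMap_apply, InnerProductSpace.toDual_symm_apply]
  have e : v = (v.1, (0 : ℝ)) + v.2 • ((0 : Space N), (1 : ℝ)) := by ext <;> simp
  conv_lhs => rw [e, map_add, map_smul]
  simp [mul_comm]

theorem spaceGrad_ne_zero_iff {φ : Space N × ℝ → ℝ} {x : Space N} {t : ℝ} :
    spaceGrad φ x t ≠ 0 ↔ fderiv ℝ (fun y => φ (y, t)) x ≠ 0 := by
  rw [spaceGrad, gradient, ne_eq, LinearIsometryEquiv.map_eq_zero_iff]

/-- A smooth nonnegative function which vanishes only at `(x,t)` and which, for each time, is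
constant outside a ball. -/
noncomputable def penalty (x : Space N) (t : ℝ) (z : Space N × ℝ) : ℝ :=
  Real.smoothTransition (‖z.1 - x‖ ^ 2) + (z.2 - t) ^ 2

theorem contDiff_penalty (x : Space N) (t : ℝ) : ContDiff ℝ ∞ (penalty x t) :=
  (Real.smoothTransition.contDiff.comp
    ((contDiff_fst.sub contDiff_const).norm_sq ℝ)).add ((contDiff_snd.sub contDiff_const).pow 2)

@[simp] theorem penalty_self (x : Space N) (t : ℝ) : penalty x t (x, t) = 0 := by
  simp [penalty]

theorem exists_le_penalty (x : Space N) (t : ℝ) {δ : ℝ} (hδ : 0 < δ) :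
    ∃ γ > 0, ∀ z : Space N × ℝ, (δ ≤ ‖z.1 - x‖ ∨ δ ≤ |z.2 - t|) → γ ≤ penalty x t z := by
  refine ⟨min (Real.smoothTransition (δ ^ 2)) (δ ^ 2), lt_min
    (Real.smoothTransition.pos_of_pos (by positivity)) (by positivity), fun z hz => ?_⟩
  rcases hz with h | h
  · refine (min_le_left _ _).trans ?_
    have := Real.smoothTransition.monotone (pow_le_pow_left₀ hδ.le h 2)
    rw [penalty]
    linarith [sq_nonneg (z.2 - t)]
  · refine (min_le_right _ _).trans ?_
    have := pow_le_pow_left₀ hδ.le h 2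
    rw [sq_abs] at this
    rw [penalty]
    linarith [Real.smoothTransition.nonneg (‖z.1 - x‖ ^ 2)]

/-- A test function with a multiple of the penalty added. -/
noncomputable def penalized (φ : Space N × ℝ → ℝ) (x : Space N) (t η : ℝ) (z : Space N × ℝ) : ℝ :=
  φ z + η * penalty x t z

variable {κ : Space N → Set (Space N) → ℝ} {T a b : ℝ} {φ : Space N × ℝ → ℝ} {x : Space N} {t : ℝ}

theorem IsSmoothTest.mem_Ioo (h : IsSmoothTest κ T a b φ x t) : t ∈ Ioo a b := h.2.2.1

theorem IsSmoothTest.contDiffAt (h : IsSmoothTest κ T a b φ x t) {s : ℝ} (hs : s ∈ Ioo a b)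
    (y : Space N) : ContDiffAt ℝ ∞ φ (y, s) :=
  h.2.2.2.1.contDiffAt (prod_mem_nhds univ_mem (Ioo_mem_nhds hs.1 hs.2))

theorem IsSmoothTest.hasFDerivAt (h : IsSmoothTest κ T a b φ x t) :
    HasFDerivAt φ (jetMap (spaceGrad φ x t) (timeDeriv φ x t)) (x, t) :=
  ((h.contDiffAt h.mem_Ioo x).differentiableAt (by simp)).hasFDerivAt_jetMap

theorem contDiffAt_penalized {z : Space N × ℝ} (hz : ContDiffAt ℝ ∞ φ z) (η : ℝ) :
    ContDiffAt ℝ ∞ (penalized φ x t η) z :=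
  hz.add (contDiffAt_const.mul (contDiff_penalty x t).contDiffAt)

theorem exists_const_penalized (hK : ∃ K : Set (Space N), IsCompact K ∧ ∃ c : ℝ → ℝ,
    ∀ s ∈ Icc a b, ∀ y ∉ K, φ (y, s) = c s) (x : Space N) (t : ℝ) :
    ∃ K : Set (Space N), IsCompact K ∧ ∃ c : ℝ → ℝ, ∀ s ∈ Icc a b, ∀ y ∉ K, ∀ η,
      penalized φ x t η (y, s) = c s + η * (1 + (s - t) ^ 2) := by
  obtain ⟨K, hK, c, hc⟩ := hK
  refine ⟨K ∪ closedBall x 1, hK.union (isCompact_closedBall _ _), c, fun s hs y hy η => ?_⟩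
  rw [mem_union, not_or] at hy
  have h1 : 1 ≤ ‖y - x‖ ^ 2 := by
    have := hy.2
    rw [mem_closedBall, not_le, dist_eq_norm] at this
    exact one_le_pow₀ this.le
  rw [penalized, hc s hs y hy.1, penalty, Real.smoothTransition.one_of_one_le h1]

theorem exists_notMem_of_isCompact (hN : 1 ≤ N) {K : Set (Space N)} (hK : IsCompact K) :
    ∃ y, y ∉ K := by
  have : Nonempty (Fin N) := ⟨⟨0, hN⟩⟩
  have : Nontrivial (Space N) := inferInstance
  have : NoncompactSpace (Space N) := NormedSpace.noncompactSpace ℝ (Space N)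
  by_contra! h
  exact noncompact_univ (Space N) ((eq_univ_of_forall h) ▸ hK)

/-- The three parameters are the time, the weight of the penalty and the level; these are the
parameters for which `IsSmoothCurvature.cont` is stated. -/
theorem IsSmoothTest.isDefiningFamily (hN : 1 ≤ N) (h : IsSmoothTest κ T a b φ x t)
    (hnc : NoncriticalLevel φ x t) :
    IsDefiningFamily (fun q : Space N × (ℝ × ℝ × ℝ) =>
      penalized φ x t q.2.2.1 (q.1, q.2.1) - q.2.2.2) (t, 0, φ (x, t)) where
  smooth := by
    refine ⟨Ioo a b ×ˢ univ, prod_mem_nhds (Ioo_mem_nhds h.mem_Ioo.1 h.mem_Ioo.2) univ_mem, ?_⟩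
    intro q hq
    refine ContDiffAt.contDiffWithinAt ?_
    have h1 : ContDiffAt ℝ ∞ (fun q : Space N × (ℝ × ℝ × ℝ) => (q.1, q.2.1)) q := by fun_prop
    have h2 : ContDiffAt ℝ ∞ (fun q : Space N × (ℝ × ℝ × ℝ) => φ (q.1, q.2.1)) q :=
      ContDiffAt.comp (g := φ) q (h.contDiffAt hq.2.1 q.1) h1
    have h3 : ContDiffAt ℝ ∞ (fun q : Space N × (ℝ × ℝ × ℝ) => penalty x t (q.1, q.2.1)) q :=
      ContDiffAt.comp (g := penalty x t) q (contDiff_penalty x t).contDiffAt h1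
    have h4 : ContDiffAt ℝ ∞ (fun q : Space N × (ℝ × ℝ × ℝ) => q.2.2.1) q := by fun_prop
    have h5 : ContDiffAt ℝ ∞ (fun q : Space N × (ℝ × ℝ × ℝ) => q.2.2.2) q := by fun_prop
    exact (h2.add (h4.mul h3)).sub h5
  compact := by
    obtain ⟨K, hK, c, hc⟩ := exists_const_penalized h.2.2.2.2.const_outside x t
    obtain ⟨y₀, hy₀⟩ := exists_notMem_of_isCompact hN hK
    refine ⟨K, hK, ?_⟩
    -- Outside `K` the function is locally constant in space, so its value there is critical and
    -- differs from the noncritical level. This keeps nearby level sets inside `K`.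
    have hne : φ (y₀, t) ≠ φ (x, t) := by
      intro he
      refine spaceGrad_ne_zero_iff.1 (hnc y₀ he) ?_
      have hev : (fun y => φ (y, t)) =ᶠ[𝓝 y₀] fun _ => φ (y₀, t) := by
        filter_upwards [hK.isClosed.isOpen_compl.mem_nhds hy₀] with y hy
        have e1 := hc t (Ioo_subset_Icc_self h.mem_Ioo) y hy 0
        have e2 := hc t (Ioo_subset_Icc_self h.mem_Ioo) y₀ hy₀ 0
        simp only [penalized, zero_mul, add_zero] at e1 e2
        rw [e1, e2]
      rw [hev.fderiv_eq]
      exact fderiv_const_apply _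
    have hcont : ContinuousAt (fun s : ℝ × ℝ × ℝ =>
        φ (y₀, s.1) + s.2.1 * penalty x t (y₀, s.1) - s.2.2) (t, 0, φ (x, t)) := by
      have h1 : ContinuousAt (fun s : ℝ × ℝ × ℝ => (y₀, s.1)) (t, 0, φ (x, t)) := by fun_prop
      have h2 : ContinuousAt (fun s : ℝ × ℝ × ℝ => φ (y₀, s.1)) (t, 0, φ (x, t)) :=
        ContinuousAt.comp (g := φ) (h.contDiffAt h.mem_Ioo y₀).continuousAt h1
      have h3 : ContinuousAt (fun s : ℝ × ℝ × ℝ => penalty x t (y₀, s.1)) (t, 0, φ (x, t)) :=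
        ContinuousAt.comp (g := penalty x t) (contDiff_penalty x t).continuous.continuousAt h1
      have h4 : ContinuousAt (fun s : ℝ × ℝ × ℝ => s.2.1) (t, 0, φ (x, t)) := by fun_prop
      have h5 : ContinuousAt (fun s : ℝ × ℝ × ℝ => s.2.2) (t, 0, φ (x, t)) := by fun_prop
      exact (h2.add (h4.mul h3)).sub h5
    have hev := hcont.eventually_ne (y := 0) (by simpa [sub_eq_zero] using hne)
    have hs : ∀ᶠ s : ℝ × ℝ × ℝ in 𝓝 (t, 0, φ (x, t)), s.1 ∈ Ioo a b :=
      continuousAt_fst.eventually (Ioo_mem_nhds h.mem_Ioo.1 h.mem_Ioo.2)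
    filter_upwards [hev, hs] with s h1 h2 y hy
    have e1 := hc s.1 (Ioo_subset_Icc_self h2) y hy s.2.1
    have e2 := hc s.1 (Ioo_subset_Icc_self h2) y₀ hy₀ s.2.1
    simp only [e1]
    rw [← e2]
    exact h1
  regular y hy := by
    simp only [penalized, zero_mul, add_zero, sub_eq_zero] at hy ⊢
    rw [fderiv_sub_const]
    exact spaceGrad_ne_zero_iff.1 (hnc y hy)

theorem IsSmoothTest.tendsto_penalized_param (h : IsSmoothTest κ T a b φ x t) :
    Tendsto (fun w : (Space N × ℝ) × ℝ => (w.1.1, (w.1.2, w.2, penalized φ x t w.2 w.1)))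
      (𝓝 ((x, t), 0)) (𝓝 (x, (t, 0, φ (x, t)))) := by
  have h2 : ContinuousAt (fun w : (Space N × ℝ) × ℝ => φ w.1) ((x, t), 0) :=
    ContinuousAt.comp (g := φ) (f := Prod.fst) (h.contDiffAt h.mem_Ioo x).continuousAt
      continuousAt_fst
  have h3 : ContinuousAt (fun w : (Space N × ℝ) × ℝ => penalty x t w.1) ((x, t), 0) :=
    ContinuousAt.comp (g := penalty x t) (f := Prod.fst)
      (contDiff_penalty x t).continuous.continuousAt continuousAt_fst
  have : ContinuousAt (fun w : (Space N × ℝ) × ℝ =>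
      (w.1.1, (w.1.2, w.2, φ w.1 + w.2 * penalty x t w.1))) ((x, t), 0) := by
    have h4 : ContinuousAt (fun w : (Space N × ℝ) × ℝ => w.2) ((x, t), 0) := by fun_prop
    have h5 : ContinuousAt (fun w : (Space N × ℝ) × ℝ => w.1.1) ((x, t), 0) := by fun_prop
    have h6 : ContinuousAt (fun w : (Space N × ℝ) × ℝ => w.1.2) ((x, t), 0) := by fun_prop
    exact h5.prodMk (h6.prodMk (h4.prodMk (h2.add (h4.mul h3))))
  have h4 := this.tendsto
  simp only [zero_mul, add_zero] at h4
  exact h4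

theorem IsSmoothTest.eventually_isDefining (hN : 1 ≤ N) (h : IsSmoothTest κ T a b φ x t)
    (hnc : NoncriticalLevel φ x t) :
    ∀ᶠ w : (Space N × ℝ) × ℝ in 𝓝 ((x, t), 0),
      IsDefining (fun y => penalized φ x t w.2 (y, w.1.2) - penalized φ x t w.2 w.1) := by
  have h1 := (h.isDefiningFamily hN hnc).eventually_isDefining
  exact ((continuous_snd.tendsto _).comp h.tendsto_penalized_param).eventually h1

theorem IsSmoothTest.isDefining (hN : 1 ≤ N) (h : IsSmoothTest κ T a b φ x t)
    (hnc : NoncriticalLevel φ x t) : IsDefining (fun y => φ (y, t) - φ (x, t)) := by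
  have := (h.eventually_isDefining hN hnc).self_of_nhds
  simpa [penalized] using this

/-- A strict inequality for `φ` at `(x, t)` persists for nearby points and small penalties, which
serves both the stability of subsolutions and the construction of bumps. -/
theorem IsSmoothTest.tendsto_penalized {c : ℝ → ℝ} {K : ℝ} (hN : 1 ≤ N)
    (hκ : IsSmoothCurvature κ c K) (h : IsSmoothTest κ T a b φ x t)
    (hnc : NoncriticalLevel φ x t) :
    Tendsto (fun w : (Space N × ℝ) × ℝ => timeDeriv (penalized φ x t w.2) w.1.1 w.1.2 +
        ‖spaceGrad (penalized φ x t w.2) w.1.1 w.1.2‖ *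
          κ w.1.1 {y | 0 ≤ penalized φ x t w.2 (y, w.1.2) - penalized φ x t w.2 w.1})
      (𝓝 ((x, t), 0))
      (𝓝 (timeDeriv φ x t + ‖spaceGrad φ x t‖ * κ x {y | 0 ≤ φ (y, t) - φ (x, t)})) := by
  have hfd : ContinuousAt (fun w : (Space N × ℝ) × ℝ => fderiv ℝ (penalized φ x t w.2) w.1)
      ((x, t), 0) := by
    refine ContDiffAt.continuousAt (𝕜 := ℝ) (n := 0) ?_
    refine ContDiffAt.fderiv (n := 1)
      (f := fun (w : (Space N × ℝ) × ℝ) (z : Space N × ℝ) => penalized φ x t w.2 z)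
      (g := Prod.fst) ?_ contDiffAt_fst (by norm_num)
    have h1 : ContDiffAt ℝ 1 φ (x, t) := (h.contDiffAt h.mem_Ioo x).of_le (by exact_mod_cast le_top)
    have h2 : ContDiffAt ℝ 1 (fun w : ((Space N × ℝ) × ℝ) × (Space N × ℝ) => φ w.2)
        (((x, t), 0), (x, t)) := ContDiffAt.comp (g := φ) (f := Prod.snd) _ h1 contDiffAt_snd
    have h3 : ContDiffAt ℝ 1 (fun w : ((Space N × ℝ) × ℝ) × (Space N × ℝ) => penalty x t w.2)
        (((x, t), 0), (x, t)) := ContDiffAt.comp (g := penalty x t) (f := Prod.snd) _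
          ((contDiff_penalty x t).contDiffAt.of_le (by exact_mod_cast le_top)) contDiffAt_snd
    change ContDiffAt ℝ 1 (fun w : ((Space N × ℝ) × ℝ) × (Space N × ℝ) =>
      φ w.2 + w.1.2 * penalty x t w.2) (((x, t), 0), (x, t))
    fun_prop
  have hdiff : ∀ᶠ w : (Space N × ℝ) × ℝ in 𝓝 ((x, t), 0),
      DifferentiableAt ℝ (penalized φ x t w.2) (w.1.1, w.1.2) := by
    have h1 : ∀ᶠ w : (Space N × ℝ) × ℝ in 𝓝 ((x, t), 0), w.1.2 ∈ Ioo a b :=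
      (Continuous.tendsto (f := fun w : (Space N × ℝ) × ℝ => w.1.2) (by fun_prop) _).eventually
        (Ioo_mem_nhds h.mem_Ioo.1 h.mem_Ioo.2)
    filter_upwards [h1] with w hw
    exact (contDiffAt_penalized (h.contDiffAt hw w.1.1) w.2).differentiableAt (by simp)
  have e0 : penalized φ x t 0 = φ := by funext z; simp [penalized]
  have hcurv : Tendsto (fun w : (Space N × ℝ) × ℝ =>
      κ w.1.1 {y | 0 ≤ penalized φ x t w.2 (y, w.1.2) - penalized φ x t w.2 w.1})
      (𝓝 ((x, t), 0)) (𝓝 (κ x {y | 0 ≤ φ (y, t) - φ (x, t)})) := by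
    have h1 := hκ.cont _ _ x (h.isDefiningFamily hN hnc) (by simp [penalized])
    have h2 := h1.comp (tendsto_nhdsWithin_of_tendsto_nhds_of_eventually_within _
      h.tendsto_penalized_param (Eventually.of_forall fun w => by simp))
    simp only [e0] at h2
    exact h2
  have htime : Tendsto (fun w : (Space N × ℝ) × ℝ =>
      timeDeriv (penalized φ x t w.2) w.1.1 w.1.2) (𝓝 ((x, t), 0)) (𝓝 (timeDeriv φ x t)) := by
    have h1 := (hfd.clm_apply (continuousAt_const (y := ((0 : Space N), (1 : ℝ))))).tendsto
    have e := hdiff.self_of_nhds.hasFDerivAt.timeDeriv_eq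
    simp only [e0] at e h1
    rw [← e] at h1
    refine h1.congr' ?_
    filter_upwards [hdiff] with w hw
    exact hw.hasFDerivAt.timeDeriv_eq.symm
  have hgrad : Tendsto (fun w : (Space N × ℝ) × ℝ =>
      ‖spaceGrad (penalized φ x t w.2) w.1.1 w.1.2‖) (𝓝 ((x, t), 0))
      (𝓝 ‖spaceGrad φ x t‖) := by
    have h1 := (hfd.clm_comp (continuousAt_const
      (y := ContinuousLinearMap.inl ℝ (Space N) ℝ))).norm.tendsto
    have e := congrArg norm hdiff.self_of_nhds.hasFDerivAt.spaceGrad_eq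
    simp only [e0, LinearIsometryEquiv.norm_map] at e h1
    rw [← e] at h1
    refine h1.congr' ?_
    filter_upwards [hdiff] with w hw
    rw [hw.hasFDerivAt.spaceGrad_eq, LinearIsometryEquiv.norm_map]
  exact htime.add (hgrad.mul hcurv)

end TestFunctions

/-! ### Semicontinuous envelopes -/

section Envelopes

variable {X : Type*} [TopologicalSpace X]

/-- The value at `x` is the infimum of the constants that bound `u` near `x`. The last clause
replaces recovery sequences. -/
theorem exists_isUSCEnvelope {u : X → ℝ} {M : ℝ} (hM : ∀ x, u x ≤ M) :
    ∃ v, IsUSCEnvelope u v ∧ ∀ x c, c < v x → ∃ᶠ y in 𝓝 x, c < u y := by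
  set S : X → Set ℝ := fun x => {c | ∀ᶠ y in 𝓝 x, u y ≤ c} with hS
  have hne : ∀ x, (S x).Nonempty := fun x => ⟨M, Eventually.of_forall hM⟩
  have hbd : ∀ x, ∀ c ∈ S x, u x ≤ c := fun x c hc => hc.self_of_nhds
  have hbb : ∀ x, BddBelow (S x) := fun x => ⟨u x, fun c hc => hbd x c hc⟩
  refine ⟨fun x => sInf (S x), ⟨⟨?_, fun x => le_csInf (hne x) (hbd x)⟩, ?_⟩, ?_⟩
  · rw [upperSemicontinuous_iff]
    intro x
    rw [upperSemicontinuousAt_iff]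
    intro c hc
    obtain ⟨d, hd, hdc⟩ := exists_lt_of_csInf_lt (hne x) hc
    have hd' : ∀ᶠ y in 𝓝 x, u y ≤ d := hd
    filter_upwards [hd'.eventually_nhds] with y hy
    exact (csInf_le (hbb y) hy).trans_lt hdc
  · rintro g ⟨hg, hug⟩ x
    refine le_of_forall_pos_le_add fun ε hε => csInf_le (hbb x) ?_
    have h1 := (upperSemicontinuousAt_iff.1 (hg.upperSemicontinuousAt x)) (g x + ε) (by linarith)
    have h2 : ∀ᶠ y in 𝓝 x, u y ≤ g x + ε := by
      filter_upwards [h1] with y hy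
      exact (hug y).trans hy.le
    exact h2
  · intro x c hc hn
    refine absurd hc (not_lt.2 (csInf_le (hbb x) ?_))
    have h2 : ∀ᶠ y in 𝓝 x, u y ≤ c := hn.mono fun y hy => not_lt.1 hy
    exact h2

theorem UpperSemicontinuous.neg_real {u : X → ℝ} (h : UpperSemicontinuous u) :
    LowerSemicontinuous fun x => -u x := by
  rw [lowerSemicontinuous_iff]
  intro x
  rw [lowerSemicontinuousAt_iff]
  intro c hc
  filter_upwards [upperSemicontinuousAt_iff.1 (h.upperSemicontinuousAt x) (-c) (by linarith)]
    with y hy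
  linarith

theorem LowerSemicontinuous.neg_real {u : X → ℝ} (h : LowerSemicontinuous u) :
    UpperSemicontinuous fun x => -u x := by
  rw [upperSemicontinuous_iff]
  intro x
  rw [upperSemicontinuousAt_iff]
  intro c hc
  filter_upwards [lowerSemicontinuousAt_iff.1 (h.lowerSemicontinuousAt x) (-c) (by linarith)]
    with y hy
  linarith

theorem exists_isLSCEnvelope {u : X → ℝ} {m : ℝ} (hm : ∀ x, m ≤ u x) :
    ∃ v, IsLSCEnvelope u v ∧ ∀ x c, v x < c → ∃ᶠ y in 𝓝 x, u y < c := by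
  obtain ⟨v, ⟨⟨h1, h2⟩, h3⟩, h4⟩ := exists_isUSCEnvelope (u := fun x => -u x) (M := -m)
    (fun x => neg_le_neg (hm x))
  refine ⟨fun x => -v x, ⟨⟨h1.neg_real, fun x => ?_⟩, ?_⟩, fun x c hc => ?_⟩
  · have := h2 x
    simp only at this ⊢
    linarith
  · rintro g ⟨hg, hgu⟩ x
    have := h3 ⟨hg.neg_real, fun y => neg_le_neg (hgu y)⟩ x
    simp only at this ⊢
    linarith
  · exact (h4 x (-c) (by linarith)).mono fun y hy => by linarith

end Envelopes

/-! ### Stability of subsolutions at noncritical levels -/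

section Stability

variable {N : ℕ} {T : ℝ}

/-- The test conditions in the definition of viscosity subsolutions. -/
def IsSubTested (κ : Space N → Set (Space N) → ℝ) (u : SpaceTime N T → ℝ) : Prop :=
  ∀ (x : Space N) (t : ↥(Icc (0 : ℝ) T)) (a b : ℝ) (φ : Space N × ℝ → ℝ),
    IsSmoothTest κ T a b φ x t →
    IsMaxOn (fun w : SpaceTime N T => u w - φ (w.1, (w.2 : ℝ))) {w | (w.2 : ℝ) ∈ Icc a b} (x, t) →
    (spaceGrad φ x t = 0 → timeDeriv φ x t ≤ 0) ∧
    (NoncriticalLevel φ x t →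
      timeDeriv φ x t + ‖spaceGrad φ x t‖ * κ x {y | φ (y, (t : ℝ)) ≥ φ (x, (t : ℝ))} ≤ 0)

theorem setOf_ge_eq_setOf_sub_nonneg (g : Space N → ℝ) (c : ℝ) :
    {y | g y ≥ c} = {y | 0 ≤ g y - c} := by
  ext y; simp [sub_nonneg]

/-- Both functions are constant in space outside a compact set, so one point `y₀` represents the
whole exterior and a compact set suffices. -/
theorem exists_isMaxOn_spaceTime (hN : 1 ≤ N) {v : SpaceTime N T → ℝ} (hv : UpperSemicontinuous v)
    (hvc : ConstOutsideCompact v) {Θ : Space N × ℝ → ℝ} {a b : ℝ}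
    (hΘ : ContinuousOn Θ (univ ×ˢ Icc a b))
    (hΘc : ∃ K : Set (Space N), IsCompact K ∧ ∃ c : ℝ → ℝ, ∀ s ∈ Icc a b, ∀ y ∉ K, Θ (y, s) = c s)
    (hne : ∃ t : ↥(Icc (0 : ℝ) T), (t : ℝ) ∈ Icc a b) :
    ∃ z : SpaceTime N T, (z.2 : ℝ) ∈ Icc a b ∧
      IsMaxOn (fun w : SpaceTime N T => v w - Θ (w.1, (w.2 : ℝ))) {w | (w.2 : ℝ) ∈ Icc a b} z := by
  obtain ⟨K, hK, c, hc⟩ := hvc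
  obtain ⟨K', hK', c', hc'⟩ := hΘc
  obtain ⟨y₀, hy₀⟩ := exists_notMem_of_isCompact hN (hK.union hK')
  rw [mem_union, not_or] at hy₀
  obtain ⟨t₀, ht₀⟩ := hne
  have htc : IsCompact {t : ↥(Icc (0 : ℝ) T) | (t : ℝ) ∈ Icc a b} :=
    (isClosed_Icc.preimage continuous_subtype_val).isCompact
  set D : Set (SpaceTime N T) := (K ∪ K' ∪ {y₀}) ×ˢ {t : ↥(Icc (0 : ℝ) T) | (t : ℝ) ∈ Icc a b}
  have hD : IsCompact D := ((hK.union hK').union isCompact_singleton).prod htc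
  have hcont : ContinuousOn (fun w : SpaceTime N T => -Θ (w.1, (w.2 : ℝ))) D := by
    refine ContinuousOn.neg (hΘ.comp (f := fun w : SpaceTime N T => (w.1, (w.2 : ℝ)))
      (by fun_prop) ?_)
    exact fun w hw => ⟨mem_univ _, hw.2⟩
  have husc : UpperSemicontinuousOn (fun w : SpaceTime N T => v w - Θ (w.1, (w.2 : ℝ))) D := by
    simp only [sub_eq_add_neg]
    exact (hv.upperSemicontinuousOn D).add hcont.upperSemicontinuousOn
  obtain ⟨z, hzD, hz⟩ := husc.exists_isMaxOn
    ⟨(y₀, t₀), (⟨Or.inr rfl, ht₀⟩ : (y₀, t₀) ∈ D)⟩ hD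
  refine ⟨z, hzD.2, fun w hw => ?_⟩
  by_cases hwK : w.1 ∈ K ∪ K'
  · exact hz (show w ∈ D from ⟨Or.inl hwK, hw⟩)
  · have h1 := hz (show (y₀, w.2) ∈ D from ⟨Or.inr rfl, hw⟩)
    rw [mem_union, not_or] at hwK
    have e1 : v w = v (y₀, w.2) := by
      rw [hc w.2 y₀ hy₀.1]; exact hc w.2 w.1 hwK.1
    have e2 : Θ (w.1, w.2) = Θ (y₀, w.2) := by
      rw [hc' w.2 hw w.1 hwK.2, hc' w.2 hw y₀ hy₀.2]
    simp only [mem_ofPred_eq, e1, e2] at h1 ⊢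
    exact h1

/-- `u` is the upper semicontinuous envelope of the supremum of `𝒱`, in a form convenient for
passing to the limit in maximum points. -/
structure IsRelaxedSup (𝒱 : Set (SpaceTime N T → ℝ)) (u : SpaceTime N T → ℝ) : Prop where
  usc : ∀ v ∈ 𝒱, UpperSemicontinuous v
  const : ∀ v ∈ 𝒱, ConstOutsideCompact v
  le : ∀ v ∈ 𝒱, ∀ z, v z ≤ u z
  approx : ∀ z c, c < u z → ∃ᶠ y in 𝓝 z, ∃ v ∈ 𝒱, c < v y

/-- A member `v` that nearly attains `u z` loses at most `γ / 3` there, and `Θ` varies by at most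
another `γ / 3`. Outside `O` the loss is at least `γ`, so the maximum of `v - Θ` lies in `O`. -/
theorem IsRelaxedSup.exists_isMaxOn (hN : 1 ≤ N) {𝒱 : Set (SpaceTime N T → ℝ)}
    {u : SpaceTime N T → ℝ} (h : IsRelaxedSup 𝒱 u) {Θ : Space N × ℝ → ℝ} {a b : ℝ}
    (hΘ : ContinuousOn Θ (univ ×ˢ Icc a b))
    (hΘc : ∃ K : Set (Space N), IsCompact K ∧ ∃ c : ℝ → ℝ, ∀ s ∈ Icc a b, ∀ y ∉ K, Θ (y, s) = c s)
    {z : SpaceTime N T} (hz : (z.2 : ℝ) ∈ Ioo a b) {O : Set (SpaceTime N T)} {γ : ℝ} (hγ : 0 < γ)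
    (hO : ∀ w ∉ O, (w.2 : ℝ) ∈ Icc a b → u w - Θ (w.1, (w.2 : ℝ)) ≤ u z - Θ (z.1, (z.2 : ℝ)) - γ) :
    ∃ v ∈ 𝒱, ∃ y ∈ O, (y.2 : ℝ) ∈ Icc a b ∧
      IsMaxOn (fun w : SpaceTime N T => v w - Θ (w.1, (w.2 : ℝ))) {w | (w.2 : ℝ) ∈ Icc a b} y := by
  have hct : Tendsto (fun w : SpaceTime N T => (w.1, (w.2 : ℝ))) (𝓝 z) (𝓝 (z.1, (z.2 : ℝ))) :=
    Continuous.tendsto (by fun_prop) z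
  have hΘz : ContinuousAt Θ (z.1, (z.2 : ℝ)) :=
    hΘ.continuousAt (prod_mem_nhds univ_mem (Icc_mem_nhds hz.1 hz.2))
  have h1 : ∀ᶠ w : SpaceTime N T in 𝓝 z, Θ (w.1, (w.2 : ℝ)) < Θ (z.1, (z.2 : ℝ)) + γ / 3 :=
    hct.eventually (hΘz.eventually_lt continuousAt_const (by linarith))
  have h2 : ∀ᶠ w : SpaceTime N T in 𝓝 z, (w.2 : ℝ) ∈ Icc a b :=
    ((continuous_snd.tendsto _).comp hct).eventually (Icc_mem_nhds hz.1 hz.2)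
  obtain ⟨w, ⟨v, hv, hvw⟩, hw1, hw2⟩ :=
    ((h.approx z (u z - γ / 3) (by linarith)).and_eventually (h1.and h2)).exists
  obtain ⟨y, hy, hmax⟩ := exists_isMaxOn_spaceTime hN (h.usc v hv) (h.const v hv) hΘ hΘc ⟨w.2, hw2⟩
  refine ⟨v, hv, y, ?_, hy, hmax⟩
  by_contra hyO
  have h3 := hO y hyO hy
  have h4 := hmax hw2
  simp only [mem_ofPred_eq] at h4
  linarith [h.le v hv y]

/-- The penalty makes the maximum strict, so the maximum of some member against the penalised
function is close to `(x, t)`; there the strict violation still holds by continuity of the operator.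
-/
theorem IsRelaxedSup.noncritical (hN : 1 ≤ N) {κ : Space N → Set (Space N) → ℝ} {c : ℝ → ℝ} {K : ℝ}
    (hκ : IsSmoothCurvature κ c K) {𝒱 : Set (SpaceTime N T → ℝ)} {u : SpaceTime N T → ℝ}
    (h : IsRelaxedSup 𝒱 u) (ht : ∀ v ∈ 𝒱, IsSubTested κ v)
    {x : Space N} {t : ↥(Icc (0 : ℝ) T)} {a b : ℝ} {φ : Space N × ℝ → ℝ}
    (hφ : IsSmoothTest κ T a b φ x t)
    (hmax : IsMaxOn (fun w : SpaceTime N T => u w - φ (w.1, (w.2 : ℝ)))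
      {w | (w.2 : ℝ) ∈ Icc a b} (x, t)) (hnc : NoncriticalLevel φ x t) :
    timeDeriv φ x t + ‖spaceGrad φ x t‖ * κ x {y | φ (y, (t : ℝ)) ≥ φ (x, (t : ℝ))} ≤ 0 := by
  by_contra! hpos
  rw [setOf_ge_eq_setOf_sub_nonneg] at hpos
  have hev := ((hφ.tendsto_penalized hN hκ hnc).eventually (lt_mem_nhds hpos)).and
    ((hφ.eventually_isDefining hN hnc).and
      ((Continuous.tendsto (f := fun w : (Space N × ℝ) × ℝ => w.1.2) (by fun_prop) _).eventually
        (Ioo_mem_nhds hφ.mem_Ioo.1 hφ.mem_Ioo.2)))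
  obtain ⟨δ, hδ, hball⟩ := Metric.eventually_nhds_iff.1 hev
  obtain ⟨γ, hγ, hpen⟩ := exists_le_penalty x t hδ
  set η := δ / 2 with hη
  have hη0 : 0 < η := by positivity
  obtain ⟨K, hK, cc, hcc⟩ := exists_const_penalized hφ.2.2.2.2.const_outside x t
  have hcts : ContinuousOn (penalized φ x t η) (univ ×ˢ Icc a b) :=
    hφ.2.2.2.2.continuousOn.add
      (continuousOn_const.mul (contDiff_penalty x t).continuous.continuousOn)
  have hconst : ∃ K : Set (Space N), IsCompact K ∧ ∃ c : ℝ → ℝ, ∀ s ∈ Icc a b, ∀ y ∉ K,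
      penalized φ x t η (y, s) = c s :=
    ⟨K, hK, fun s => cc s + η * (1 + (s - t) ^ 2), fun s hs y hy => hcc s hs y hy η⟩
  obtain ⟨v, hv, y, hyO, hy, hvmax⟩ := h.exists_isMaxOn hN hcts hconst (z := (x, t)) hφ.mem_Ioo
    (O := {w | ‖w.1 - x‖ < δ ∧ |(w.2 : ℝ) - t| < δ}) (mul_pos hη0 hγ) (fun w hwO hw => by
      have h1 := hmax hw
      have h2 : δ ≤ ‖w.1 - x‖ ∨ δ ≤ |(w.2 : ℝ) - t| := by
        by_contra! hn
        exact hwO hn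
      have h3 := mul_le_mul_of_nonneg_left (hpen (w.1, (w.2 : ℝ)) h2) hη0.le
      simp only [mem_ofPred_eq] at h1
      simp only [penalized, penalty_self, mul_zero, add_zero]
      linarith)
  have hd : dist (((y.1, (y.2 : ℝ)), η) : (Space N × ℝ) × ℝ) ((x, (t : ℝ)), 0) < δ := by
    rw [Prod.dist_eq, Prod.dist_eq, dist_eq_norm, Real.dist_eq, Real.dist_eq, sub_zero]
    refine max_lt (max_lt hyO.1 hyO.2) ?_
    rw [abs_of_pos hη0]; exact half_lt_self hδ
  obtain ⟨g1, g2, g3⟩ := hball hd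
  simp only at g1 g2 g3
  have hgne : ∀ y', penalized φ x t η (y', (y.2 : ℝ)) = penalized φ x t η (y.1, (y.2 : ℝ)) →
      spaceGrad (penalized φ x t η) y' y.2 ≠ 0 := fun y' hy' => by
    have := g2.regular y' (sub_eq_zero.2 hy')
    rw [fderiv_sub_const] at this
    exact spaceGrad_ne_zero_iff.2 this
  have htest : IsSmoothTest κ T a b (penalized φ x t η) y.1 y.2 :=
    ⟨hφ.1, hφ.2.1, g3, fun z hz =>
      (contDiffAt_penalized (hφ.contDiffAt hz.2 z.1) η).contDiffWithinAt,
      hcts, (contDiffAt_penalized (hφ.contDiffAt g3 y.1) η).of_le ENat.LEInfty.out, hconst,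
      fun h0 => absurd h0 (hgne y.1 rfl)⟩
  have := (ht v hv y.1 y.2 a b _ htest hvmax).2 hgne
  rw [setOf_ge_eq_setOf_sub_nonneg] at this
  exact absurd g1 (not_lt.2 this)

end Stability

/-! ### Stability of subsolutions at critical points -/

section FlatStability

variable {N : ℕ} {T : ℝ}

/-- Taylor's formula at `0`. The modulus can then be replaced by a multiple of `(s - t)²`, smooth on
both sides of `t`. -/
theorem IsTimeModulus.exists_le_sq {σ : ℝ → ℝ} (hσ : IsTimeModulus σ) {T : ℝ} (hT : 0 < T) :
    ∃ C, 0 ≤ C ∧ ∀ r ∈ Icc 0 T, σ r ≤ C * r ^ 2 := by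
  have hsm : ContDiffOn ℝ ((1 : ℕ) + 1) σ (Icc 0 T) :=
    (hσ.smooth.mono Icc_subset_Ici_self).of_le (by norm_num; exact ENat.LEInfty.out)
  obtain ⟨C, hC⟩ := exists_taylor_mean_remainder_bound hT.le hsm
  refine ⟨|C|, abs_nonneg C, fun r hr => ?_⟩
  have h1 := hC r hr
  have hd : derivWithin σ (Icc 0 T) 0 = 0 := by
    refine (derivWithin_congr_set ?_).trans hσ.deriv_zero
    filter_upwards [Iio_mem_nhds hT] with y hy
    exact propext ⟨fun h => h.1, fun h => ⟨h, le_of_lt hy⟩⟩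
  have e : taylorWithinEval σ 1 (Icc 0 T) 0 r = 0 := by
    rw [taylorWithinEval_succ σ 0 (Icc 0 T) 0 r, taylor_within_zero_eval, iteratedDerivWithin_one]
    simp [hd, hσ.zero]
  rw [e, sub_zero, sub_zero] at h1
  calc σ r ≤ ‖σ r‖ := Real.le_norm_self _
    _ ≤ C * r ^ (1 + 1) := h1
    _ ≤ |C| * r ^ 2 := mul_le_mul_of_nonneg_right (le_abs_self C) (sq_nonneg r)

/-- A radial test function. -/
noncomputable def radialTest (G : ℝ → ℝ) (x : Space N) (t α C : ℝ) (z : Space N × ℝ) : ℝ :=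
  α * (z.2 - t) + G ‖z.1 - x‖ + C * (z.2 - t) ^ 2

theorem contDiff_radialTest {G : ℝ → ℝ} (hG : ContDiff ℝ ∞ (fun y : Space N => G ‖y‖))
    (x : Space N) (t α C : ℝ) : ContDiff ℝ ∞ (radialTest G x t α C) := by
  have h1 : ContDiff ℝ ∞ (fun z : Space N × ℝ => G ‖z.1 - x‖) :=
    hG.comp (contDiff_fst.sub contDiff_const)
  have h2 : ContDiff ℝ ∞ (fun z : Space N × ℝ => z.2 - t) := contDiff_snd.sub contDiff_const
  exact ((contDiff_const.mul h2).add h1).add (contDiff_const.mul (h2.pow 2))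

theorem timeDeriv_radialTest (G : ℝ → ℝ) (x y : Space N) (t s α C : ℝ) :
    timeDeriv (radialTest G x t α C) y s = α + 2 * C * (s - t) := by
  have h1 : HasDerivAt (fun s : ℝ => s - t) 1 s := (hasDerivAt_id s).sub_const t
  have h2 := ((h1.const_mul α).add_const (G ‖y - x‖)).add ((h1.pow 2).const_mul C)
  refine HasDerivAt.deriv (h2.congr_deriv ?_)
  simp
  ring

theorem norm_spaceGrad_radialTest {G : ℝ → ℝ} {x y : Space N} {t s α C d : ℝ} (hN : 1 ≤ N)
    (hG : HasDerivAt G d ‖y - x‖) (hd : 0 < d) (hy : 0 < ‖y - x‖) :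
    ‖spaceGrad (radialTest G x t α C) y s‖ = d := by
  have : Nonempty (Fin N) := ⟨⟨0, hN⟩⟩
  have hn : DifferentiableAt ℝ (fun z : Space N => ‖z‖) (y - x) :=
    (contDiffAt_norm ℝ (norm_pos_iff.1 hy)).differentiableAt one_ne_zero
  have h1 : HasFDerivAt (fun z : Space N => ‖z - x‖) (fderiv ℝ (fun z : Space N => ‖z‖) (y - x)) y :=
    HasFDerivAt.comp (g := fun z : Space N => ‖z‖) (f := fun z => z - x) y hn.hasFDerivAt
      ((hasFDerivAt_id y).sub_const x)
  have h2 := hG.comp_hasFDerivAt y h1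
  have h3 : HasFDerivAt (fun z => radialTest G x t α C (z, s))
      (d • fderiv ℝ (fun z : Space N => ‖z‖) (y - x)) y :=
    (h2.const_add (α * (s - t))).add_const (C * (s - t) ^ 2)
  rw [spaceGrad, gradient, LinearIsometryEquiv.norm_map, h3.fderiv, norm_smul,
    norm_fderiv_norm hn, Real.norm_of_nonneg hd.le, mul_one]

variable {κ : Space N → Set (Space N) → ℝ} {K : ℝ}

/-- At a point with vanishing gradient and positive time derivative, a test function lies below a
radial test function whose superlevel sets are complements of balls. -/
theorem IsSmoothTest.exists_radialTest (hN : 1 ≤ N) {x : Space N} {t a b : ℝ}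
    {φ : Space N × ℝ → ℝ} (hφ : IsSmoothTest κ T a b φ x t) (hgrad : spaceGrad φ x t = 0)
    (hα : 0 < timeDeriv φ x t) :
    ∃ (Θ : Space N × ℝ → ℝ) (ρ τ γ : ℝ), 0 < ρ ∧ 0 < τ ∧ 0 < γ ∧ ContDiff ℝ ∞ Θ ∧
      (∃ K : Set (Space N), IsCompact K ∧ ∃ c : ℝ → ℝ, ∀ s, ∀ y ∉ K, Θ (y, s) = c s) ∧
      Θ (x, t) = 0 ∧ (∀ s ∈ Icc (t - τ) (t + τ), s ∈ Ioo a b) ∧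
      (∀ y, ∀ s ∈ Ioo a b, (ρ ≤ ‖y - x‖ ∨ τ ≤ |s - t|) →
        φ (y, s) - φ (x, t) + γ ≤ Θ (y, s)) ∧
      ∀ y s, ‖y - x‖ ≤ ρ → |s - t| ≤ τ →
        timeDeriv φ x t / 2 < timeDeriv Θ y s ∧
        (y = x → spaceGrad Θ y s = 0 ∧ ∃ F σ, InFamilyF κ F ∧ IsTimeModulus σ ∧
          ∀ y' s', |Θ (y', s') - Θ (y, s) - timeDeriv Θ y s * (s' - s)| ≤
            F ‖y' - y‖ + σ |s' - s|) ∧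
        (y ≠ x → (∀ y', Θ (y', s) ≥ Θ (y, s) ↔ ‖y - x‖ ≤ ‖y' - x‖) ∧ NoncriticalLevel Θ y s ∧
          ‖spaceGrad Θ y s‖ * cUpper κ ‖y - x‖ < timeDeriv φ x t / 2) := by
  have : Nonempty (Fin N) := ⟨⟨0, hN⟩⟩
  set α := timeDeriv φ x t with hαdef
  obtain ⟨f, σ, hf, hσ, hflat⟩ := hφ.2.2.2.2.flat hgrad
  have hab := hφ.mem_Ioo
  have hf0 : ∀ r, 0 ≤ r → 0 ≤ f r := fun r hr => by
    obtain ⟨e, he⟩ := exists_norm_eq (Space N) hr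
    have h1 := hflat (x + e) t hab
    simp only [add_sub_cancel_left, sub_self, abs_zero, hσ.zero, add_zero, he] at h1
    exact (abs_nonneg _).trans h1
  have hba : 0 < b - a := by linarith [hab.1, hab.2]
  obtain ⟨C₁, hC₁, hσle⟩ := hσ.exists_le_sq hba
  -- The extra unit leaves a gain `(s - t)²`, which separates the functions when `|s - t|` is not
  -- small.
  set C := C₁ + 1 with hC
  have hC0 : 0 < C := by linarith
  -- The bound by `α / (4C)` keeps the time derivative `α + 2C(s - t)` above `α / 2`.
  obtain ⟨τ₀, hτ₀, hτ₀le⟩ : ∃ τ₀ > 0, τ₀ < α / (4 * C) ∧ τ₀ < t - a ∧ τ₀ < b - t := by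
    have h1 : 0 < min (α / (4 * C)) (min (t - a) (b - t)) :=
      lt_min (by positivity) (lt_min (by linarith [hab.1]) (by linarith [hab.2]))
    refine ⟨_, half_pos h1, ?_, ?_, ?_⟩
    · exact (half_lt_self h1).trans_le (min_le_left _ _)
    · exact (half_lt_self h1).trans_le ((min_le_right _ _).trans (min_le_left _ _))
    · exact (half_lt_self h1).trans_le ((min_le_right _ _).trans (min_le_right _ _))
  obtain ⟨hτα, hτa, hτb⟩ := hτ₀le
  have hτα' : 2 * C * τ₀ < α / 2 := by
    rw [lt_div_iff₀ (by positivity)] at hτα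
    linarith
  obtain ⟨ρ₁, hρ₁, hfmono, hfpos, F, hF, hrad⟩ := hf.exists_radial
  -- `f ρ < τ₀² / 2` lets the gain in time beat `f` inside the ball; `α / 12` becomes `α / 2` after
  -- the factor `6` in the gradient bound.
  obtain ⟨ρ, hρ, hρsmall⟩ : ∃ ρ ∈ Ioo 0 ρ₁, f ρ < τ₀ ^ 2 / 2 ∧
      ∀ r ∈ Ioc 0 ρ, derivWithin f (Ici 0) r * cUpper κ r < α / 12 := by
    have h1 : ∀ᶠ r in 𝓝[>] (0 : ℝ), derivWithin f (Ici 0) r * cUpper κ r < α / 12 :=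
      hf.tendsto.eventually (gt_mem_nhds (by positivity))
    obtain ⟨ρ₂, hρ₂, h2⟩ := mem_nhdsGT_iff_exists_Ioo_subset.1 h1
    have h3 : Tendsto f (𝓝[>] 0) (𝓝 0) := by
      have := (hf.smooth.continuousOn 0 self_mem_Ici).tendsto
      rw [hf.zero] at this
      exact this.mono_left (nhdsWithin_mono _ Ioi_subset_Ici_self)
    have h4 : ∀ᶠ r in 𝓝[>] (0 : ℝ), f r < τ₀ ^ 2 / 2 := h3.eventually (gt_mem_nhds (by positivity))
    obtain ⟨ρ, hρ1, hρ2⟩ := (h4.and (Ioo_mem_nhdsGT (lt_min hρ₁ hρ₂))).exists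
    refine ⟨ρ, ⟨hρ2.1, hρ2.2.trans_le (min_le_left _ _)⟩, hρ1, fun r hr => h2 ⟨hr.1, ?_⟩⟩
    exact hr.2.trans_lt (hρ2.2.trans_le (min_le_right _ _))
  obtain ⟨hfρ, hfc⟩ := hρsmall
  obtain ⟨G, γ, hγ, hGsm, ⟨M, cG, hGc⟩, hG0, hGF, hGf, hGd, hGiff⟩ := hrad ρ hρ
  set Θ := radialTest G x t α C with hΘ
  have hΘsm : ContDiff ℝ ∞ Θ := contDiff_radialTest hGsm _ _ _ _
  have hsubI : ∀ s, s ∈ Icc (t - τ₀) (t + τ₀) → s ∈ Ioo a b := fun s hs =>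
    ⟨by linarith [hs.1], by linarith [hs.2]⟩
  have hΘc : ∃ K : Set (Space N), IsCompact K ∧ ∃ c : ℝ → ℝ, ∀ s, ∀ y ∉ K, Θ (y, s) = c s := by
    refine ⟨closedBall x M, isCompact_closedBall _ _,
      fun s => α * (s - t) + cG + C * (s - t) ^ 2, fun s y hy => ?_⟩
    rw [mem_closedBall, not_le, dist_eq_norm] at hy
    simp only [hΘ, radialTest, hGc _ hy.le]
  refine ⟨Θ, ρ, τ₀, min γ (τ₀ ^ 2 / 2), hρ.1, hτ₀, lt_min hγ (by positivity), hΘsm, hΘc,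
    by simp [hΘ, radialTest, hG0], hsubI, fun y s hs hys => ?_, fun y s hy hs => ?_⟩
  · have h2 := (le_abs_self _).trans (hflat y s hs)
    have h3 := hσle |s - t| ⟨abs_nonneg _, by
      rw [abs_le]; constructor <;> linarith [hs.1, hs.2, hab.1, hab.2]⟩
    rw [sq_abs] at h3
    have h1 : φ (y, s) - φ (x, t) ≤
        Θ (y, s) + f ‖y - x‖ - G ‖y - x‖ - (s - t) ^ 2 := by
      simp only [hΘ, radialTest, hC]
      linarith
    rcases le_or_gt ρ ‖y - x‖ with hr | hr
    · have h2 := hGf _ hr (hf0 _ (norm_nonneg _))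
      linarith [min_le_left γ (τ₀ ^ 2 / 2), sq_nonneg (s - t)]
    · have h3 := pow_le_pow_left₀ hτ₀.le (hys.resolve_left (not_le.2 hr)) 2
      rw [sq_abs] at h3
      have h4 : f ‖y - x‖ ≤ f ρ := hfmono.monotoneOn
        ⟨norm_nonneg _, hr.le.trans hρ.2.le⟩ ⟨hρ.1.le, hρ.2.le⟩ hr.le
      have h5 := (hGF _ (norm_nonneg (y - x)) (hf0 _ (norm_nonneg _))).1
      linarith [min_le_right γ (τ₀ ^ 2 / 2)]
  have hyτ := abs_le.1 hs
  have htime : timeDeriv Θ y s = α + 2 * C * (s - t) := timeDeriv_radialTest _ _ _ _ _ _ _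
  have hnorm : ∀ y' : Space N, ‖y' - x‖ ∈ Ioo 0 ρ₁ →
      ∃ d, 0 < d ∧ d ≤ 6 * derivWithin f (Ici 0) ‖y' - x‖ ∧ ‖spaceGrad Θ y' s‖ = d := by
    intro y' hy'
    obtain ⟨d, hd, hd0, hd6⟩ := hGd _ hy'
    exact ⟨d, hd0, hd6, norm_spaceGrad_radialTest hN hd hd0 hy'.1⟩
  refine ⟨?_, fun hyx => ⟨?_, F, fun r => C * r ^ 2, hF,
    ⟨?_, by simp, ?_, fun r hr => by positivity⟩, fun y' s' => ?_⟩, fun hyx => ?_⟩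
  · rw [htime]
    have := mul_le_mul_of_nonneg_left hyτ.1 (show 0 ≤ 2 * C by linarith)
    linarith
  · by_contra hne
    refine spaceGrad_ne_zero_iff.1 hne (IsLocalMin.fderiv_eq_zero (Eventually.of_forall fun y' => ?_))
    have h1 := (hGF _ (norm_nonneg (y' - x)) (hf0 _ (norm_nonneg _))).1
    simp only [hΘ, radialTest, hyx, sub_self, norm_zero, hG0]
    linarith
  · exact (contDiff_const.mul (contDiff_id.pow 2)).contDiffOn
  · have h1 : HasDerivAt (fun r : ℝ => C * r ^ 2) (C * (2 * 0 ^ (2 - 1) * 1)) 0 := by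
      simpa using ((hasDerivAt_id (0 : ℝ)).pow 2).const_mul C
    rw [h1.hasDerivWithinAt.derivWithin (uniqueDiffOn_Ici 0 0 self_mem_Ici)]
    simp
  · rw [htime]
    have e : Θ (y', s') - Θ (y, s) - (α + 2 * C * (s - t)) * (s' - s) =
        G ‖y' - x‖ + C * (s' - s) ^ 2 := by
      simp only [hΘ, radialTest, hyx, sub_self, norm_zero, hG0]
      ring
    have h1 := hGF _ (norm_nonneg (y' - x)) (hf0 _ (norm_nonneg _))
    rw [e]
    simp only [hyx, sq_abs]
    rw [abs_of_nonneg (add_nonneg h1.1 (by positivity))]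
    linarith
  have hpos : 0 < ‖y - x‖ := norm_pos_iff.2 (sub_ne_zero.2 hyx)
  set r := ‖y - x‖ with hr
  have hrρ₁ : r ∈ Ioo 0 ρ₁ := ⟨hpos, hy.trans_lt hρ.2⟩
  have hlev : ∀ y', Θ (y', s) ≥ Θ (y, s) ↔ r ≤ ‖y' - x‖ := fun y' => by
    rw [← hGiff r hrρ₁ _ (norm_nonneg (y' - x))]
    simp only [hΘ, radialTest, ge_iff_le, add_le_add_iff_right, add_le_add_iff_left, hr]
  refine ⟨hlev, fun y' hy' => ?_, ?_⟩
  · have h1 : r ≤ ‖y' - x‖ := (hlev y').1 hy'.ge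
    have h2 : ‖y' - x‖ ∈ Ioo 0 ρ₁ := by
      refine ⟨hpos.trans_le h1, ?_⟩
      -- A level point beyond `ρ₁` would make `G` at an intermediate radius `r' > r` at most `G r`.
      by_contra! hge
      obtain ⟨r', hr1, hr2⟩ := exists_between hrρ₁.2
      have h3 := (hGiff r' ⟨hpos.trans hr1, hr2⟩ _ (norm_nonneg (y' - x))).2 (hr2.le.trans hge)
      have h4 : G ‖y' - x‖ = G r := by
        simp only [hΘ, radialTest] at hy'
        linarith
      rw [h4] at h3
      exact absurd ((hGiff r' ⟨hpos.trans hr1, hr2⟩ r hpos.le).1 h3) (not_le.2 hr1)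
    obtain ⟨d, hd0, -, hd⟩ := hnorm y' h2
    rw [← norm_pos_iff, hd]
    exact hd0
  · obtain ⟨d, hd0, hd6, hd⟩ := hnorm y hrρ₁
    rw [hd]
    rcases le_total 0 (cUpper κ r) with hc | hc
    · have := mul_le_mul_of_nonneg_right hd6 hc
      linarith [hfc r ⟨hpos, hy⟩]
    · linarith [mul_nonpos_of_nonneg_of_nonpos hd0.le hc]

/-- If the time derivative `α` were positive, some member would be touched from above by the radial
function `Θ` near `(x, t)`. Over the centre `x` the test for vanishing gradient contradicts `Θ_t > α
/ 2`. Elsewhere the superlevel set is the complement of a ball and the curvature term exceeds `-α /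
2`, again a contradiction. -/
theorem IsRelaxedSup.flat (hN : 1 ≤ N)
    (hκ : IsSmoothCurvature κ (cUpper κ) K) {𝒱 : Set (SpaceTime N T → ℝ)} {u : SpaceTime N T → ℝ}
    (h : IsRelaxedSup 𝒱 u) (ht : ∀ v ∈ 𝒱, IsSubTested κ v)
    {x : Space N} {t : ↥(Icc (0 : ℝ) T)} {a b : ℝ} {φ : Space N × ℝ → ℝ}
    (hφ : IsSmoothTest κ T a b φ x t)
    (hmax : IsMaxOn (fun w : SpaceTime N T => u w - φ (w.1, (w.2 : ℝ)))
      {w | (w.2 : ℝ) ∈ Icc a b} (x, t)) (hgrad : spaceGrad φ x t = 0) :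
    timeDeriv φ x t ≤ 0 := by
  by_contra! hα
  obtain ⟨Θ, ρ, τ, γ, hρ, hτ, hγ, hsm, ⟨Kc, hKc, cc, hcc⟩, hz, hsub, hoff, hin⟩ :=
    hφ.exists_radialTest hN hgrad hα
  have hΘc : ∃ K : Set (Space N), IsCompact K ∧ ∃ c : ℝ → ℝ,
      ∀ s ∈ Icc ((t : ℝ) - τ) (t + τ), ∀ y ∉ K, Θ (y, s) = c s :=
    ⟨Kc, hKc, cc, fun s _ => hcc s⟩
  obtain ⟨v, hv, y, hyO, hy, hvmax⟩ := h.exists_isMaxOn hN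
    (Θ := Θ) (a := t - τ) (b := t + τ) hsm.continuous.continuousOn hΘc (z := (x, t))
    ⟨by simpa using hτ, by simpa using hτ⟩
    (O := {w | ‖w.1 - x‖ < ρ ∧ |(w.2 : ℝ) - t| < τ}) hγ (fun w hwO hw => by
      have h1 := hmax (show (w.2 : ℝ) ∈ Icc a b from Ioo_subset_Icc_self (hsub _ hw))
      have h2 := hoff w.1 w.2 (hsub _ hw) (by
        by_contra! hn
        exact hwO hn)
      simp only [mem_ofPred_eq] at h1
      rw [hz]
      linarith)
  obtain ⟨g1, g2, g3⟩ := hin y.1 y.2 hyO.1.le hyO.2.le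
  have hyτ := abs_lt.1 hyO.2
  have htest : IsSmoothTest κ T (t - τ) (t + τ) Θ y.1 y.2 := by
    have hl := (hsub _ (left_mem_Icc.2 (by linarith))).1
    have hr := (hsub _ (right_mem_Icc.2 (by linarith))).2
    refine ⟨hφ.1.trans hl.le, hr.le.trans hφ.2.1, ⟨by linarith, by linarith⟩,
      hsm.contDiffOn, hsm.continuous.continuousOn, hsm.contDiffAt.of_le ENat.LEInfty.out,
      hΘc, fun h0 => ?_⟩
    by_cases hyx : y.1 = x
    · obtain ⟨-, F, σ, hF, hσ, hle⟩ := g2 hyx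
      exact ⟨F, σ, hF, hσ, fun y' s _ => hle y' s⟩
    · exact absurd h0 ((g3 hyx).2.1 y.1 rfl)
  have hres := ht v hv y.1 y.2 _ _ _ htest hvmax
  by_cases hyx : y.1 = x
  · linarith [hres.1 (g2 hyx).1]
  · have hpos : 0 < ‖y.1 - x‖ := norm_pos_iff.2 (sub_ne_zero.2 hyx)
    obtain ⟨hlev, hnc, hc⟩ := g3 hyx
    have h1 := hres.2 hnc
    have hset : {y' | Θ (y', (y.2 : ℝ)) ≥ Θ (y.1, (y.2 : ℝ))} = (ball x ‖y.1 - x‖)ᶜ := by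
      ext y'
      rw [mem_ofPred_eq, hlev, mem_compl_iff, mem_ball, not_lt, dist_eq_norm]
    rw [hset] at h1
    have h2 := hκ.compl_upper x _ hpos y.1 (by rw [mem_sphere, dist_eq_norm])
    have h4 := mul_le_mul_of_nonneg_left h2 (norm_nonneg (spaceGrad Θ y.1 y.2))
    linarith

theorem IsRelaxedSup.isSubTested (hN : 1 ≤ N) (hκ : IsSmoothCurvature κ (cUpper κ) K)
    {𝒱 : Set (SpaceTime N T → ℝ)} {u : SpaceTime N T → ℝ}
    (h : IsRelaxedSup 𝒱 u) (ht : ∀ v ∈ 𝒱, IsSubTested κ v) : IsSubTested κ u :=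
  fun _ _ _ _ _ hφ hmax => ⟨h.flat hN hκ ht hφ hmax, h.noncritical hN hκ ht hφ hmax⟩

end FlatStability

/-! ### Perron's method -/

section Perron

variable {N : ℕ} {T : ℝ} {κ : Space N → Set (Space N) → ℝ} {c : ℝ → ℝ} {K : ℝ}

theorem IsJetSubsolution.isSubTested (hN : 1 ≤ N) {b : Space N × ℝ → ℝ}
    (hb : IsJetSubsolution κ b) : IsSubTested κ (fun z : SpaceTime N T => b (z.1, (z.2 : ℝ))) := by
  intro x t a d φ hφ hmax
  have hab := hφ.mem_Ioo
  have hle : ∀ s ∈ Ioo a d, ∀ y, b (y, s) - φ (y, s) ≤ b (x, t) - φ (x, t) := fun s hs y =>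
    hmax (show ((y, ⟨s, hφ.1.trans hs.1.le, hs.2.le.trans hφ.2.1⟩) : SpaceTime N T).2.1 ∈ Icc a d
      from Ioo_subset_Icc_self hs)
  obtain ⟨g1, g2⟩ := hb x t φ _ _ hφ.hasFDerivAt (by
    filter_upwards [Ioo_mem_nhds hab.1 hab.2] with s hs using hle s hs)
  refine ⟨g1, fun hnc => ?_⟩
  rw [setOf_ge_eq_setOf_sub_nonneg]
  refine g2 (hnc x rfl) _ (hφ.isDefining hN hnc) (sub_self _) fun y hy => ?_
  have := hle t hab y
  linarith

/-- The family of subsolutions between the barriers. -/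
def perronClass (T : ℝ) (κ : Space N → Set (Space N) → ℝ) (Bl : Space N × ℝ → ℝ)
    (𝓤 : Set (Space N × ℝ → ℝ)) : Set (SpaceTime N T → ℝ) :=
  {v | UpperSemicontinuous v ∧ (∀ z, Bl (z.1, (z.2 : ℝ)) ≤ v z) ∧
    (∀ W ∈ 𝓤, ∀ z, v z ≤ W (z.1, (z.2 : ℝ))) ∧ IsSubTested κ v}

/-- Barriers for Perron's method: a lower barrier and a family of upper barriers. -/
structure IsPerronBarriers (T : ℝ) (κ : Space N → Set (Space N) → ℝ) (Bl : Space N × ℝ → ℝ)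
    (𝓤 : Set (Space N × ℝ → ℝ)) (R M C₀ : ℝ) : Prop where
  continuous_lower : Continuous Bl
  lower : IsJetSubsolution κ Bl
  continuous_upper : ∀ W ∈ 𝓤, Continuous W
  upper : ∀ W ∈ 𝓤, IsJetSubsolution (dualCurvature κ) (fun z => -W z)
  le : ∀ W ∈ 𝓤, ∀ z : SpaceTime N T, Bl (z.1, (z.2 : ℝ)) ≤ W (z.1, (z.2 : ℝ))
  le_lower : ∀ z, -M ≤ Bl z
  lower_eq : ∀ z : SpaceTime N T, R ≤ ‖z.1‖ → Bl (z.1, (z.2 : ℝ)) = C₀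
  exists_upper : ∃ W ∈ 𝓤, (∀ z, W z ≤ M) ∧
    ∀ z : SpaceTime N T, R ≤ ‖z.1‖ → W (z.1, (z.2 : ℝ)) = C₀

namespace IsPerronBarriers

variable {Bl : Space N × ℝ → ℝ} {𝓤 : Set (Space N × ℝ → ℝ)} {R M C₀ : ℝ}

theorem lower_mem (h : IsPerronBarriers T κ Bl 𝓤 R M C₀) (hN : 1 ≤ N) {b : Space N × ℝ → ℝ}
    (hc : Continuous b) (hb : IsJetSubsolution κ b)
    (hle : ∀ W ∈ 𝓤, ∀ z : SpaceTime N T, b (z.1, (z.2 : ℝ)) ≤ W (z.1, (z.2 : ℝ))) :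
    (fun z : SpaceTime N T => max (b (z.1, (z.2 : ℝ))) (Bl (z.1, (z.2 : ℝ)))) ∈
      perronClass T κ Bl 𝓤 := by
  refine ⟨?_, fun z => le_max_right _ _, fun W hW z => max_le (hle W hW z) (h.le W hW z),
    (hb.sup h.lower).isSubTested hN⟩
  have := h.continuous_lower
  exact Continuous.upperSemicontinuous (by fun_prop)

theorem eq_of_mem (h : IsPerronBarriers T κ Bl 𝓤 R M C₀) {v : SpaceTime N T → ℝ}
    (hv : v ∈ perronClass T κ Bl 𝓤) {z : SpaceTime N T} (hz : R ≤ ‖z.1‖) : v z = C₀ := by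
  obtain ⟨W, hW, -, hWC⟩ := h.exists_upper
  exact le_antisymm ((hv.2.2.1 W hW z).trans (hWC z hz).le) ((h.lower_eq z hz).ge.trans (hv.2.1 z))

theorem _root_.constOutsideCompact_of_norm {u : SpaceTime N T → ℝ} {R C₀ : ℝ}
    (h : ∀ z : SpaceTime N T, R ≤ ‖z.1‖ → u z = C₀) : ConstOutsideCompact u :=
  ⟨closedBall 0 R, isCompact_closedBall _ _, fun _ => C₀, fun t x hx => h (x, t) (by
    rw [mem_closedBall, dist_zero_right, not_le] at hx
    exact hx.le)⟩

/-- The Perron class has a largest element. -/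
theorem exists_isGreatest (h : IsPerronBarriers T κ Bl 𝓤 R M C₀) (hN : 1 ≤ N)
    (hκ : IsSmoothCurvature κ (cUpper κ) K) : ∃ u, IsGreatest (perronClass T κ Bl 𝓤) u := by
  obtain ⟨W₀, hW₀, hW₀M, -⟩ := h.exists_upper
  set S := perronClass T κ Bl 𝓤 with hS
  have hBl : (fun z : SpaceTime N T => Bl (z.1, (z.2 : ℝ))) ∈ S := by
    simpa using h.lower_mem hN h.continuous_lower h.lower h.le
  set s : SpaceTime N T → ℝ := fun z => sSup ((fun v => v z) '' S) with hs
  have hne : ∀ z, ((fun v : SpaceTime N T → ℝ => v z) '' S).Nonempty := fun z =>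
    ⟨_, mem_image_of_mem _ hBl⟩
  have hbd : ∀ z, BddAbove ((fun v : SpaceTime N T → ℝ => v z) '' S) := fun z => by
    refine ⟨M, ?_⟩
    rintro _ ⟨v, hv, rfl⟩
    exact (hv.2.2.1 W₀ hW₀ z).trans (hW₀M _)
  have hle : ∀ v ∈ S, ∀ z, v z ≤ s z := fun v hv z => le_csSup (hbd z) (mem_image_of_mem _ hv)
  have hsW : ∀ W ∈ 𝓤, ∀ z : SpaceTime N T, s z ≤ W (z.1, (z.2 : ℝ)) := fun W hW z => by
    refine csSup_le (hne z) ?_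
    rintro _ ⟨v, hv, rfl⟩
    exact hv.2.2.1 W hW z
  obtain ⟨u, hu, hfreq⟩ := exists_isUSCEnvelope (fun z => (hsW W₀ hW₀ z).trans (hW₀M _))
  have hrel : IsRelaxedSup S u := by
    refine ⟨fun v hv => hv.1, fun v hv => constOutsideCompact_of_norm fun z hz => h.eq_of_mem hv hz,
      fun v hv z => (hle v hv z).trans (hu.1.2 z), fun z d hd => (hfreq z d hd).mono fun y hy => ?_⟩
    obtain ⟨_, ⟨v, hv, rfl⟩, hlt⟩ := exists_lt_of_lt_csSup (hne y) hy
    exact ⟨v, hv, hlt⟩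
  refine ⟨u, ⟨hu.1.1, fun z => hrel.le _ hBl z, fun W hW => ?_,
    hrel.isSubTested hN hκ fun v hv => hv.2.2.2⟩, fun v hv z => hrel.le v hv z⟩
  have := h.continuous_upper W hW
  -- Upper barriers are continuous majorants of the supremum, so the least upper semicontinuous
  -- majorant lies below them.
  exact hu.2 ⟨Continuous.upperSemicontinuous (f := fun z : SpaceTime N T => W (z.1, (z.2 : ℝ)))
    (by fun_prop), hsW W hW⟩

end IsPerronBarriers

/-- `q` is a classical strict subsolution at `(x,t)`. -/
def IsStrictSubsolutionAt (κ : Space N → Set (Space N) → ℝ) (q : Space N × ℝ → ℝ) (x : Space N)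
    (t : ℝ) : Prop :=
  ∃ (p : Space N) (α : ℝ), HasFDerivAt q (jetMap p α) (x, t) ∧ (p = 0 → α < 0) ∧
    (p ≠ 0 → ∃ Ξ, IsDefining Ξ ∧ Ξ x = 0 ∧ (∀ y, 0 < Ξ y → q (x, t) < q (y, t)) ∧
      α + ‖p‖ * κ x {y | 0 ≤ Ξ y} < 0)

/-- At a contact point `q` serves as test function for `W`, whose inequality is the reverse of the
strict one for `q`. This takes the place of a comparison principle. -/
theorem IsStrictSubsolutionAt.not_touch_dual {q W : Space N × ℝ → ℝ} {x : Space N} {t : ℝ}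
    (hq : IsStrictSubsolutionAt κ q x t)
    (hW : IsJetSubsolution (dualCurvature κ) (fun z => -W z))
    (hle : ∀ᶠ s in 𝓝 t, ∀ y, q (y, s) - W (y, s) ≤ q (x, t) - W (x, t)) : False := by
  obtain ⟨p, α, hd, h0, h1⟩ := hq
  have hd' : HasFDerivAt (fun z => -q z) (jetMap (-p) (-α)) (x, t) := by
    refine hd.fun_neg.congr_fderiv (ContinuousLinearMap.ext fun v => ?_)
    simp
    ring
  obtain ⟨g1, g2⟩ := hW x t _ _ _ hd' (by
    filter_upwards [hle] with s hs y
    linarith [hs y])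
  by_cases hp : p = 0
  · linarith [h0 hp, g1 (by simpa using hp)]
  · obtain ⟨Ξ, hΞ, hΞ0, hΞq, hlt⟩ := h1 hp
    have := g2 (by simpa using hp) _ hΞ.neg (by simpa using hΞ0) (fun y hy => by
      have h2 := hle.self_of_nhds y
      have h3 : q (y, t) ≤ q (x, t) := by linarith
      rw [neg_nonneg]
      by_contra! hpos
      exact absurd (hΞq y hpos) (not_lt.2 h3))
    rw [dualCurvature_setOf hΞ.neg] at this
    simp only [neg_neg, norm_neg] at this
    linarith

/-- A test function touching `q` from above has the same jet and a larger superlevel set, hence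
smaller curvature. -/
theorem IsStrictSubsolutionAt.test (hN : 1 ≤ N) (hκ : IsSmoothCurvature κ c K)
    {q φ : Space N × ℝ → ℝ} {x : Space N} {t a b : ℝ} (hq : IsStrictSubsolutionAt κ q x t)
    (hqc : Continuous fun y => q (y, t)) (hφ : IsSmoothTest κ T a b φ x t)
    (hle : ∀ᶠ s in 𝓝 t, ∀ y, q (y, s) - φ (y, s) ≤ q (x, t) - φ (x, t)) :
    (spaceGrad φ x t = 0 → timeDeriv φ x t ≤ 0) ∧
    (NoncriticalLevel φ x t →
      timeDeriv φ x t + ‖spaceGrad φ x t‖ * κ x {y | φ (y, t) ≥ φ (x, t)} ≤ 0) := by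
  obtain ⟨p, α, hd, h0, h1⟩ := hq
  obtain ⟨e1, e2⟩ := jetMap_eq_of_isLocalMin hd hφ.hasFDerivAt (by
    have : ∀ᶠ z : Space N × ℝ in 𝓝 (x, t), ∀ y, q (y, z.2) - φ (y, z.2) ≤ q (x, t) - φ (x, t) :=
      (continuous_snd.tendsto (x, t)).eventually hle
    filter_upwards [this] with z hz
    linarith [hz z.1])
  rw [e1, e2]
  refine ⟨fun hp => (h0 hp).le, fun hnc => ?_⟩
  have hp : p ≠ 0 := e1 ▸ hnc x rfl
  obtain ⟨Ξ, hΞ, hΞ0, hΞq, hlt⟩ := h1 hp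
  have hcl : ∀ y, 0 ≤ Ξ y → q (x, t) ≤ q (y, t) := fun y hy => by
    have h2 : closure {y | 0 < Ξ y} ⊆ {y | q (x, t) ≤ q (y, t)} :=
      closure_minimal (fun y hy => (hΞq y hy).le) (isClosed_le continuous_const hqc)
    rw [hΞ.closure_pos] at h2
    exact h2 hy
  rw [setOf_ge_eq_setOf_sub_nonneg]
  have h3 := hκ.mono _ _ hΞ (hφ.isDefining hN hnc) (fun y hy => by
    linarith [hcl y hy, hle.self_of_nhds y]) x hΞ0 (sub_self _)
  have h4 := mul_le_mul_of_nonneg_left h3 (norm_nonneg p)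
  linarith

/-- The largest element of the Perron class lies above every strict subsolution which it
dominates outside a compact set. -/
theorem IsPerronBarriers.le_of_isStrictSubsolutionAt {Bl : Space N × ℝ → ℝ}
    {𝓤 : Set (Space N × ℝ → ℝ)} (hN : 1 ≤ N) (hκ : IsSmoothCurvature κ c K)
    {R M C₀ : ℝ} (h : IsPerronBarriers T κ Bl 𝓤 R M C₀)
    {u : SpaceTime N T → ℝ} (hu : IsGreatest (perronClass T κ Bl 𝓤) u)
    {q : Space N × ℝ → ℝ} {𝒩 : Set (Space N × ℝ)} (h𝒩 : IsCompact 𝒩) {a b : ℝ} (ha : 0 ≤ a)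
    (hb : b ≤ T) (hsub : ∀ z ∈ 𝒩, z.2 ∈ Ioo a b) (hq : ContinuousOn q (univ ×ˢ Ioo a b))
    (hoff : ∀ z : SpaceTime N T, (z.2 : ℝ) ∈ Ioo a b → (z.1, (z.2 : ℝ)) ∉ 𝒩 →
      q (z.1, (z.2 : ℝ)) ≤ u z)
    (hstrict : ∀ x t, (x, t) ∈ 𝒩 → IsStrictSubsolutionAt κ q x t) :
    ∀ z : SpaceTime N T, (z.2 : ℝ) ∈ Ioo a b → q (z.1, (z.2 : ℝ)) ≤ u z := by
  have hoffW : ∀ W ∈ 𝓤, ∀ y, ∀ s ∈ Ioo a b, (y, s) ∉ 𝒩 → q (y, s) ≤ W (y, s) :=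
    fun W hW y s hs hy => (hoff (y, ⟨s, ha.trans hs.1.le, hs.2.le.trans hb⟩) hs hy).trans
      (hu.1.2.2.1 W hW _)
  -- A positive value of `q - W` would give a maximum over the compact set, and it would be a
  -- maximum over all space because `q ≤ W` elsewhere.
  have hqW : ∀ W ∈ 𝓤, ∀ y, ∀ s ∈ Ioo a b, q (y, s) ≤ W (y, s) := by
    intro W hWU y s hs
    by_contra! hlt
    have hy : (y, s) ∈ 𝒩 := by
      by_contra hy
      exact absurd (hoffW W hWU y s hs hy) (not_le.2 hlt)
    obtain ⟨z, hz, hmax⟩ := h𝒩.exists_isMaxOn ⟨_, hy⟩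
      ((hq.mono fun z hz => ⟨mem_univ _, hsub z hz⟩).sub (h.continuous_upper W hWU).continuousOn)
    have h1 := hmax hy
    simp only [mem_ofPred_eq, Pi.sub_apply] at h1
    refine (hstrict z.1 z.2 hz).not_touch_dual (h.upper W hWU) ?_
    filter_upwards [Ioo_mem_nhds (hsub z hz).1 (hsub z hz).2] with s' hs' y'
    by_cases hy' : (y', s') ∈ 𝒩
    · exact hmax hy'
    · have := hoffW W hWU y' s' hs' hy'
      linarith
  -- The competitor is `max u q` on the time slab. At a contact point either `v = u`, and the test
  -- for `u` applies, or `v = q` on `𝒩`, where `q` is strict.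
  set v : SpaceTime N T → ℝ := fun z =>
    if (z.2 : ℝ) ∈ Ioo a b then max (u z) (q (z.1, (z.2 : ℝ))) else u z with hv
  have hv1 : ∀ z : SpaceTime N T, (z.2 : ℝ) ∈ Ioo a b → v z = max (u z) (q (z.1, (z.2 : ℝ))) :=
    fun z hz => if_pos hz
  have hv2 : ∀ z : SpaceTime N T, (z.1, (z.2 : ℝ)) ∉ 𝒩 → v z = u z := fun z hz => by
    by_cases h : (z.2 : ℝ) ∈ Ioo a b
    · rw [hv1 z h, max_eq_left (hoff z h hz)]
    · exact if_neg h
  have huv : ∀ z, u z ≤ v z := fun z => by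
    by_cases h : (z.2 : ℝ) ∈ Ioo a b
    · rw [hv1 z h]; exact le_max_left _ _
    · exact (if_neg h : v z = u z).ge
  have hct : Continuous fun z : SpaceTime N T => (z.1, (z.2 : ℝ)) := by fun_prop
  have hvS : v ∈ perronClass T κ Bl 𝓤 := by
    refine ⟨?_, fun z => (hu.1.2.1 z).trans (huv z), fun W hWU z => ?_, ?_⟩
    · rw [upperSemicontinuous_iff]
      intro z
      rw [upperSemicontinuousAt_iff]
      intro d hd
      by_cases hz : (z.1, (z.2 : ℝ)) ∈ 𝒩
      · have hI := hsub _ hz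
        rw [hv1 z hI, max_lt_iff] at hd
        have hqz : ContinuousAt q (z.1, (z.2 : ℝ)) :=
          hq.continuousAt (prod_mem_nhds univ_mem (Ioo_mem_nhds hI.1 hI.2))
        filter_upwards [upperSemicontinuousAt_iff.1 (hu.1.1.upperSemicontinuousAt z) d hd.1,
          hct.continuousAt.eventually (hqz.eventually_lt continuousAt_const hd.2),
          (continuous_snd.comp hct).continuousAt.eventually (Ioo_mem_nhds hI.1 hI.2)] with y h1 h2 h3
        rw [hv1 y h3]
        exact max_lt h1 h2
      · rw [hv2 z hz] at hd
        filter_upwards [upperSemicontinuousAt_iff.1 (hu.1.1.upperSemicontinuousAt z) d hd,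
          hct.continuousAt.eventually (h𝒩.isClosed.isOpen_compl.mem_nhds hz)] with y h1 h2
        rw [hv2 y h2]
        exact h1
    · by_cases h : (z.2 : ℝ) ∈ Ioo a b
      · rw [hv1 z h]
        exact max_le (hu.1.2.2.1 W hWU z) (hqW W hWU _ _ h)
      · exact (if_neg h : v z = u z).le.trans (hu.1.2.2.1 W hWU z)
    · intro x t a' b' φ hφ hmax
      by_cases hvu : v (x, t) = u (x, t)
      · refine hu.1.2.2.2 x t a' b' φ hφ fun w hw => ?_
        have := hmax hw
        simp only [mem_ofPred_eq] at this ⊢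
        linarith [huv w]
      · have hz : (x, (t : ℝ)) ∈ 𝒩 := by
          by_contra hz
          exact hvu (hv2 (x, t) hz)
        have hI : (t : ℝ) ∈ Ioo a b := hsub _ hz
        have hvq : v (x, t) = q (x, t) := by
          rw [hv1 (x, t) hI] at hvu ⊢
          exact max_eq_right (le_of_lt (lt_of_not_ge fun h => hvu (max_eq_left h)))
        refine (hstrict x t hz).test hN hκ ?_ hφ ?_
        · exact hq.comp_continuous (f := fun y => (y, (t : ℝ))) (by fun_prop)
            fun y => ⟨mem_univ _, hI⟩
        · filter_upwards [Ioo_mem_nhds hI.1 hI.2, Ioo_mem_nhds hφ.mem_Ioo.1 hφ.mem_Ioo.2]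
            with s hs hs' y
          have h1 := hmax (show ((y, ⟨s, ha.trans hs.1.le, hs.2.le.trans hb⟩) :
            SpaceTime N T).2.1 ∈ Icc a' b' from Ioo_subset_Icc_self hs')
          simp only [mem_ofPred_eq, hvq] at h1
          have h2 : q (y, s) ≤ v (y, ⟨s, ha.trans hs.1.le, hs.2.le.trans hb⟩) := by
            rw [hv1 _ hs]
            exact le_max_right _ _
          linarith
  intro z hz
  have := hu.2 hvS z
  rw [hv1 z hz] at this
  exact (le_max_right _ _).trans this

end Perron

/-! ### Bumps and the supersolution property -/

section Supersolution

variable {N : ℕ} {T : ℝ} {κ : Space N → Set (Space N) → ℝ} {K : ℝ}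

theorem spaceGrad_neg (φ : Space N × ℝ → ℝ) (x : Space N) (t : ℝ) :
    spaceGrad (fun z => -φ z) x t = -spaceGrad φ x t := by
  rw [spaceGrad, spaceGrad, gradient, gradient, fderiv_fun_neg, map_neg]

theorem timeDeriv_neg (φ : Space N × ℝ → ℝ) (x : Space N) (t : ℝ) :
    timeDeriv (fun z => -φ z) x t = -timeDeriv φ x t :=
  deriv.fun_neg

theorem IsSmoothTest.neg {a b : ℝ} {φ : Space N × ℝ → ℝ} {x : Space N} {t : ℝ}
    (h : IsSmoothTest κ T a b φ x t) : IsSmoothTest κ T a b (fun z => -φ z) x t := by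
  obtain ⟨h1, h2, h3, h4, h5⟩ := h
  obtain ⟨Kc, hK, c, hc⟩ := h5.const_outside
  refine ⟨h1, h2, h3, h4.neg, h5.continuousOn.neg, h5.contDiffAt.neg,
    ⟨Kc, hK, fun s => -c s, fun s hs y hy => by rw [hc s hs y hy]⟩, fun h0 => ?_⟩
  rw [spaceGrad_neg, neg_eq_zero] at h0
  obtain ⟨f, σ, hf, hσ, hle⟩ := h5.flat h0
  refine ⟨f, σ, hf, hσ, fun y s hs => ?_⟩
  rw [timeDeriv_neg, ← abs_neg]
  refine le_of_eq_of_le (congrArg abs ?_) (hle y s hs)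
  ring

theorem IsSmoothTest.exists_strict_noncritical {a b : ℝ} {φ : Space N × ℝ → ℝ} {x : Space N} {t : ℝ}
    {c : ℝ → ℝ} (hN : 1 ≤ N) (hκ : IsSmoothCurvature κ c K) (hφ : IsSmoothTest κ T a b φ x t)
    (hnc : NoncriticalLevel φ x t)
    (hneg : timeDeriv φ x t + ‖spaceGrad φ x t‖ * κ x {y | 0 ≤ φ (y, t) - φ (x, t)} < 0) :
    ∃ (q : Space N × ℝ → ℝ) (ρ γ : ℝ), 0 < ρ ∧ 0 < γ ∧ ContinuousOn q (univ ×ˢ Ioo a b) ∧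
      Icc (t - ρ) (t + ρ) ⊆ Ioo a b ∧ q (x, t) = γ ∧
      (∀ y s, (ρ ≤ ‖y - x‖ ∨ ρ ≤ |s - t|) → q (y, s) ≤ φ (y, s) - φ (x, t)) ∧
      ∀ y s, ‖y - x‖ ≤ ρ → |s - t| ≤ ρ → IsStrictSubsolutionAt κ q y s := by
  have hev := ((hφ.tendsto_penalized hN hκ hnc).eventually (gt_mem_nhds hneg)).and
    ((hφ.eventually_isDefining hN hnc).and
      ((Continuous.tendsto (f := fun w : (Space N × ℝ) × ℝ => w.1.2) (by fun_prop) _).eventually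
        (Ioo_mem_nhds hφ.mem_Ioo.1 hφ.mem_Ioo.2)))
  obtain ⟨δ, hδ, hball⟩ := Metric.eventually_nhds_iff.1 hev
  set ρ := δ / 2 with hρ
  have hρ0 : 0 < ρ := by positivity
  have hρδ : ρ < δ := half_lt_self hδ
  obtain ⟨γ, hγ, hpen⟩ := exists_le_penalty x t hρ0
  have hin : ∀ y s, ‖y - x‖ ≤ ρ → |s - t| ≤ ρ →
      dist (((y, s), -ρ) : (Space N × ℝ) × ℝ) ((x, t), 0) < δ := fun y s hy hs => by
    rw [Prod.dist_eq, Prod.dist_eq, dist_eq_norm, Real.dist_eq, Real.dist_eq, sub_zero]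
    refine max_lt (max_lt (hy.trans_lt hρδ) (hs.trans_lt hρδ)) ?_
    rwa [abs_neg, abs_of_pos hρ0]
  -- The lift `ρ * γ` is at most what the penalty removes at distance `ρ`, so the bump is confined
  -- to a neighbourhood.
  set q : Space N × ℝ → ℝ := fun z => penalized φ x t (-ρ) z + (ρ * γ - φ (x, t)) with hq
  refine ⟨q, ρ, ρ * γ, hρ0, mul_pos hρ0 hγ, ?_, fun s hs => ?_, ?_, fun y s hys => ?_,
    fun y s hy hs => ?_⟩
  · exact fun z hz => ((contDiffAt_penalized (hφ.contDiffAt hz.2 z.1) _).continuousAt.add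
      continuousAt_const).continuousWithinAt
  · exact (hball (hin x s (by simpa using hρ0.le)
      (abs_le.2 ⟨by linarith [hs.1], by linarith [hs.2]⟩))).2.2
  · simp [hq, penalized]
  · have := mul_le_mul_of_nonneg_left (hpen (y, s) hys) hρ0.le
    simp only [hq, penalized]
    linarith
  · obtain ⟨g1, g2, g3⟩ := hball (hin y s hy hs)
    simp only at g1 g2 g3
    have hd := ((contDiffAt_penalized (x := x) (t := t) (hφ.contDiffAt g3 y) (-ρ)).differentiableAt
      (by simp)).hasFDerivAt_jetMap
    refine ⟨_, _, hd.add_const _, fun h0 => ?_, fun _ => ⟨_, g2, sub_self _, fun y' hy' => ?_, g1⟩⟩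
    · have := g2.regular y (sub_self _)
      rw [fderiv_sub_const] at this
      exact absurd h0 (spaceGrad_ne_zero_iff.2 this)
    · simp only [hq]
      linarith

/-- The bump is `γ - Θ` for the radial function `Θ` above `-φ`. Off the centre its strict superlevel
sets are balls, whose curvature is bounded by `cUpper`. -/
theorem IsSmoothTest.exists_strict_critical {a b : ℝ} {φ : Space N × ℝ → ℝ} {x : Space N} {t : ℝ}
    (hN : 1 ≤ N) (hκ : IsSmoothCurvature κ (cUpper κ) K) (hφ : IsSmoothTest κ T a b φ x t)
    (hgrad : spaceGrad φ x t = 0) (hneg : timeDeriv φ x t < 0) :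
    ∃ (q : Space N × ℝ → ℝ) (ρ τ γ : ℝ), 0 < ρ ∧ 0 < τ ∧ 0 < γ ∧ Continuous q ∧
      Icc (t - τ) (t + τ) ⊆ Ioo a b ∧ q (x, t) = γ ∧
      (∀ y, ∀ s ∈ Ioo a b, (ρ ≤ ‖y - x‖ ∨ τ ≤ |s - t|) →
        q (y, s) ≤ φ (y, s) - φ (x, t)) ∧
      ∀ y s, ‖y - x‖ ≤ ρ → |s - t| ≤ τ → IsStrictSubsolutionAt κ q y s := by
  obtain ⟨Θ, ρ, τ, γ, hρ, hτ, hγ, hsm, -, hz, hsub, hoff, hin⟩ :=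
    hφ.neg.exists_radialTest hN (by rw [spaceGrad_neg, hgrad, neg_zero])
      (by rw [timeDeriv_neg]; linarith)
  refine ⟨fun z => γ - Θ z, ρ, τ, γ, hρ, hτ, hγ, continuous_const.sub hsm.continuous, hsub,
    by simp [hz], fun y s hs hys => by linarith [hoff y s hs hys], fun y s hy hs => ?_⟩
  obtain ⟨g1, g2, g3⟩ := hin y s hy hs
  have hα : 0 < timeDeriv (fun z => -φ z) x t := by rw [timeDeriv_neg]; linarith
  have hd := (hsm.differentiable (by simp) (y, s)).hasFDerivAt_jetMap.const_sub γ
  refine ⟨-spaceGrad Θ y s, -timeDeriv Θ y s, hd.congr_fderiv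
    (ContinuousLinearMap.ext fun v => by simp; ring), fun _ => by linarith, fun h0 => ?_⟩
  have hyx : y ≠ x := fun h => h0 (by rw [(g2 h).1, neg_zero])
  obtain ⟨hlev, -, hc⟩ := g3 hyx
  have hpos : 0 < ‖y - x‖ := norm_pos_iff.2 (sub_ne_zero.2 hyx)
  have hys : y ∈ sphere x ‖y - x‖ := by rw [mem_sphere, dist_eq_norm]
  refine ⟨ballFn x ‖y - x‖, isDefining_ballFn x hpos, ballFn_eq_zero hys, fun y' hy' => ?_, ?_⟩
  · have h1 : ¬ ‖y - x‖ ≤ ‖y' - x‖ := fun h => by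
      rw [ballFn] at hy'
      linarith [pow_le_pow_left₀ hpos.le h 2]
    rw [← hlev, ge_iff_le, not_le] at h1
    linarith
  · rw [setOf_ballFn_nonneg x hpos, norm_neg]
    have := mul_le_mul_of_nonneg_left (hκ.ball_upper x _ hpos y hys)
      (norm_nonneg (spaceGrad Θ y s))
    linarith

variable {Bl : Space N × ℝ → ℝ} {𝓤 : Set (Space N × ℝ → ℝ)} {R M C₀ : ℝ}

/-- The lower envelope of the largest element of the Perron class cannot be touched from below by
a test function above which there is room for a strict subsolution. -/
theorem IsPerronBarriers.not_bump (h : IsPerronBarriers T κ Bl 𝓤 R M C₀) (hN : 1 ≤ N)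
    (hκ : IsSmoothCurvature κ (cUpper κ) K) {u w : SpaceTime N T → ℝ}
    (hu : IsGreatest (perronClass T κ Bl 𝓤) u) (hwu : w ≤ u)
    (hw : ∀ z c, w z < c → ∃ᶠ y in 𝓝 z, u y < c) {x : Space N} {t : ↥(Icc (0 : ℝ) T)}
    {q φ : Space N × ℝ → ℝ} {a b ρ τ γ : ℝ} (ha : 0 ≤ a) (hb : b ≤ T) (hτ : 0 < τ)
    (hγ : 0 < γ)
    (hmin : IsMinOn (fun z : SpaceTime N T => w z - φ (z.1, (z.2 : ℝ)))
      {z | (z.2 : ℝ) ∈ Icc a b} (x, t))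
    (hqc : ContinuousOn q (univ ×ˢ Ioo a b)) (hsub : Icc ((t : ℝ) - τ) (t + τ) ⊆ Ioo a b)
    (hqz : q (x, t) = γ)
    (hoff : ∀ y, ∀ s ∈ Ioo a b, (ρ < ‖y - x‖ ∨ τ < |s - (t : ℝ)|) → q (y, s) ≤ φ (y, s) - φ (x, t))
    (hstrict : ∀ y s, ‖y - x‖ ≤ ρ → |s - (t : ℝ)| ≤ τ → IsStrictSubsolutionAt κ q y s) : False := by
  have hmem : ∀ s, |s - (t : ℝ)| ≤ τ → s ∈ Ioo a b := fun s hs => hsub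
    ⟨by linarith [(abs_le.1 hs).1], by linarith [(abs_le.1 hs).2]⟩
  set e := w (x, t) with he
  -- Maximality puts `q + e` below `u`, while `u` takes values below `e + γ / 2` arbitrarily near
  -- `(x, t)`, where `q + e` is close to `e + γ`.
  have hle := h.le_of_isStrictSubsolutionAt hN hκ hu (q := fun z => q z + e)
    (𝒩 := closedBall x ρ ×ˢ closedBall (t : ℝ) τ)
    ((isCompact_closedBall _ _).prod (isCompact_closedBall _ _)) ha hb
    (fun z hz => hmem _ (by simpa [Real.dist_eq] using hz.2)) (hqc.add continuousOn_const)
    (fun z hz hzn => by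
      have h1 := hmin (Ioo_subset_Icc_self hz)
      have h2 := hoff z.1 z.2 hz (by
        by_contra! hn
        exact hzn ⟨by simpa [dist_eq_norm] using hn.1, by simpa [Real.dist_eq] using hn.2⟩)
      have h3 := hwu z
      simp only [mem_ofPred_eq] at h1
      linarith)
    (fun y s hys => by
      obtain ⟨p, α, hd, h0, h1⟩ := hstrict y s (by simpa [dist_eq_norm] using hys.1)
        (by simpa [Real.dist_eq] using hys.2)
      refine ⟨p, α, hd.add_const _, h0, fun hp => ?_⟩
      obtain ⟨Ξ, g1, g2, g3, g4⟩ := h1 hp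
      exact ⟨Ξ, g1, g2, fun y' hy' => by linarith [g3 y' hy'], g4⟩)
  have hI : (t : ℝ) ∈ Ioo a b := hmem t (by simpa using hτ.le)
  have hct : Continuous fun z : SpaceTime N T => (z.1, (z.2 : ℝ)) := by fun_prop
  have hqx : ContinuousAt q (x, (t : ℝ)) :=
    hqc.continuousAt (prod_mem_nhds univ_mem (Ioo_mem_nhds hI.1 hI.2))
  have hq : ∀ᶠ z : SpaceTime N T in 𝓝 (x, t), γ / 2 < q (z.1, (z.2 : ℝ)) :=
    (hct.tendsto (x, t)).eventually (continuousAt_const.eventually_lt hqx (by linarith))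
  have hIe : ∀ᶠ z : SpaceTime N T in 𝓝 (x, t), (z.2 : ℝ) ∈ Ioo a b :=
    ((continuous_snd.comp hct).tendsto (x, t)).eventually (Ioo_mem_nhds hI.1 hI.2)
  obtain ⟨z, hz1, hz2, hz3⟩ :=
    ((hw (x, t) (e + γ / 2) (by linarith)).and_eventually (hq.and hIe)).exists
  linarith [hle z hz3]

/-- The lower envelope of the largest element of the Perron class satisfies the test conditions
for supersolutions. -/
theorem IsPerronBarriers.super_test (h : IsPerronBarriers T κ Bl 𝓤 R M C₀) (hN : 1 ≤ N)
    (hκ : IsSmoothCurvature κ (cUpper κ) K) {u w : SpaceTime N T → ℝ}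
    (hu : IsGreatest (perronClass T κ Bl 𝓤) u) (hwu : w ≤ u)
    (hw : ∀ z c, w z < c → ∃ᶠ y in 𝓝 z, u y < c) {x : Space N} {t : ↥(Icc (0 : ℝ) T)}
    {a b : ℝ} {φ : Space N × ℝ → ℝ} (hφ : IsSmoothTest κ T a b φ x t)
    (hmin : IsMinOn (fun z : SpaceTime N T => w z - φ (z.1, (z.2 : ℝ)))
      {z | (z.2 : ℝ) ∈ Icc a b} (x, t)) :
    (spaceGrad φ x t = 0 → 0 ≤ timeDeriv φ x t) ∧
    (NoncriticalLevel φ x t →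
      0 ≤ timeDeriv φ x t +
        ‖spaceGrad φ x t‖ * κ x (closure {y | φ (y, (t : ℝ)) > φ (x, (t : ℝ))})) := by
  refine ⟨fun hgrad => ?_, fun hnc => ?_⟩
  · by_contra! hneg
    obtain ⟨q, ρ, τ, γ, -, hτ, hγ, hqc, hsub, hqz, hoff, hstrict⟩ :=
      hφ.exists_strict_critical hN hκ hgrad hneg
    exact h.not_bump hN hκ hu hwu hw hφ.1 hφ.2.1 hτ hγ hmin hqc.continuousOn hsub hqz
      (fun y s hs hys => hoff y s hs (hys.imp le_of_lt le_of_lt)) hstrict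
  · have hset : closure {y | φ (y, (t : ℝ)) > φ (x, (t : ℝ))} =
        {y | 0 ≤ φ (y, (t : ℝ)) - φ (x, (t : ℝ))} := by
      rw [← (hφ.isDefining hN hnc).closure_pos]
      simp only [gt_iff_lt, sub_pos]
    rw [hset]
    by_contra! hneg
    obtain ⟨q, ρ, γ, hρ, hγ, hqc, hsub, hqz, hoff, hstrict⟩ :=
      hφ.exists_strict_noncritical hN hκ hnc hneg
    exact h.not_bump hN hκ hu hwu hw hφ.1 hφ.2.1 hρ hγ hmin hqc hsub hqz
      (fun y s _ hys => hoff y s (hys.imp le_of_lt le_of_lt)) hstrict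

end Supersolution

/-! ### Explicit barriers and existence -/

section Existence

variable {N : ℕ} {κ : Space N → Set (Space N) → ℝ} {c : ℝ → ℝ} {K : ℝ} {u₀ : Space N → ℝ}
  {C₀ M R T : ℝ}

/-- Continuous subsolutions which start below `u₀` and stay below their initial values. -/
def lowerBarriers (κ : Space N → Set (Space N) → ℝ) (u₀ : Space N → ℝ) :
    Set (Space N × ℝ → ℝ) :=
  {b | Continuous b ∧ IsJetSubsolution κ b ∧ (∀ x s, 0 ≤ s → b (x, s) ≤ b (x, 0)) ∧
    ∀ x, b (x, 0) ≤ u₀ x}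

/-- Continuous supersolutions which start above `u₀` and stay above their initial values. -/
def upperBarriers (κ : Space N → Set (Space N) → ℝ) (u₀ : Space N → ℝ) :
    Set (Space N × ℝ → ℝ) :=
  {W | (fun z => -W z) ∈ lowerBarriers (dualCurvature κ) (fun x => -u₀ x)}

theorem le_of_mem_lowerBarriers {b : Space N × ℝ → ℝ} (hb : b ∈ lowerBarriers κ u₀) (x : Space N)
    {s : ℝ} (hs : 0 ≤ s) : b (x, s) ≤ u₀ x :=
  (hb.2.2.1 x s hs).trans (hb.2.2.2 x)

theorem le_of_mem_upperBarriers {W : Space N × ℝ → ℝ} (hW : W ∈ upperBarriers κ u₀) (x : Space N)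
    {s : ℝ} (hs : 0 ≤ s) : u₀ x ≤ W (x, s) :=
  neg_le_neg_iff.1 (le_of_mem_lowerBarriers hW x hs)

theorem neg_mem_upperBarriers {b : Space N × ℝ → ℝ}
    (hb : b ∈ lowerBarriers (dualCurvature κ) (fun x => -u₀ x)) :
    (fun z => -b z) ∈ upperBarriers κ u₀ := by
  change (fun z => - -b z) ∈ lowerBarriers (dualCurvature κ) (fun x => -u₀ x)
  simpa only [neg_neg] using hb

theorem continuous_of_mem_upperBarriers {W : Space N × ℝ → ℝ} (hW : W ∈ upperBarriers κ u₀) :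
    Continuous W := by
  have h : Continuous fun z => -W z := hW.1
  simpa only [neg_neg] using h.fun_neg

theorem IsSmoothCurvature.exists_mem_lowerBarriers (hκ : IsSmoothCurvature κ c K)
    (hu : UniformContinuous u₀) (hM : ∀ x, |u₀ x - C₀| ≤ M) (x₀ : Space N) {ε : ℝ} (hε : 0 < ε) :
    ∃ b ∈ lowerBarriers κ u₀, u₀ x₀ - ε ≤ b (x₀, 0) := by
  obtain ⟨δ, hδ, hδε⟩ := Metric.uniformContinuous_iff.1 hu ε hε
  have hM0 : 0 ≤ M := (abs_nonneg _).trans (hM 0)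
  set ρ := δ / 2 with hρ
  have hρ0 : 0 < ρ := by positivity
  -- At distance `δ = 2ρ` the cone has dropped by `L * ρ = 2M` from its plateau, hence below `C₀ - M
  -- ≤ u₀`; nearer to `x₀` uniform continuity suffices.
  set L := 2 * M / ρ with hL
  have hL0 : 0 ≤ L := by positivity
  have hLρ : L * ρ = 2 * M := div_mul_cancel₀ _ hρ0.ne'
  set C := max 0 (L * c ρ) with hC
  have hC0 : 0 ≤ C := le_max_left _ _
  refine ⟨fun z => (u₀ x₀ - ε + L * ρ) - L * max ‖z.1 - x₀‖ ρ - C * z.2,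
    ⟨by fun_prop, hκ.isJetSubsolution_cone x₀ hL0 hρ0 hC0 (le_max_right _ _), fun x s hs => ?_,
      fun x => ?_⟩, ?_⟩
  · have := mul_nonneg hC0 hs
    simp only
    linarith
  · simp only [mul_zero, sub_zero]
    rcases lt_or_ge ‖x - x₀‖ δ with h | h
    · have h1 := hδε (a := x) (b := x₀) (by rwa [dist_eq_norm])
      rw [Real.dist_eq, abs_lt] at h1
      have h2 := mul_le_mul_of_nonneg_left (le_max_right ‖x - x₀‖ ρ) hL0
      linarith [h1.1]
    · have h1 := mul_le_mul_of_nonneg_left (h.trans (le_max_left ‖x - x₀‖ ρ)) hL0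
      have h2 : L * δ = 2 * (L * ρ) := by rw [hρ]; ring
      have h3 := (abs_le.1 (hM x)).1
      have h4 := (abs_le.1 (hM x₀)).2
      linarith
  · simp [max_eq_right hρ0.le]

/-- A function which is constant outside a ball that expands with speed `K`. -/
noncomputable def expandingBarrier (C₀ M R K : ℝ) (z : Space N × ℝ) : ℝ :=
  C₀ - M * max 0 (min 1 (R + 1 - (‖z.1‖ - K * z.2)))

theorem expandingBarrier_le (hM : 0 ≤ M) (z : Space N × ℝ) : expandingBarrier C₀ M R K z ≤ C₀ :=
  sub_le_self _ (mul_nonneg hM (le_max_left _ _))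

theorem le_expandingBarrier (hM : 0 ≤ M) (z : Space N × ℝ) :
    C₀ - M ≤ expandingBarrier C₀ M R K z := by
  have := mul_le_mul_of_nonneg_left
    (max_le zero_le_one (min_le_left 1 (R + 1 - (‖z.1‖ - K * z.2)))) hM
  rw [expandingBarrier]
  linarith

theorem expandingBarrier_eq (hK : 0 ≤ K) {z : Space N × ℝ} (ht : z.2 ≤ T)
    (hz : R + 1 + K * T ≤ ‖z.1‖) : expandingBarrier C₀ M R K z = C₀ := by
  have h1 := mul_le_mul_of_nonneg_left ht hK
  rw [expandingBarrier, max_eq_left ((min_le_right _ _).trans (by linarith)), mul_zero, sub_zero]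

/-- Initially it is `C₀ - M ≤ u₀` on the ball of radius `R`, and at most `C₀ = u₀` outside; the
shell of width `1` makes it continuous. -/
theorem IsSmoothCurvature.expandingBarrier_mem (hκ : IsSmoothCurvature κ c K)
    (hM : ∀ x, |u₀ x - C₀| ≤ M) (hR : ∀ x, R ≤ ‖x‖ → u₀ x = C₀) :
    expandingBarrier C₀ M R K ∈ lowerBarriers κ u₀ := by
  have hM0 : 0 ≤ M := (abs_nonneg _).trans (hM 0)
  have hg : Monotone fun r : ℝ => C₀ - M * max 0 (min 1 (R + 1 - r)) := fun r s hrs =>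
    sub_le_sub_left (mul_le_mul_of_nonneg_left
      (max_le_max_left 0 (min_le_min_left 1 (sub_le_sub_left hrs _))) hM0) _
  refine ⟨?_, hκ.isJetSubsolution_expanding hg, fun x s hs => hg ?_, fun x => ?_⟩
  · unfold expandingBarrier
    fun_prop
  · have := mul_nonneg hκ.K_pos.le hs
    simp only
    linarith
  · rcases le_total R ‖x‖ with h | h
    · rw [hR x h]
      exact expandingBarrier_le hM0 _
    · have h1 := (abs_le.1 (hM x)).1
      rw [expandingBarrier, min_eq_left (by simp only; linarith), max_eq_right zero_le_one]
      linarith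

/-- The initial datum separates lower from upper barriers at all times. The upper barrier equal to
`C₀` far out is the negative of the expanding one for the dual curvature, with the same `K`. -/
theorem IsSmoothCurvature.isPerronBarriers (hκ : IsSmoothCurvature κ c K)
    (hM : ∀ x, |u₀ x - C₀| ≤ M) (hR : ∀ x, R ≤ ‖x‖ → u₀ x = C₀) :
    IsPerronBarriers T κ (expandingBarrier C₀ M R K) (upperBarriers κ u₀) (R + 1 + K * T)
      (|C₀| + M) C₀ := by
  have hM0 : 0 ≤ M := (abs_nonneg _).trans (hM 0)
  have hb := hκ.expandingBarrier_mem hM hR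
  have hb' := hκ.dual.expandingBarrier_mem (u₀ := fun x => -u₀ x) (C₀ := -C₀) (M := M)
    (fun x => by rw [← neg_sub', abs_neg]; exact hM x) (fun x hx => by rw [hR x hx])
  refine ⟨hb.1, hb.2.1, fun W hW => continuous_of_mem_upperBarriers hW, fun W hW => hW.2.1,
    fun W hW z => (le_of_mem_lowerBarriers hb _ z.2.2.1).trans
      (le_of_mem_upperBarriers hW _ z.2.2.1), fun z => ?_,
    fun z hz => expandingBarrier_eq hκ.K_pos.le z.2.2.2 hz,
    fun z => -expandingBarrier (-C₀) M R K z, neg_mem_upperBarriers hb', fun z => ?_,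
    fun z hz => ?_⟩
  · linarith [le_expandingBarrier (C₀ := C₀) (R := R) (K := K) hM0 z, neg_abs_le C₀]
  · have := le_expandingBarrier (C₀ := -C₀) (R := R) (K := K) hM0 z
    linarith [le_abs_self C₀]
  · have e : expandingBarrier (-C₀) M R K (z.1, (z.2 : ℝ)) = -C₀ :=
      expandingBarrier_eq hκ.K_pos.le z.2.2.2 hz
    simp only [e, neg_neg]

theorem exists_abs_sub_le (hu : Continuous u₀) (hR : ∀ x, R ≤ ‖x‖ → u₀ x = C₀) :
    ∃ M, ∀ x, |u₀ x - C₀| ≤ M := by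
  obtain ⟨M, hM⟩ := (isCompact_closedBall (0 : Space N) R).exists_bound_of_continuousOn
    (f := fun x => u₀ x - C₀) (hu.sub continuous_const).continuousOn
  refine ⟨max M 0, fun x => ?_⟩
  rcases le_total R ‖x‖ with h | h
  · simp [hR x h]
  · exact (hM x (by simpa using h)).trans (le_max_left _ _)

/-- Being upper semicontinuous, the largest element is its own upper envelope. Upper cones bound it
by `u₀` initially; lower cones, joined with the lower barrier, belong to the class and, being
continuous, also lie below the lower envelope. -/
theorem IsSmoothCurvature.exists_viscositySolution (hN : 1 ≤ N)
    (hκ : IsSmoothCurvature κ (cUpper κ) K) (hu : UniformContinuous u₀)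
    (hR : ∀ x, R ≤ ‖x‖ → u₀ x = C₀) :
    ∃ u : SpaceTime N T → ℝ, IsViscositySolution κ u₀ u ∧
      ∀ x t, R + 1 + K * T ≤ ‖x‖ → u (x, t) = C₀ := by
  obtain ⟨M, hM⟩ := exists_abs_sub_le hu.continuous hR
  have hP := hκ.isPerronBarriers (T := T) hM hR
  obtain ⟨u, hmax⟩ := hP.exists_isGreatest hN hκ
  have huC : ∀ z : SpaceTime N T, R + 1 + K * T ≤ ‖z.1‖ → u z = C₀ := fun z =>
    hP.eq_of_mem hmax.1
  obtain ⟨w, hw, hfreq⟩ := exists_isLSCEnvelope (u := u) (m := -(|C₀| + M))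
    (fun z => (hP.le_lower _).trans (hmax.1.2.1 z))
  have hlow : ∀ b : Space N × ℝ → ℝ, Continuous b →
      (∀ z : SpaceTime N T, b (z.1, (z.2 : ℝ)) ≤ u z) →
      ∀ z : SpaceTime N T, b (z.1, (z.2 : ℝ)) ≤ w z := fun b hb hbu =>
    hw.2 ⟨Continuous.lowerSemicontinuous (f := fun z : SpaceTime N T => b (z.1, (z.2 : ℝ)))
      (by fun_prop), hbu⟩
  refine ⟨u, ⟨⟨u, ⟨⟨hmax.1.1, le_rfl⟩, fun g hg => hg.2⟩, hmax.1.1,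
    constOutsideCompact_of_norm huC, fun x t ht => ?_, hmax.1.2.2.2⟩,
    ⟨w, hw, hw.1.1, constOutsideCompact_of_norm (R := R + 1 + K * T) (C₀ := C₀) fun z hz => ?_,
      fun x t ht => ?_, fun x t a b φ hφ hmin =>
        hP.super_test hN hκ hmax hw.1.2 hfreq hφ hmin⟩⟩, fun x t hx => huC (x, t) hx⟩
  · refine le_of_forall_pos_le_add fun ε hε => ?_
    obtain ⟨b, hb, hbε⟩ := hκ.dual.exists_mem_lowerBarriers (u₀ := fun x => -u₀ x)
      hu.neg (C₀ := -C₀) (M := M) (fun x => by rw [← neg_sub', abs_neg]; exact hM x) x hε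
    have h1 := hmax.1.2.2.1 (fun z => -b z) (neg_mem_upperBarriers hb) (x, t)
    simp only [ht] at h1
    linarith
  · exact le_antisymm ((hw.1.2 z).trans (huC z hz).le)
      ((hP.lower_eq z hz).ge.trans (hlow _ hP.continuous_lower hmax.1.2.1 z))
  · refine le_of_forall_pos_le_add fun ε hε => ?_
    obtain ⟨b, hb, hbε⟩ := hκ.exists_mem_lowerBarriers hu hM x hε
    have h1 := hlow b hb.1 (fun z => (le_max_left _ _).trans (hmax.2
      (hP.lower_mem hN hb.1 hb.2.1 fun W hW z => (le_of_mem_lowerBarriers hb _ z.2.2.1).trans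
        (le_of_mem_upperBarriers hW _ z.2.2.1)) z)) (x, t)
    simp only [ht] at h1
    linarith

end Existence

theorem mainTheorem4 {N : ℕ} (hN : 1 ≤ N) {ℓ : ℕ} (hℓ : 2 ≤ ℓ) {β : ℝ} (hβ : β ∈ Set.Icc (0 : ℝ) 1)
    (κ : Space N → Set (Space N) → ℝ) (hκ : IsNonlocalCurvature ℓ β κ)
    {R T : ℝ} (hR : 0 < R) (hT : 0 < T) :
    ∃ R' > R, ∀ (u₀ : Space N → ℝ) (C₀ : ℝ), UniformContinuous u₀ →
      (∀ x, R ≤ ‖x‖ → u₀ x = C₀) →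
      ∃ u : SpaceTime N T → ℝ, IsViscositySolution κ u₀ u ∧
        ∀ x t, R' ≤ ‖x‖ → u (x, t) = C₀ := by
  obtain ⟨K, hK⟩ := hκ.isSmoothCurvature hN hβ
  -- Radius at time `T` of a ball that starts from radius `R + 1` and grows with speed `K`.
  refine ⟨R + 1 + K * T, by nlinarith [mul_pos hK.K_pos hT], fun u₀ C₀ hu hC => ?_⟩
  exact hK.exists_viscositySolution hN hu hC
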